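/- Theorem 7.1. Setting. Let $T>0$ and let $(\Omega,\mathcal F,(\mathcal F_t)_{t\in[0,T]},\mathbf P)$ be a filtered probability space. Let $H_0$ and $H$ be real Hilbert spaces, $H$ separable, with $H_0\subset H$ and Hilbert–Schmidt embedding $J:H_0\to H$. Let $V$ be an $H$-valued $(\mathcal F_t)$-Wiener process on $[0,T]$ with continuous paths and covariance operator $Q=JJ^*$ (equivalently, $H_0=Q^{1/2}H$ with norm $|Q^{1/2}h|_{H_0}=|h|_H$ for $h\perp\ker Q^{1/2}$). Let $E$ be a Polish space, let $g^\varepsilon:C([0,T];H)\to E$ be Borel measurable for each $\varepsilon>0$, and let $\alpha(\varepsilon)$ be real numbers with $\alpha(\varepsilon)\to\infty$ as $\varepsilon\to0$. Let $\mathcal A$ be the class of $H_0$-valued $(\mathcal F_t)$-predictable processes $w$ with $\int_0^T|w(s)|_{H_0}^2ds<\infty$ a.s. For $M>0$ let $\mathcal S_M=\{w\in L^2(0,T;H_0):\int_0^T|w(s)|_{H_0}^2ds\le M\}$ with the weak topology of $L^2(0,T;H_0)$, and let $\mathcal A_M=\{w\in\mathcal A: w\in\mathcal S_M\text{ a.s.}\}$.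 Hypothesis $(\mathbf H)$. There is a Borel measurable map $g^0:C([0,T];H)\to E$ such that 1. for every $M>0$ and every family $\{w^\varepsilon:\varepsilon>0\}\subset\mathcal A_M$ that converges in distribution, as $\varepsilon\to0$, to some $\mathcal S_M$-valued random variable $w$ (as $\mathcal S_M$-valued random variables), $g^\varepsilon\bigl(V(\cdot)+\sqrt{\alpha(\varepsilon)}\int_0^{\cdot}w^\varepsilon(s)\,ds\bigr)$ converges in distribution in $E$ to $g^0\bigl(\int_0^{\cdot}w(s)\,ds\bigr)$; 2. for every $M<\infty$, the set $K_M=\{g^0(\int_0^{\cdot}w(s)\,ds): w\in\mathcal S_M\}$ is a compact subset of $E$. For such a $g^0$ and $y\in E$ put $$I(y)=\inf\Bigl\{\tfrac12\int_0^T|w(s)|_{H_0}^2ds:\ w\in L^2(0,T;H_0),\ y=g^0\bigl(\textstyle\int_0^{\cdot}w(s)\,ds\bigr)\Bigr\},\qquad \inf\emptyset=\infty. \tag{7.1}$$ Conclusion. Let $Y^\varepsilon=g^\varepsilon(V(\cdot))$. If $g^\varepsilon$ satisfies $(\mathbf H)$, then $\{Y^\varepsilon:\varepsilon>0\}$ satisfies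 the Laplace principle in $E$ with rate function $I$ and speed $\alpha(\varepsilon)$: the function $I:E\to[0,\infty]$ is lower semicontinuous, and for every bounded continuous $\hbar:E\to\mathbb R$, $$\lim_{\varepsilon\to0}\frac1{\alpha(\varepsilon)}\log\mathbf E\bigl\{\exp[-\alpha(\varepsilon)\hbar(Y^\varepsilon)]\bigr\}=-\inf_{y\in E}\{\hbar(y)+I(y)\}.$$ -/

import Mathlib

open Filter Topology MeasureTheory ProbabilityTheory
open scoped NNReal ENNReal RealInnerProductSpace BoundedContinuousFunction

noncomputable section

namespace LaplacePrincipleWiener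

/-! ### Time interval, parameter set, path spaces -/

/-- The time interval `[0, T]`. -/
abbrev Time (T : ℝ) : Type := Set.Icc (0 : ℝ) T

/-- Lebesgue measure on `[0, T]`. -/
def leb (T : ℝ) : Measure (Time T) := Measure.comap Subtype.val (volume : Measure ℝ)

theorem leb_apply {T : ℝ} (A : Set (Time T)) : leb T A = volume (Subtype.val '' A) :=
  (MeasurableEmbedding.subtype_coe measurableSet_Icc).comap_apply _ _

instance instIsFiniteMeasureLeb (T : ℝ) : IsFiniteMeasure (leb T) := ⟨by
  rw [leb_apply, Set.image_univ, Subtype.range_coe]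
  exact measure_Icc_lt_top⟩

instance instFactLe (T : ℝ) [h : Fact (0 < T)] : Fact ((0 : ℝ) ≤ T) := ⟨h.out.le⟩

/-- The parameters `ε > 0`. -/
abbrev Eps : Type := Set.Ioi (0 : ℝ)

/-- The filter of the limit `ε → 0` over `ε > 0`. -/
def smallEps : Filter Eps := Filter.comap (fun ε : Eps => (ε : ℝ)) (𝓝 0)

/-- The space `C([0, T]; H)`, with the topology of uniform convergence. -/
abbrev PathSpace (T : ℝ) (H : Type*) [TopologicalSpace H] : Type _ := C(Time T, H)

/-- `C([0, T]; H)` carries its Borel σ-algebra. -/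
instance instMeasurableSpacePathSpace (T : ℝ) (H : Type*) [TopologicalSpace H] :
    MeasurableSpace C(Set.Icc (0 : ℝ) T, H) := borel _

instance instBorelSpacePathSpace (T : ℝ) (H : Type*) [TopologicalSpace H] :
    BorelSpace C(Set.Icc (0 : ℝ) T, H) := ⟨rfl⟩

/-- The space `L²(0, T; H₀)`. -/
abbrev L2 (T : ℝ) (H₀ : Type*) [NormedAddCommGroup H₀] : Type _ :=
  Lp H₀ 2 (leb T)

/-- The energy `∫₀ᵀ |w(s)|² ds`. -/
def energy {T : ℝ} {H₀ : Type*} [NormedAddCommGroup H₀] (w : L2 T H₀) : ℝ :=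
  ∫ s, ‖w s‖ ^ 2 ∂(leb T)

theorem energy_eq_norm_sq {T : ℝ} {H₀ : Type*} [NormedAddCommGroup H₀] [InnerProductSpace ℝ H₀]
    (w : L2 T H₀) : energy w = ‖w‖ ^ 2 := by
  rw [← real_inner_self_eq_norm_sq, L2.inner_def]
  simp [energy]

/-- The ball `S_M` of all `w` in `L²(0, T; H₀)` with `∫₀ᵀ |w(s)|² ds ≤ M`. It is a type of its own,
since it carries the weak topology. -/
def SBall (T : ℝ) (H₀ : Type*) [NormedAddCommGroup H₀] [InnerProductSpace ℝ H₀]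
    (M : ℝ≥0) : Type _ := {w : L2 T H₀ // energy w ≤ M}

section SBall

variable {T : ℝ} {H₀ : Type*} [NormedAddCommGroup H₀] [InnerProductSpace ℝ H₀] {M : ℝ≥0}

/-- The inclusion of `S_M` in `L²(0, T; H₀)`. -/
def SBall.val (w : SBall T H₀ M) : L2 T H₀ := Subtype.val w

/-- `S_M` carries the topology induced by the weak topology of `L²(0, T; H₀)`. -/
instance instTopologicalSpaceSBall : TopologicalSpace (SBall T H₀ M) :=
  TopologicalSpace.induced (fun w => toWeakSpace ℝ (L2 T H₀) w.val) inferInstance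

instance instMeasurableSpaceSBall : MeasurableSpace (SBall T H₀ M) := borel _

instance instBorelSpaceSBall : BorelSpace (SBall T H₀ M) := ⟨rfl⟩

theorem energy_zero_le (M : ℝ≥0) : energy (0 : L2 T H₀) ≤ M := by
  rw [energy_eq_norm_sq]; simp

end SBall

/-! ### The primitive `∫₀^· w(s) ds` in `C([0, T]; H)` -/

section Primitive

theorem L2_integrable {T : ℝ} {H₀ : Type*} [NormedAddCommGroup H₀] (w : L2 T H₀) : Integrable w (leb T) :=
  (Lp.memLp w).integrable one_le_two

variable {T : ℝ} {H₀ H : Type*} [NormedAddCommGroup H₀] [InnerProductSpace ℝ H₀]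
  [NormedAddCommGroup H] [InnerProductSpace ℝ H]

theorem continuous_primitive_L2 (w : L2 T H₀) :
    Continuous fun t : Time T => ∫ s in Set.Iic t, w s ∂(leb T) := by
  simp_rw [← integral_indicator (measurableSet_Iic (α := Time T))]
  refine continuous_iff_continuousAt.2 fun t₀ => ?_
  refine continuousAt_of_dominated (bound := fun s => ‖w s‖) ?_ ?_ (L2_integrable w).norm ?_
  · exact Eventually.of_forall fun t =>
      (L2_integrable w).aestronglyMeasurable.indicator measurableSet_Iic
  · exact Eventually.of_forall fun t => Eventually.of_forall fun s =>
      norm_indicator_le_norm_self _ _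
  · have h0 : ∀ᵐ s ∂(leb T), s ≠ t₀ := by
      have : leb T {t₀} = 0 := by rw [leb_apply]; simp
      exact compl_mem_ae_iff.2 this
    filter_upwards [h0] with s hs
    rcases lt_or_gt_of_ne hs with h | h
    · refine (continuousAt_const (y := w s)).congr ?_
      filter_upwards [lt_mem_nhds h] with t ht
      rw [Set.indicator_of_mem (Set.mem_Iic.2 ht.le)]
    · refine (continuousAt_const (y := 0)).congr ?_
      filter_upwards [gt_mem_nhds h] with t ht
      rw [Set.indicator_of_notMem (fun h' => not_lt.2 (Set.mem_Iic.1 h') ht)]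

/-- The path `t ↦ ∫₀ᵗ w(s) ds`, as an element of `C([0, T]; H)`, for `w` in `L²(0, T; H₀)`. The
integral is taken in `H₀` and read in `H` through the embedding `J : H₀ → H`. -/
def primitive (J : H₀ →L[ℝ] H) (w : L2 T H₀) : PathSpace T H where
  toFun t := J (∫ s in Set.Iic t, w s ∂(leb T))
  continuous_toFun := J.continuous.comp (continuous_primitive_L2 w)

end Primitive

/-! ### Hilbert–Schmidt embeddings and Wiener processes -/

/-- A bounded operator `J` is Hilbert–Schmidt: `∑ |J e_i|² < ∞` for an orthonormal basis `(e_i)`. -/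
def IsHilbertSchmidt {H₀ H : Type*} [NormedAddCommGroup H₀] [InnerProductSpace ℝ H₀]
    [NormedAddCommGroup H] [InnerProductSpace ℝ H] (J : H₀ →L[ℝ] H) : Prop :=
  ∃ (ι : Set H₀) (e : HilbertBasis ι ℝ H₀), Summable fun i => ‖J (e i)‖ ^ 2

/-- `V` is an `H`-valued Wiener process on `[0, T]` with covariance operator `Q`, relative to the
filtration `ℱ`: a random element of `C([0, T]; H)`, started at `0` and adapted, such that for
`s ≤ t` the increment `V t - V s` is independent of `ℱ s` and centered Gaussian with covariance
operator `(t - s) Q`. -/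
structure IsWienerProcess {Ω : Type*} [mΩ : MeasurableSpace Ω] (P : Measure Ω) {T : ℝ}
    (ℱ : Filtration (Time T) mΩ) {H : Type*} [NormedAddCommGroup H] [InnerProductSpace ℝ H]
    [MeasurableSpace H] [BorelSpace H] [Fact (0 < T)] (Q : H →L[ℝ] H)
    (V : Ω → PathSpace T H) : Prop where
  measurable : Measurable V
  start : ∀ᵐ ω ∂P, V ω ⊥ = 0
  adapted : ∀ t : Time T, Measurable[ℱ t] fun ω => V ω t
  indep_increments : ∀ s t : Time T, s ≤ t →
    Indep (MeasurableSpace.comap (fun ω => V ω t - V ω s) inferInstance) (ℱ s) P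
  gaussian_increments : ∀ s t : Time T, s ≤ t → ∀ h : H,
    P.map (fun ω => ⟪h, V ω t - V ω s⟫) =
      gaussianReal 0 (Real.toNNReal (((t : ℝ) - (s : ℝ)) * ⟪h, Q h⟫))

/-! ### Controls -/

section Controls

variable {Ω : Type*} [mΩ : MeasurableSpace Ω] {T : ℝ} {H₀ : Type*} [NormedAddCommGroup H₀]
  [InnerProductSpace ℝ H₀]

/-- The class `𝒜` of `ℱ`-predictable `H₀`-valued processes `w` with `∫₀ᵀ |w(s)|² ds < ∞` a.s. -/
def IsControl [Fact (0 < T)] (P : Measure Ω) (ℱ : Filtration (Time T) mΩ)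
    (w : Time T → Ω → H₀) : Prop :=
  IsStronglyPredictable ℱ w ∧ ∀ᵐ ω ∂P, MemLp (fun s => w s ω) 2 (leb T)

open Classical in
/-- The path `w(·, ω)` as an element of `L²(0, T; H₀)` (zero if it is not square integrable). -/
def pathL2 (w : Time T → Ω → H₀) (ω : Ω) : L2 T H₀ :=
  if h : MemLp (fun s => w s ω) 2 (leb T) then h.toLp _ else 0

/-- The class `𝒜_M` of those `w` in `𝒜` whose paths lie in `S_M` a.s. -/
def IsControlBdd [Fact (0 < T)] (P : Measure Ω) (ℱ : Filtration (Time T) mΩ) (M : ℝ≥0)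
    (w : Time T → Ω → H₀) : Prop :=
  IsControl P ℱ w ∧ ∀ᵐ ω ∂P, energy (pathL2 w ω) ≤ M

open Classical in
/-- A process in `𝒜_M` as a random element of `S_M` (zero on the exceptional null set). -/
def toSBall (M : ℝ≥0) (w : Time T → Ω → H₀) (ω : Ω) : SBall T H₀ M :=
  if h : energy (pathL2 w ω) ≤ M then ⟨pathL2 w ω, h⟩ else ⟨0, energy_zero_le M⟩

end Controls

/-! ### Hypothesis (H), the rate function, the Laplace principle -/

section Main

variable {Ω : Type*} [mΩ : MeasurableSpace Ω] {T : ℝ} [Fact (0 < T)]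
  {H₀ H : Type*} [NormedAddCommGroup H₀] [InnerProductSpace ℝ H₀]
  [NormedAddCommGroup H] [InnerProductSpace ℝ H]
  {E : Type*} [TopologicalSpace E] [MeasurableSpace E] [BorelSpace E]

/-- Hypothesis (H) on the maps `g^ε`, with limit map `g⁰`.

In `weak_convergence` the limit `w` of the controls is a random element of `S_M`. As convergence in
distribution involves `w` only through its law `μ`, `w` is taken to be the identity map of
the probability space `(S_M, μ)`. -/
structure HypothesisH (P : Measure Ω) [IsProbabilityMeasure P] (ℱ : Filtration (Time T) mΩ)
    (J : H₀ →L[ℝ] H) (V : Ω → PathSpace T H) (α : Eps → ℝ)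
    (g : Eps → PathSpace T H → E) (g₀ : PathSpace T H → E) : Prop where
  measurable_limit : Measurable g₀
  weak_convergence : ∀ M : ℝ≥0, 0 < M →
    ∀ w : Eps → Time T → Ω → H₀, (∀ ε, IsControlBdd P ℱ M (w ε)) →
    ∀ (μ : Measure (SBall T H₀ M)) [IsProbabilityMeasure μ],
      TendstoInDistribution (fun ε => toSBall M (w ε)) smallEps
        (fun u : SBall T H₀ M => u) (fun _ => P) μ →
      TendstoInDistribution
        (fun ε ω => g ε (V ω + √(α ε) • primitive J (toSBall M (w ε) ω).val)) smallEps
        (fun u : SBall T H₀ M => g₀ (primitive J u.val)) (fun _ => P) μ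
  isCompact_levels : ∀ M : ℝ≥0,
    IsCompact {y : E | ∃ u : SBall T H₀ M, g₀ (primitive J u.val) = y}

/-- `I(y) = inf { ½ ∫₀ᵀ |w(s)|² ds : w ∈ L²(0, T; H₀), y = g⁰(∫₀^· w(s) ds) }`, with
`inf ∅ = ∞`. -/
def rate (J : H₀ →L[ℝ] H) (g₀ : PathSpace T H → E) (y : E) : ℝ≥0∞ :=
  ⨅ (w : L2 T H₀) (_ : y = g₀ (primitive J w)), ENNReal.ofReal (1 / 2 * energy w)

/-- The family `Y` satisfies the Laplace principle on `E` with rate function `I`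
(a lower semicontinuous function with values in `[0, ∞]`) and speed `α(ε) → ∞`. -/
structure LaplacePrinciple (P : Measure Ω) (Y : Eps → Ω → E) (I : E → ℝ≥0∞) (α : Eps → ℝ) :
    Prop where
  aemeasurable : ∀ ε, AEMeasurable (Y ε) P
  lowerSemicontinuous : LowerSemicontinuous I
  speed : Tendsto α smallEps atTop
  tendsto : ∀ h : E →ᵇ ℝ,
    Tendsto (fun ε => ((1 / α ε * Real.log (∫ ω, Real.exp (-(α ε) * h (Y ε ω)) ∂P) : ℝ) : EReal))
      smallEps (𝓝 (-(⨅ y : E, (((h y : ℝ) : EReal) + ((I y : ℝ≥0∞) : EReal)))))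

end Main

end LaplacePrincipleWiener

end

/-!
# The Laplace principle for functionals of a Hilbert space valued Wiener process

The scaled free energies `-(1/α) log E exp(-α h(Y))` are rewritten, up to small errors, as optimal
values of control problems, in which `V` is replaced by `V + √α ∫ w ds` at the cost `½ ∫ |w|² ds`.
Hypothesis (H) passes to the limit in these problems, and the limit problem is deterministic: its
value is the infimum of `½ ∫ |w|² ds + h(g⁰(∫ w ds))` over `L²(0, T; H₀)`, that is, of `h + I`
(`iInf_add_rate`).

**The variational formula.** Only controls that are constant on the slots of a uniform grid are
needed, and for these there is no stochastic calculus. For a smooth function `Φ` of finitely many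
observations `⟪e, V t⟫`, the controlled observations form a random walk in `ℝ^d`. By a third-order
Taylor expansion (`RegularPotential.abs_step_le`), one step of size `r²` changes the expected cost to
go by `½ r² E |w - w*|²`, up to `O(r³)`, where `w*` is the feedback control built from the
logarithmic gradient of the value function. As there are `T / r²` steps, the accumulated error
vanishes on fine grids: no control beats the free energy, and `w*` attains it
(`StepProcess.neg_log_le_cost`, `StepProcess.exists_cost_le`). Bounded measurable functions of the
path are approximated in `L¹` by smooth functions of finitely many observations
(`exists_smooth_obs`). For the upper bound the approximation must be good under the law of the
shifted path too, which depends on the control; this follows from the lower bound, applied to a large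
multiple of the approximation error, which plays the part of an entropy bound
(`IsWienerProcess.exists_le_neg_log`). A control is switched off when its energy becomes large, so
that all controls lie in one `S_M` (`IsWienerProcess.exists_scaled_le`).

**The Laplace principle.** Step functions are dense in `L²(0, T; H₀)`, and inserting deterministic
ones in the variational formula gives one bound (`eventually_neg_log_le`). For the other bound, nearly
optimal controls along a sequence `ε → 0` are random elements of `S_M`, which is compact and
metrizable in the weak topology, since the Hilbert–Schmidt embedding forces `H₀` to be separable.
Hence their laws have a limit point, and the energy is weakly lower semicontinuous
(`eventually_le_neg_log`). The sublevel sets of the rate function are intersections of the compact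
sets `K_M` (`lowerSemicontinuous_rate`).
-/

set_option linter.unusedSectionVars false

namespace LaplacePrincipleWiener

/-! ### One step of the discretised variational formula -/

/-- Third-order Taylor bound for `log (1 + D)`, away from the singularity. -/
theorem abs_log_one_add_sub_le {κ D : ℝ} (hκ : 0 < κ) (hκ1 : κ ≤ 1) (hD : κ ≤ 1 + D) :
    |Real.log (1 + D) - D + D ^ 2 / 2| ≤ 4 * |D| ^ 3 / κ := by
  have h3 : |D| ^ 3 ≤ |D| ^ 3 / κ := by
    rw [le_div_iff₀ hκ]
    exact mul_le_of_le_one_right (by positivity) hκ1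
  have key : |D| < 1 → |Real.log (1 + D) - D + D ^ 2 / 2| ≤ |D| ^ 3 / (1 - |D|) := by
    intro h
    have := Real.abs_log_sub_add_sum_range_le (x := -D) (by simpa using h) 2
    simp only [Finset.sum_range_succ, Finset.sum_range_zero, abs_neg] at this
    norm_num at this
    refine le_trans (le_of_eq ?_) this
    congr 1; ring
  rcases lt_or_ge D 0 with h0 | h0
  · have ha : |D| = -D := abs_of_neg h0
    refine (key (by rw [ha]; linarith)).trans ?_
    have h1 : |D| ^ 3 / (1 - |D|) ≤ |D| ^ 3 / κ := by
      apply div_le_div_of_nonneg_left (by positivity) hκ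
      rw [ha]; linarith
    refine h1.trans ?_
    apply div_le_div_of_nonneg_right _ hκ.le
    nlinarith [pow_nonneg (abs_nonneg D) 3]
  · have ha : |D| = D := abs_of_nonneg h0
    have h4 : 4 * |D| ^ 3 / κ = 4 * (|D| ^ 3 / κ) := by ring
    rw [h4]
    rcases lt_or_ge D (1 / 2) with h1 | h1
    · refine (key (by rw [ha]; linarith)).trans ?_
      have h1 : |D| ^ 3 / (1 - |D|) ≤ |D| ^ 3 / (1 / 2) := by
        apply div_le_div_of_nonneg_left (by positivity) (by norm_num)
        rw [ha]; linarith
      have : 0 ≤ |D| ^ 3 := by positivity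
      linarith
    · have hl1 : Real.log (1 + D) ≤ D := by
        have := Real.log_le_sub_one_of_pos (show 0 < 1 + D by linarith)
        linarith
      have hl0 : 0 ≤ Real.log (1 + D) := Real.log_nonneg (by linarith)
      rw [ha] at h3 ⊢
      have hD3 : D ≤ 4 * D ^ 3 := by nlinarith [mul_nonneg h0 (sub_nonneg.2 h1), sq_nonneg D]
      have hD2 : D ^ 2 / 2 ≤ D ^ 3 := by nlinarith [mul_nonneg (sq_nonneg D) (sub_nonneg.2 h1)]
      have hD30 : 0 ≤ D ^ 3 := by positivity
      rw [abs_le]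
      constructor <;> nlinarith [sq_nonneg D]

theorem abs_log_one_add_sub_self_le {κ A : ℝ} (hκ : 0 < κ) (hA : κ ≤ 1 + A) :
    |Real.log (1 + A) - A| ≤ A ^ 2 / κ := by
  have hpos : 0 < 1 + A := by linarith
  have h1 := Real.log_le_sub_one_of_pos hpos
  have h2 := Real.one_sub_inv_le_log_of_pos hpos
  have h3 : A ^ 2 / (1 + A) ≤ A ^ 2 / κ := div_le_div_of_nonneg_left (sq_nonneg A) hκ hA
  have h4 : 1 - (1 + A)⁻¹ = A - A ^ 2 / (1 + A) := by field_simp; ring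
  have h5 : 0 ≤ A ^ 2 / κ := by positivity
  rw [abs_le]
  constructor <;> linarith

variable {F : Type*} [NormedAddCommGroup F] [InnerProductSpace ℝ F]

/-- A function `Φ` with values in `[1/K, K]` whose gradient `G` is bounded by `K` and
`K`-Lipschitz. Differentiability enters only through the second-order Taylor estimate, so that the
class is visibly stable under averaging of translates. -/
structure RegularPotential (K : ℝ) (Φ : F → ℝ) (G : F → F) : Prop where
  one_le : 1 ≤ K
  lower : ∀ x, K⁻¹ ≤ Φ x
  upper : ∀ x, Φ x ≤ K
  grad_le : ∀ x, ‖G x‖ ≤ K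
  grad_lip : ∀ x y, ‖G x - G y‖ ≤ K * ‖x - y‖
  taylor : ∀ x y, |Φ (x + y) - Φ x - ⟪G x, y⟫| ≤ K * ‖y‖ ^ 2

namespace RegularPotential

variable {K : ℝ} {Φ : F → ℝ} {G : F → F}

theorem K_pos (h : RegularPotential K Φ G) : 0 < K := by linarith [h.one_le]

theorem pos (h : RegularPotential K Φ G) (x : F) : 0 < Φ x :=
  (inv_pos.2 h.K_pos).trans_le (h.lower x)

theorem inv_le (h : RegularPotential K Φ G) (x : F) : (Φ x)⁻¹ ≤ K :=
  inv_le_of_inv_le₀ h.K_pos (h.lower x)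

theorem continuous_grad (h : RegularPotential K Φ G) : Continuous G :=
  (LipschitzWith.of_dist_le_mul (K := ⟨K, h.K_pos.le⟩) fun x y => by
    rw [dist_eq_norm, dist_eq_norm]; exact h.grad_lip x y).continuous

theorem abs_sub_le (h : RegularPotential K Φ G) (x y : F) : |Φ (x + y) - Φ x| ≤ 2 * K * ‖y‖ := by
  have hK := h.one_le
  rcases le_or_gt ‖y‖ 1 with hy | hy
  · have h1 := abs_le.1 (h.taylor x y)
    have h2 := abs_le.1 ((abs_real_inner_le_norm (G x) y).trans
      (mul_le_mul_of_nonneg_right (h.grad_le x) (norm_nonneg y)))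
    have h3 : ‖y‖ ^ 2 ≤ ‖y‖ := by nlinarith [norm_nonneg y]
    have h4 : K * ‖y‖ ^ 2 ≤ K * ‖y‖ := mul_le_mul_of_nonneg_left h3 h.K_pos.le
    rw [abs_le]
    constructor <;> linarith [h1.1, h1.2, h2.1, h2.2]
  · have h1 := h.upper (x + y)
    have h2 := h.upper x
    have h3 := h.pos (x + y)
    have h4 := h.pos x
    have h5 : K ≤ K * ‖y‖ := le_mul_of_one_le_right h.K_pos.le hy.le
    rw [abs_le]
    constructor <;> linarith

theorem continuous (h : RegularPotential K Φ G) : Continuous Φ :=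
  (LipschitzWith.of_dist_le_mul (K := ⟨2 * K, by linarith [h.one_le]⟩) fun x y => by
    rw [dist_eq_norm, dist_eq_norm]
    have := h.abs_sub_le y (x - y)
    rwa [add_sub_cancel] at this).continuous

/-- The logarithmic gradient `∇ log Φ`. -/
noncomputable def logGrad (_h : RegularPotential K Φ G) (x : F) : F := (Φ x)⁻¹ • G x

theorem continuous_logGrad (h : RegularPotential K Φ G) : Continuous h.logGrad :=
  (h.continuous.inv₀ fun x => (h.pos x).ne').smul h.continuous_grad

theorem norm_logGrad_le (h : RegularPotential K Φ G) (x : F) : ‖h.logGrad x‖ ≤ K ^ 2 := by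
  rw [logGrad, norm_smul, norm_inv, Real.norm_of_nonneg (h.pos x).le, pow_two]
  exact mul_le_mul (h.inv_le x) (h.grad_le x) (norm_nonneg _) h.K_pos.le

/-- Second-order expansion of `log Φ`, for a displacement with a deterministic part of the order
`r²` and a random part `ξ` of the order `r`, with an error of the order `r³`. -/
theorem abs_log_sub_expansion_le (h : RegularPotential K Φ G) {r B : ℝ} (hr0 : 0 ≤ r) (hr1 : r ≤ 1)
    (hB : 1 ≤ B) (x b ξ : F) (hb : ‖b‖ ≤ B) :
    |Real.log (Φ (x + (r ^ 2 • b + ξ))) - (Real.log (Φ x) + (Φ x)⁻¹ * (Φ (x + ξ) - Φ x)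
      + r ^ 2 * ⟪h.logGrad x, b⟫ - 1 / 2 * ⟪h.logGrad x, ξ⟫ ^ 2)|
      ≤ 37 * K ^ 8 * (r * B + ‖ξ‖) ^ 3 := by
  have hK := h.one_le
  have hK0 := h.K_pos
  set z := r * B + ‖ξ‖ with hz
  set p := h.logGrad x with hp
  set y := r ^ 2 • b + ξ with hy
  set D := (Φ x)⁻¹ * (Φ (x + y) - Φ x) with hD
  have hφ := h.pos x
  have hpK : ‖p‖ ≤ K ^ 2 := h.norm_logGrad_le x
  have hrB : 0 ≤ r * B := by positivity
  have hz0 : 0 ≤ z := by positivity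
  have hξz : ‖ξ‖ ≤ z := by linarith
  have hrBz : r * B ≤ z := by linarith [norm_nonneg ξ]
  have hr2 : r ^ 2 * ‖b‖ ≤ r * B := by
    calc r ^ 2 * ‖b‖ ≤ r ^ 2 * B := by gcongr
      _ = r * (r * B) := by ring
      _ ≤ 1 * (r * B) := by gcongr
      _ = r * B := one_mul _
  have hr2b : r ^ 2 * ‖b‖ ≤ z ^ 2 := by
    calc r ^ 2 * ‖b‖ ≤ r ^ 2 * B := by gcongr
      _ ≤ r ^ 2 * B ^ 2 := by gcongr; nlinarith
      _ = (r * B) ^ 2 := by ring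
      _ ≤ z ^ 2 := by gcongr
  have hyz : ‖y‖ ≤ z := by
    refine (norm_add_le _ _).trans ?_
    rw [norm_smul, Real.norm_of_nonneg (by positivity)]
    linarith
  have hD1 : |D| ≤ 2 * K ^ 2 * z := by
    rw [hD, abs_mul, abs_of_pos (inv_pos.2 hφ)]
    calc (Φ x)⁻¹ * |Φ (x + y) - Φ x| ≤ K * (2 * K * z) :=
          mul_le_mul (h.inv_le x) ((h.abs_sub_le x y).trans (by gcongr)) (abs_nonneg _) hK0.le
      _ = 2 * K ^ 2 * z := by ring
  -- `log (1 + D) = D - D²/2 + O(z³)`, where `D = Φ(x + y)/Φ(x) - 1` is of the order `z`.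
  have hlow : (K ^ 2)⁻¹ ≤ 1 + D := by
    have : 1 + D = (Φ x)⁻¹ * Φ (x + y) := by rw [hD]; field_simp; ring
    rw [this, pow_two, mul_inv]
    exact mul_le_mul ((inv_le_inv₀ hK0 hφ).2 (h.upper x)) (h.lower _) (by positivity) (by positivity)
  have hlog : Real.log (Φ (x + y)) = Real.log (Φ x) + Real.log (1 + D) := by
    have : Φ (x + y) = Φ x * (1 + D) := by rw [hD]; field_simp; ring
    rw [this, Real.log_mul hφ.ne']
    exact (lt_of_lt_of_le (by positivity) hlow).ne'
  have e1 : |Real.log (1 + D) - D + D ^ 2 / 2| ≤ 32 * K ^ 8 * z ^ 3 := by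
    refine (abs_log_one_add_sub_le (by positivity) ?_ hlow).trans ?_
    · exact inv_le_one_of_one_le₀ (one_le_pow₀ hK)
    · rw [div_inv_eq_mul]
      calc 4 * |D| ^ 3 * K ^ 2 ≤ 4 * (2 * K ^ 2 * z) ^ 3 * K ^ 2 := by gcongr
        _ = 32 * K ^ 8 * z ^ 3 := by ring
  -- In `D²` only `⟪p, ξ⟫²` matters: the rest of `D` is of the order `z²`.
  have hpξ : |⟪p, ξ⟫| ≤ K ^ 2 * z :=
    (abs_real_inner_le_norm _ _).trans (mul_le_mul hpK hξz (norm_nonneg _) (by positivity))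
  have hDlin : |D - ⟪p, y⟫| ≤ K ^ 2 * z ^ 2 := by
    have : D - ⟪p, y⟫ = (Φ x)⁻¹ * (Φ (x + y) - Φ x - ⟪G x, y⟫) := by
      rw [hp, logGrad, real_inner_smul_left, hD]; ring
    rw [this, abs_mul, abs_of_pos (inv_pos.2 hφ)]
    calc (Φ x)⁻¹ * |Φ (x + y) - Φ x - ⟪G x, y⟫| ≤ K * (K * z ^ 2) :=
          mul_le_mul (h.inv_le x) ((h.taylor x y).trans (by gcongr)) (abs_nonneg _) hK0.le
      _ = K ^ 2 * z ^ 2 := by ring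
  have hpb : |r ^ 2 * ⟪p, b⟫| ≤ K ^ 2 * z ^ 2 := by
    rw [abs_mul, abs_of_nonneg (by positivity : (0:ℝ) ≤ r ^ 2)]
    calc r ^ 2 * |⟪p, b⟫| ≤ r ^ 2 * (K ^ 2 * ‖b‖) := by
          gcongr
          exact (abs_real_inner_le_norm _ _).trans (by gcongr)
      _ = K ^ 2 * (r ^ 2 * ‖b‖) := by ring
      _ ≤ K ^ 2 * z ^ 2 := by gcongr
  have hDξ : |D - ⟪p, ξ⟫| ≤ 2 * K ^ 2 * z ^ 2 := by
    have : D - ⟪p, ξ⟫ = (D - ⟪p, y⟫) + r ^ 2 * ⟪p, b⟫ := by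
      rw [hy, inner_add_right, real_inner_smul_right]; ring
    rw [this]
    refine (abs_add_le _ _).trans ?_
    linarith
  have e2 : |D ^ 2 - ⟪p, ξ⟫ ^ 2| ≤ 6 * K ^ 4 * z ^ 3 := by
    have : D ^ 2 - ⟪p, ξ⟫ ^ 2 = (D - ⟪p, ξ⟫) * (D + ⟪p, ξ⟫) := by ring
    rw [this, abs_mul]
    calc |D - ⟪p, ξ⟫| * |D + ⟪p, ξ⟫| ≤ (2 * K ^ 2 * z ^ 2) * (2 * K ^ 2 * z + K ^ 2 * z) := by
          gcongr
          exact (abs_add_le _ _).trans (by gcongr)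
      _ = 6 * K ^ 4 * z ^ 3 := by ring
  -- In `D` the deterministic part `r² b` contributes `r² ⟪p, b⟫`, as the gradient at `x + ξ`
  -- differs from the one at `x` by `O(z)`.
  have e3 : |D - (Φ x)⁻¹ * (Φ (x + ξ) - Φ x) - r ^ 2 * ⟪p, b⟫| ≤ 2 * K ^ 2 * z ^ 3 := by
    have hsplit : D - (Φ x)⁻¹ * (Φ (x + ξ) - Φ x) - r ^ 2 * ⟪p, b⟫
        = (Φ x)⁻¹ * ((Φ (x + ξ + r ^ 2 • b) - Φ (x + ξ) - ⟪G (x + ξ), r ^ 2 • b⟫)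
          + r ^ 2 * ⟪G (x + ξ) - G x, b⟫) := by
      have : x + y = x + ξ + r ^ 2 • b := by rw [hy]; abel
      rw [hD, this, hp, logGrad, real_inner_smul_left, real_inner_smul_right, inner_sub_left]
      ring
    rw [hsplit, abs_mul, abs_of_pos (inv_pos.2 hφ)]
    have t1 : |Φ (x + ξ + r ^ 2 • b) - Φ (x + ξ) - ⟪G (x + ξ), r ^ 2 • b⟫| ≤ K * z ^ 3 := by
      refine (h.taylor _ _).trans ?_
      gcongr
      rw [norm_smul, Real.norm_of_nonneg (by positivity)]
      calc (r ^ 2 * ‖b‖) ^ 2 = (r ^ 2 * ‖b‖) * (r ^ 2 * ‖b‖) := by ring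
        _ ≤ z ^ 2 * z := by gcongr; exact hr2.trans hrBz
        _ = z ^ 3 := by ring
    have t2 : |r ^ 2 * ⟪G (x + ξ) - G x, b⟫| ≤ K * z ^ 3 := by
      rw [abs_mul, abs_of_nonneg (by positivity : (0:ℝ) ≤ r ^ 2)]
      have hl : ‖G (x + ξ) - G x‖ ≤ K * z := by
        refine (h.grad_lip _ _).trans ?_
        rw [add_sub_cancel_left]; gcongr
      calc r ^ 2 * |⟪G (x + ξ) - G x, b⟫| ≤ r ^ 2 * (K * z * ‖b‖) := by
            gcongr
            exact (abs_real_inner_le_norm _ _).trans (by gcongr)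
        _ = K * z * (r ^ 2 * ‖b‖) := by ring
        _ ≤ K * z * z ^ 2 := by gcongr
        _ = K * z ^ 3 := by ring
    calc _ ≤ K * (K * z ^ 3 + K * z ^ 3) :=
          mul_le_mul (h.inv_le x) ((abs_add_le _ _).trans (add_le_add t1 t2)) (abs_nonneg _) hK0.le
      _ = 2 * K ^ 2 * z ^ 3 := by ring
  rw [hlog]
  have hz3 : 0 ≤ z ^ 3 := by positivity
  have k2 : K ^ 2 ≤ K ^ 8 := pow_le_pow_right₀ hK (by norm_num)
  have k4 : K ^ 4 ≤ K ^ 8 := pow_le_pow_right₀ hK (by norm_num)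
  have k2' : K ^ 2 * z ^ 3 ≤ K ^ 8 * z ^ 3 := by gcongr
  have k4' : K ^ 4 * z ^ 3 ≤ K ^ 8 * z ^ 3 := by gcongr
  have a1 := abs_le.1 e1
  have a2 := abs_le.1 e2
  have a3 := abs_le.1 e3
  rw [abs_le]
  constructor <;> linarith [a1.1, a1.2, a2.1, a2.2, a3.1, a3.2]

end RegularPotential

theorem RegularPotential.abs_log_le {K : ℝ} {Φ : F → ℝ} {G : F → F}
    (h : RegularPotential K Φ G) (x : F) : |Real.log (Φ x)| ≤ Real.log K := by
  rw [abs_le]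
  constructor
  · rw [← Real.log_inv]
    exact Real.log_le_log (inv_pos.2 h.K_pos) (h.lower x)
  · exact Real.log_le_log (h.pos x) (h.upper x)

variable [MeasurableSpace F]

/-- The moments of a centred increment of size `r`. -/
structure StepMoments (r C : ℝ) (ν : Measure F) : Prop where
  memLp : MemLp (fun ξ : F => ξ) 3 ν
  mean : ∀ p : F, ∫ ξ, ⟪p, ξ⟫ ∂ν = 0
  second : ∫ ξ, ‖ξ‖ ^ 2 ∂ν ≤ C * r ^ 2
  third : ∫ ξ, ‖ξ‖ ^ 3 ∂ν ≤ C * r ^ 3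

namespace StepMoments

variable {r C : ℝ} {ν : Measure F}

theorem integrable_cube (h : StepMoments r C ν) :
    Integrable (fun ξ => ‖ξ‖ ^ 3) ν := by
  simpa using h.memLp.integrable_norm_pow (p := 3) (by norm_num)

theorem integrable_sq [IsFiniteMeasure ν] (h : StepMoments r C ν) :
    Integrable (fun ξ => ‖ξ‖ ^ 2) ν := by
  have : MemLp (fun ξ : F => ξ) 2 ν := h.memLp.mono_exponent (by norm_num)
  simpa using this.integrable_norm_pow (p := 2) (by norm_num)

theorem integrable_inner [IsFiniteMeasure ν] (h : StepMoments r C ν) (p : F) :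
    Integrable (fun ξ => ⟪p, ξ⟫) ν :=
  (h.memLp.integrable (by norm_num)).const_inner p

theorem integrable_inner_sq [IsFiniteMeasure ν] (h : StepMoments r C ν) (p : F) :
    Integrable (fun ξ => ⟪p, ξ⟫ ^ 2) ν := by
  have : MemLp (fun ξ : F => ⟪p, ξ⟫) 2 ν :=
    (h.memLp.mono_exponent (by norm_num)).const_inner p
  exact this.integrable_sq

end StepMoments

variable [BorelSpace F] {K : ℝ} {Φ : F → ℝ} {G : F → F}

theorem RegularPotential.integrable_translate [SecondCountableTopology F] {Ω : Type*}
    [MeasurableSpace Ω] {P : Measure Ω} [IsFiniteMeasure P] (h : RegularPotential K Φ G)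
    {X : Ω → F} (hX : Measurable X) : Integrable (fun ω => Φ (X ω)) P :=
  Integrable.of_bound (h.continuous.measurable.comp hX).aestronglyMeasurable K
    (Eventually.of_forall fun ω => by
      rw [Real.norm_of_nonneg (h.pos _).le]; exact h.upper _)

theorem RegularPotential.integrable_log [SecondCountableTopology F] {Ω : Type*}
    [MeasurableSpace Ω] {P : Measure Ω} [IsFiniteMeasure P] (h : RegularPotential K Φ G)
    {X : Ω → F} (hX : Measurable X) : Integrable (fun ω => Real.log (Φ (X ω))) P :=
  Integrable.of_bound
    ((h.continuous.measurable.comp hX).log).aestronglyMeasurable (Real.log K)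
    (Eventually.of_forall fun _ => h.abs_log_le _)

/-- The constant in the error `O(r³)` of one step. -/
def stepConst (K B C : ℝ) : ℝ := 37 * K ^ 8 * (4 * (B ^ 3 + C)) + K ^ 2 * (K ^ 2 * C) ^ 2

/-- One step of size `r² = h`: shifting the Gaussian increment by `r² b` changes the mean of
`log Φ` by `r² ⟪∇ log Φ, b⟫`, and Jensen's gap is `½ E ⟪∇ log Φ, ξ⟫²`, up to order `r³`. -/
theorem RegularPotential.abs_step_le [SecondCountableTopology F] {ν : Measure F}
    [IsProbabilityMeasure ν] (h : RegularPotential K Φ G) {r B C : ℝ} (hr0 : 0 ≤ r) (hr1 : r ≤ 1)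
    (hB : 1 ≤ B) (hν : StepMoments r C ν) (x b : F) (hb : ‖b‖ ≤ B) :
    |∫ ξ, Real.log (Φ (x + (r ^ 2 • b + ξ))) ∂ν - Real.log (∫ ξ, Φ (x + ξ) ∂ν)
      - r ^ 2 * ⟪h.logGrad x, b⟫ + 1 / 2 * ∫ ξ, ⟪h.logGrad x, ξ⟫ ^ 2 ∂ν|
      ≤ stepConst K B C * r ^ 3 := by
  have hK := h.one_le
  have hK0 := h.K_pos
  have hφ := h.pos x
  set p := h.logGrad x with hp
  have iΦ : Integrable (fun ξ => Φ (x + ξ)) ν := h.integrable_translate (measurable_const_add x)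
  have iL : Integrable (fun ξ => Real.log (Φ (x + (r ^ 2 • b + ξ)))) ν :=
    h.integrable_log ((measurable_const_add (r ^ 2 • b)).const_add x)
  have i2 : Integrable (fun ξ => ⟪p, ξ⟫ ^ 2) ν := hν.integrable_inner_sq p
  have i3 := hν.integrable_cube
  have iA : Integrable (fun ξ => (Φ x)⁻¹ * (Φ (x + ξ) - Φ x)) ν :=
    (iΦ.sub (integrable_const _)).const_mul _
  set A := ∫ ξ, (Φ x)⁻¹ * (Φ (x + ξ) - Φ x) ∂ν with hA
  have hAeq : ∫ ξ, Φ (x + ξ) ∂ν = Φ x * (1 + A) := by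
    rw [hA, integral_const_mul, integral_sub iΦ (integrable_const _)]
    simp only [integral_const, probReal_univ, one_smul]
    field_simp
    ring
  -- `A` is the relative increase of the mean; it cancels against the logarithm of the mean below.
  have iE : Integrable (fun ξ => Real.log (Φ x) + (Φ x)⁻¹ * (Φ (x + ξ) - Φ x)
      + r ^ 2 * ⟪p, b⟫ - 1 / 2 * ⟪p, ξ⟫ ^ 2) ν :=
    (((integrable_const _).add iA).add (integrable_const _)).sub (i2.const_mul _)
  have hE : ∫ ξ, (Real.log (Φ x) + (Φ x)⁻¹ * (Φ (x + ξ) - Φ x)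
      + r ^ 2 * ⟪p, b⟫ - 1 / 2 * ⟪p, ξ⟫ ^ 2) ∂ν
      = Real.log (Φ x) + A + r ^ 2 * ⟪p, b⟫ - 1 / 2 * ∫ ξ, ⟪p, ξ⟫ ^ 2 ∂ν := by
    have j1 : Integrable (fun ξ => Real.log (Φ x) + (Φ x)⁻¹ * (Φ (x + ξ) - Φ x)) ν :=
      (integrable_const _).add iA
    have j2 : Integrable (fun ξ => Real.log (Φ x) + (Φ x)⁻¹ * (Φ (x + ξ) - Φ x)
      + r ^ 2 * ⟪p, b⟫) ν := j1.add (integrable_const _)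
    rw [integral_sub j2 (i2.const_mul _), integral_add j1 (integrable_const _),
      integral_add (integrable_const _) iA, integral_const_mul (1 / 2 : ℝ)]
    simp [hA]
  have iz : Integrable (fun ξ => 37 * K ^ 8 * (4 * ((r * B) ^ 3 + ‖ξ‖ ^ 3))) ν :=
    (((integrable_const _).add i3).const_mul _).const_mul _
  have hmain : |∫ ξ, Real.log (Φ (x + (r ^ 2 • b + ξ))) ∂ν
      - (Real.log (Φ x) + A + r ^ 2 * ⟪p, b⟫ - 1 / 2 * ∫ ξ, ⟪p, ξ⟫ ^ 2 ∂ν)|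
      ≤ 37 * K ^ 8 * (4 * (B ^ 3 + C)) * r ^ 3 := by
    rw [← hE, ← integral_sub iL iE]
    rw [← Real.norm_eq_abs]
    calc _ ≤ ∫ ξ, 37 * K ^ 8 * (4 * ((r * B) ^ 3 + ‖ξ‖ ^ 3)) ∂ν := by
          refine norm_integral_le_of_norm_le iz (Eventually.of_forall fun ξ => ?_)
          refine (h.abs_log_sub_expansion_le hr0 hr1 hB x b ξ hb).trans ?_
          gcongr
          have ha : 0 ≤ r * B := by positivity
          have hn := norm_nonneg ξ
          nlinarith [mul_nonneg (add_nonneg ha hn) (sq_nonneg (r * B - ‖ξ‖))]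
      _ = 37 * K ^ 8 * (4 * ((r * B) ^ 3 + ∫ ξ, ‖ξ‖ ^ 3 ∂ν)) := by
          rw [integral_const_mul, integral_const_mul, integral_add (integrable_const _) i3]
          simp
      _ ≤ 37 * K ^ 8 * (4 * ((r * B) ^ 3 + C * r ^ 3)) := by
          have := hν.third
          gcongr
      _ = 37 * K ^ 8 * (4 * (B ^ 3 + C)) * r ^ 3 := by ring
  -- Since `ξ` is centred, `A` is of the order `r²` only, and `log (1 + A) = A + O(r⁴)`.
  have hA2 : |A| ≤ K ^ 2 * C * r ^ 2 := by
    have hAlin : A = ∫ ξ, (Φ x)⁻¹ * (Φ (x + ξ) - Φ x - ⟪G x, ξ⟫) ∂ν := by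
      have j : Integrable (fun ξ => Φ (x + ξ) - Φ x) ν := iΦ.sub (integrable_const _)
      rw [hA, integral_const_mul, integral_const_mul, integral_sub j (hν.integrable_inner _),
        hν.mean, sub_zero]
    rw [hAlin, ← Real.norm_eq_abs]
    calc _ ≤ ∫ ξ, K ^ 2 * ‖ξ‖ ^ 2 ∂ν := by
          refine norm_integral_le_of_norm_le (hν.integrable_sq.const_mul _)
            (Eventually.of_forall fun ξ => ?_)
          rw [norm_mul, norm_inv, Real.norm_of_nonneg hφ.le, Real.norm_eq_abs]
          calc _ ≤ K * (K * ‖ξ‖ ^ 2) :=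
                mul_le_mul (h.inv_le x) (h.taylor x ξ) (abs_nonneg _) hK0.le
            _ = K ^ 2 * ‖ξ‖ ^ 2 := by ring
      _ = K ^ 2 * ∫ ξ, ‖ξ‖ ^ 2 ∂ν := integral_const_mul _ _
      _ ≤ K ^ 2 * (C * r ^ 2) := by gcongr; exact hν.second
      _ = K ^ 2 * C * r ^ 2 := by ring
  have hlow : (K ^ 2)⁻¹ ≤ 1 + A := by
    have h1 : K⁻¹ ≤ ∫ ξ, Φ (x + ξ) ∂ν := by
      have := integral_mono (integrable_const (μ := ν) K⁻¹) iΦ (fun ξ => h.lower _)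
      simpa using this
    have h2 : 1 + A = (Φ x)⁻¹ * ∫ ξ, Φ (x + ξ) ∂ν := by rw [hAeq]; field_simp
    rw [h2, pow_two, mul_inv]
    exact mul_le_mul ((inv_le_inv₀ hK0 hφ).2 (h.upper x)) h1 (by positivity) (by positivity)
  have hlog : Real.log (∫ ξ, Φ (x + ξ) ∂ν) = Real.log (Φ x) + Real.log (1 + A) := by
    rw [hAeq, Real.log_mul hφ.ne']
    exact (lt_of_lt_of_le (by positivity) hlow).ne'
  have hl : |Real.log (1 + A) - A| ≤ K ^ 2 * (K ^ 2 * C) ^ 2 * r ^ 3 := by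
    refine (abs_log_one_add_sub_self_le (by positivity) hlow).trans ?_
    rw [div_inv_eq_mul, ← sq_abs]
    have hr43 : r ^ 4 ≤ r ^ 3 := pow_le_pow_of_le_one hr0 hr1 (by norm_num)
    calc |A| ^ 2 * K ^ 2 ≤ (K ^ 2 * C * r ^ 2) ^ 2 * K ^ 2 := by gcongr
      _ = K ^ 2 * (K ^ 2 * C) ^ 2 * r ^ 4 := by ring
      _ ≤ K ^ 2 * (K ^ 2 * C) ^ 2 * r ^ 3 := by gcongr
  rw [hlog, stepConst]
  have a1 := abs_le.1 hmain
  have a2 := abs_le.1 hl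
  rw [abs_le]
  constructor <;> linarith [a1.1, a1.2, a2.1, a2.2]

/-- The class of regular potentials is stable under averaging of translates. -/
theorem RegularPotential.average [SecondCountableTopology F] [CompleteSpace F]
    (h : RegularPotential K Φ G) (ν : Measure F) [IsProbabilityMeasure ν] :
    RegularPotential K (fun x => ∫ ξ, Φ (x + ξ) ∂ν) (fun x => ∫ ξ, G (x + ξ) ∂ν) := by
  have iΦ : ∀ x, Integrable (fun ξ => Φ (x + ξ)) ν := fun x =>
    h.integrable_translate (measurable_const_add x)
  have iG : ∀ x, Integrable (fun ξ => G (x + ξ)) ν := fun x =>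
    Integrable.of_bound (h.continuous_grad.comp (continuous_const_add x)).aestronglyMeasurable K
      (Eventually.of_forall fun ξ => h.grad_le _)
  refine ⟨h.one_le, fun x => ?_, fun x => ?_, fun x => ?_, fun x y => ?_, fun x y => ?_⟩
  · simpa using integral_mono (integrable_const (μ := ν) K⁻¹) (iΦ x) (fun ξ => h.lower _)
  · simpa using integral_mono (iΦ x) (integrable_const (μ := ν) K) (fun ξ => h.upper _)
  · simpa using norm_integral_le_of_norm_le (integrable_const (μ := ν) K)
      (Eventually.of_forall fun ξ => h.grad_le (x + ξ))
  · rw [← integral_sub (iG x) (iG y)]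
    simpa using norm_integral_le_of_norm_le (integrable_const (μ := ν) (K * ‖x - y‖))
      (Eventually.of_forall fun ξ => (h.grad_lip (x + ξ) (y + ξ)).trans (by simp))
  · have : ⟪∫ ξ, G (x + ξ) ∂ν, y⟫ = ∫ ξ, ⟪G (x + ξ), y⟫ ∂ν := by
      rw [real_inner_comm, ← integral_inner (iG x)]
      simp_rw [real_inner_comm]
    have j : Integrable (fun ξ => Φ (x + y + ξ) - Φ (x + ξ)) ν := (iΦ _).sub (iΦ _)
    rw [this, ← integral_sub (iΦ _) (iΦ _), ← integral_sub j ((iG x).inner_const y)]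
    have key : ‖∫ ξ, (Φ (x + y + ξ) - Φ (x + ξ) - ⟪G (x + ξ), y⟫) ∂ν‖ ≤ ∫ _, K * ‖y‖ ^ 2 ∂ν := by
      refine norm_integral_le_of_norm_le (integrable_const _) (Eventually.of_forall fun ξ => ?_)
      have := h.taylor (x + ξ) y
      rwa [add_right_comm] at this
    simpa using key

/-! ### The discrete variational formula -/

/-- Conditioning on `Y` of a function of two independent variables. -/
theorem integral_comp_of_indepFun {Ω 𝒴 𝒵 : Type*} [MeasurableSpace Ω] [MeasurableSpace 𝒴]
    [MeasurableSpace 𝒵] {P : Measure Ω} [IsProbabilityMeasure P] {Y : Ω → 𝒴} {Z : Ω → 𝒵}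
    (hY : Measurable Y) (hZ : Measurable Z) (h : IndepFun Y Z P) {f : 𝒴 × 𝒵 → ℝ}
    (hf : Measurable f) {C : ℝ} (hC : ∀ x, |f x| ≤ C) :
    Integrable (fun ω => ∫ z, f (Y ω, z) ∂(P.map Z)) P ∧
    ∫ ω, f (Y ω, Z ω) ∂P = ∫ ω, ∫ z, f (Y ω, z) ∂(P.map Z) ∂P := by
  have : IsProbabilityMeasure (P.map Y) := Measure.isProbabilityMeasure_map hY.aemeasurable
  have : IsProbabilityMeasure (P.map Z) := Measure.isProbabilityMeasure_map hZ.aemeasurable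
  have hmap := (indepFun_iff_map_prod_eq_prod_map_map hY.aemeasurable hZ.aemeasurable).1 h
  have hi : Integrable f ((P.map Y).prod (P.map Z)) :=
    Integrable.of_bound hf.aestronglyMeasurable C (Eventually.of_forall hC)
  refine ⟨hi.integral_prod_left.comp_measurable hY, ?_⟩
  rw [← integral_map (f := f) (hY.prodMk hZ).aemeasurable hf.aestronglyMeasurable, hmap,
    integral_prod f hi]
  exact integral_map (f := fun y => ∫ z, f (y, z) ∂(P.map Z)) hY.aemeasurable
    hi.integral_prod_left.aestronglyMeasurable

variable {F : Type*} [NormedAddCommGroup F] [InnerProductSpace ℝ F] [MeasurableSpace F]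
  {H₀ : Type*} [NormedAddCommGroup H₀] [InnerProductSpace ℝ H₀]

/-- The value functions of backward induction: `backward ν N f n` averages `f` over the last `n`
of the `N` increments, whose laws are `ν 0, …, ν (N - 1)`. -/
noncomputable def backward {E' : Type*} [NormedAddCommGroup E'] [NormedSpace ℝ E']
    (ν : ℕ → Measure F) (N : ℕ) (f : F → E') : ℕ → F → E'
  | 0 => f
  | n + 1 => fun x => ∫ y, backward ν N f n (x + y) ∂(ν (N - 1 - n))

theorem RegularPotential.backward [FiniteDimensional ℝ F] [BorelSpace F] {K : ℝ} {Φ : F → ℝ} {G : F → F} (h : RegularPotential K Φ G)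
    {ν : ℕ → Measure F} {N : ℕ} (hν : ∀ k < N, IsProbabilityMeasure (ν k)) (n : ℕ) (hn : n ≤ N) :
    RegularPotential K (backward ν N Φ n) (backward ν N G n) := by
  induction n with
  | zero => exact h
  | succ n ih =>
    have := hν (N - 1 - n) (by omega)
    exact (ih (by omega)).average _

/-- Increments `ξ k` of a discrete-time process in `F`, each independent of the past, of size `r`
and with covariance `r² S_k† S_k`. -/
structure StepProcess {Ω : Type*} [mΩ : MeasurableSpace Ω] (P : Measure Ω)
    (𝓕 : ℕ → MeasurableSpace Ω) (N : ℕ) (r C : ℝ) (ξ : ℕ → Ω → F) (S : ℕ → F →L[ℝ] H₀) :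
    Prop where
  le : ∀ k, 𝓕 k ≤ mΩ
  mono : Monotone 𝓕
  adapted : ∀ k < N, Measurable[𝓕 (k + 1)] (ξ k)
  indep : ∀ k < N, Indep (MeasurableSpace.comap (ξ k) inferInstance) (𝓕 k) P
  moments : ∀ k < N, StepMoments r C (P.map (ξ k))
  cov : ∀ k < N, ∀ p : F, ∫ y, ⟪p, y⟫ ^ 2 ∂(P.map (ξ k)) = r ^ 2 * ‖S k p‖ ^ 2

/-- The controlled walk `X_{k+1} = X_k + r² R_k w_k + ξ_k` started at `0`. -/
def walk {Ω : Type*} (r : ℝ) (R : ℕ → H₀ →L[ℝ] F) (ξ : ℕ → Ω → F) (w : ℕ → Ω → H₀) :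
    ℕ → Ω → F
  | 0 => fun _ => 0
  | k + 1 => fun ω => walk r R ξ w k ω + (r ^ 2 • R k (w k ω) + ξ k ω)

namespace StepProcess

variable {Ω : Type*} [mΩ : MeasurableSpace Ω] {P : Measure Ω}
  {𝓕 : ℕ → MeasurableSpace Ω} {N : ℕ} {r C : ℝ} {ξ : ℕ → Ω → F} {S : ℕ → F →L[ℝ] H₀}
  {R : ℕ → H₀ →L[ℝ] F} {K B : ℝ} {Φ : F → ℝ} {G : F → F} {w : ℕ → Ω → H₀}

theorem measurable (h : StepProcess P 𝓕 N r C ξ S) {k : ℕ} (hk : k < N) : Measurable (ξ k) :=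
  (h.adapted k hk).mono (h.le _) le_rfl

variable [FiniteDimensional ℝ F] [BorelSpace F]

theorem measurable_walk (h : StepProcess P 𝓕 N r C ξ S)
    (hw : ∀ k < N, StronglyMeasurable[𝓕 k] (w k)) {k : ℕ} (hk : k ≤ N) :
    Measurable[𝓕 k] (walk r R ξ w k) := by
  induction k with
  | zero => exact measurable_const
  | succ k ih =>
    have h1 : Measurable[𝓕 (k + 1)] (walk r R ξ w k) :=
      (ih (by omega)).mono (h.mono (Nat.le_succ k)) le_rfl
    have h2 : Measurable[𝓕 (k + 1)] fun ω => R k (w k ω) :=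
      (((R k).continuous.comp_stronglyMeasurable (hw k (by omega))).measurable).mono
        (h.mono (Nat.le_succ k)) le_rfl
    exact h1.add ((h2.const_smul (r ^ 2)).add (h.adapted k (by omega)))

variable [IsProbabilityMeasure P]

theorem isProbabilityMeasure (h : StepProcess P 𝓕 N r C ξ S) {k : ℕ} (hk : k < N) :
    IsProbabilityMeasure (P.map (ξ k)) :=
  Measure.isProbabilityMeasure_map (h.measurable hk).aemeasurable

/-- One step of the controlled walk changes the expected cost-to-go by half the squared distance
of the control to the optimal one, up to order `r³`. -/
theorem abs_cost_step_le (h : StepProcess P 𝓕 N r C ξ S)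
    (hRS : ∀ k p a, ⟪p, R k a⟫ = ⟪S k p, a⟫) (hr0 : 0 ≤ r) (hr1 : r ≤ 1)
    {U V : F → ℝ} {g : F → F} {k : ℕ} (hk : k < N)
    (hU : RegularPotential K U g) (hV : ∀ x, V x = ∫ y, U (x + y) ∂(P.map (ξ k)))
    (hVm : Measurable V) (hB : 1 ≤ B)
    (hw : ∀ k < N, StronglyMeasurable[𝓕 k] (w k)) (hwb : ∀ k < N, ∀ ω, ‖R k (w k ω)‖ ≤ B)
    (hwi : MemLp (w k) 2 P) :
    |1 / 2 * r ^ 2 * ∫ ω, ‖w k ω‖ ^ 2 ∂P - ∫ ω, Real.log (U (walk r R ξ w (k + 1) ω)) ∂P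
      + ∫ ω, Real.log (V (walk r R ξ w k ω)) ∂P
      - 1 / 2 * r ^ 2 * ∫ ω, ‖w k ω - S k (hU.logGrad (walk r R ξ w k ω))‖ ^ 2 ∂P|
      ≤ stepConst K B C * r ^ 3 := by
  have := h.isProbabilityMeasure hk
  set X := walk r R ξ w k with hX
  have hXk : Measurable[𝓕 k] X := h.measurable_walk hw hk.le
  have hRk : Measurable[𝓕 k] fun ω => R k (w k ω) :=
    ((R k).continuous.comp_stronglyMeasurable (hw k hk)).measurable
  have hXm : Measurable X := hXk.mono (h.le k) le_rfl
  have hRm : Measurable fun ω => R k (w k ω) := hRk.mono (h.le k) le_rfl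
  -- The position and the control are `𝓕 k`-measurable, so `ξ k` is integrated out with both frozen.
  have hind : IndepFun (fun ω => (X ω, R k (w k ω))) (ξ k) P := by
    rw [IndepFun_iff_Indep]
    exact (indep_of_indep_of_le_right (h.indep k hk) (hXk.prodMk hRk).comap_le).symm
  have hf : Measurable fun q : (F × F) × F => Real.log (U (q.1.1 + (r ^ 2 • q.1.2 + q.2))) :=
    (hU.continuous.measurable.comp (by fun_prop)).log
  obtain ⟨hi, hfr⟩ := integral_comp_of_indepFun (hXm.prodMk hRm) (h.measurable hk) hind hf
    (C := Real.log K) (fun q => hU.abs_log_le _)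
  have hfr' : ∫ ω, Real.log (U (walk r R ξ w (k + 1) ω)) ∂P
      = ∫ ω, ∫ y, Real.log (U (X ω + (r ^ 2 • R k (w k ω) + y))) ∂(P.map (ξ k)) ∂P := hfr
  rw [hfr']
  have iV : Integrable (fun ω => Real.log (V (X ω))) P := by
    refine Integrable.of_bound (hVm.comp hXm).log.aestronglyMeasurable (Real.log K)
      (Eventually.of_forall fun ω => ?_)
    rw [hV]
    exact (hU.average (P.map (ξ k))).abs_log_le _
  have iw : Integrable (fun ω => ‖w k ω‖ ^ 2) P := hwi.integrable_norm_pow (by norm_num)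
  have hS : MemLp (fun ω => S k (hU.logGrad (X ω))) 2 P := by
    refine MemLp.of_bound ((S k).continuous.comp_stronglyMeasurable
      (hU.continuous_logGrad.comp_stronglyMeasurable
        hXm.stronglyMeasurable)).aestronglyMeasurable (‖S k‖ * K ^ 2)
      (Eventually.of_forall fun ω => ?_)
    exact (S k).le_opNorm_of_le (hU.norm_logGrad_le _)
  have id : Integrable (fun ω => ‖w k ω - S k (hU.logGrad (X ω))‖ ^ 2) P :=
    (hwi.sub hS).integrable_norm_pow (by norm_num)
  rw [← integral_const_mul, ← integral_const_mul, ← integral_sub (iw.const_mul _) hi]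
  have j1 : Integrable (fun ω => 1 / 2 * r ^ 2 * ‖w k ω‖ ^ 2
      - ∫ y, Real.log (U (X ω + (r ^ 2 • R k (w k ω) + y))) ∂(P.map (ξ k))) P :=
    (iw.const_mul _).sub hi
  have j2 : Integrable (fun ω => 1 / 2 * r ^ 2 * ‖w k ω‖ ^ 2
      - ∫ y, Real.log (U (X ω + (r ^ 2 • R k (w k ω) + y))) ∂(P.map (ξ k))
      + Real.log (V (X ω))) P := j1.add iV
  rw [← integral_add j1 iV, ← integral_sub j2 (id.const_mul _)]
  have key : ‖∫ ω, (1 / 2 * r ^ 2 * ‖w k ω‖ ^ 2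
      - ∫ y, Real.log (U (X ω + (r ^ 2 • R k (w k ω) + y))) ∂(P.map (ξ k))
      + Real.log (V (X ω))
      - 1 / 2 * r ^ 2 * ‖w k ω - S k (hU.logGrad (X ω))‖ ^ 2) ∂P‖
      ≤ ∫ _, stepConst K B C * r ^ 3 ∂P := by
    refine norm_integral_le_of_norm_le (integrable_const _) (Eventually.of_forall fun ω => ?_)
    have hst := hU.abs_step_le hr0 hr1 hB (h.moments k hk) (X ω) (R k (w k ω)) (hwb k hk ω)
    rw [← hV, h.cov k hk, hRS] at hst
    rw [norm_sub_sq_real, real_inner_comm, Real.norm_eq_abs, abs_le]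
    have h2 := abs_le.1 hst
    constructor <;> linarith [h2.1, h2.2]
  simpa using key

/-- The mean of `Φ` at the uncontrolled walk is the value function at the start. -/
theorem integral_walk_zero (h : StepProcess P 𝓕 N r C ξ S) (hΦ : RegularPotential K Φ G) :
    ∫ ω, Φ (walk r R ξ (fun _ _ => (0 : H₀)) N ω) ∂P
      = backward (fun k => P.map (ξ k)) N Φ N 0 := by
  have hν : ∀ k < N, IsProbabilityMeasure (P.map (ξ k)) := fun k hk => h.isProbabilityMeasure hk
  suffices H : ∀ n ≤ N, ∫ ω, Φ (walk r R ξ (fun _ _ => (0 : H₀)) N ω) ∂P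
      = ∫ ω, backward (fun k => P.map (ξ k)) N Φ n
          (walk r R ξ (fun _ _ => (0 : H₀)) (N - n) ω) ∂P by
    have := H N le_rfl
    rw [this, Nat.sub_self]
    simp [walk]
  intro n hn
  induction n with
  | zero => rfl
  | succ n ih =>
    rw [ih (by omega)]
    obtain ⟨k, hk⟩ : ∃ k, N - n = k + 1 := ⟨N - n - 1, by omega⟩
    have hk1 : N - (n + 1) = k := by omega
    have hkN : k < N := by omega
    have hU := hΦ.backward hν n (by omega)
    have h0 : ∀ k < N, StronglyMeasurable[𝓕 k] ((fun _ _ => (0 : H₀)) k : Ω → H₀) :=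
      fun k _ => stronglyMeasurable_const
    have hXk : Measurable[𝓕 k] (walk r R ξ (fun _ _ => (0 : H₀)) k) :=
      h.measurable_walk h0 hkN.le
    have hind : IndepFun (walk r R ξ (fun _ _ => (0 : H₀)) k) (ξ k) P := by
      rw [IndepFun_iff_Indep]
      exact (indep_of_indep_of_le_right (h.indep k hkN) hXk.comap_le).symm
    have hf : Measurable fun q : F × F => backward (fun k => P.map (ξ k)) N Φ n (q.1 + q.2) :=
      hU.continuous.measurable.comp (by fun_prop)
    obtain ⟨-, hfr⟩ := integral_comp_of_indepFun (hXk.mono (h.le k) le_rfl) (h.measurable hkN)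
      hind hf (C := K) (fun q => by
        rw [abs_of_pos (hU.pos _)]; exact hU.upper _)
    have hidx : N - 1 - n = k := by omega
    rw [hk, hk1]
    simpa [walk, backward, hidx] using hfr

/-- The cost of a control of the walk exceeds the free energy by half the squared distance of the
control to the optimal feedback, up to the discretisation error: the one-step estimates telescope. -/
theorem abs_cost_le (h : StepProcess P 𝓕 N r C ξ S)
    (hRS : ∀ k p a, ⟪p, R k a⟫ = ⟪S k p, a⟫) (hr0 : 0 ≤ r) (hr1 : r ≤ 1)
    (hΦ : RegularPotential K Φ G) (hB : 1 ≤ B)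
    (hw : ∀ k < N, StronglyMeasurable[𝓕 k] (w k)) (hwb : ∀ k < N, ∀ ω, ‖R k (w k ω)‖ ≤ B)
    (hwi : ∀ k < N, MemLp (w k) 2 P) :
    |1 / 2 * r ^ 2 * ∑ k ∈ Finset.range N, ∫ ω, ‖w k ω‖ ^ 2 ∂P
      - ∫ ω, Real.log (Φ (walk r R ξ w N ω)) ∂P
      + Real.log (∫ ω, Φ (walk r R ξ (fun _ _ => (0 : H₀)) N ω) ∂P)
      - 1 / 2 * r ^ 2 * ∑ k ∈ Finset.range N, ∫ ω, ‖w k ω -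
        S k ((backward (fun k => P.map (ξ k)) N Φ (N - (k + 1)) (walk r R ξ w k ω))⁻¹ •
          backward (fun k => P.map (ξ k)) N G (N - (k + 1)) (walk r R ξ w k ω))‖ ^ 2 ∂P|
      ≤ N * (stepConst K B C * r ^ 3) := by
  have hν : ∀ k < N, IsProbabilityMeasure (P.map (ξ k)) := fun k hk => h.isProbabilityMeasure hk
  set ν := fun k => P.map (ξ k) with hνdef
  have hstep : ∀ k < N, |1 / 2 * r ^ 2 * ∫ ω, ‖w k ω‖ ^ 2 ∂P
      - ∫ ω, Real.log (backward ν N Φ (N - (k + 1)) (walk r R ξ w (k + 1) ω)) ∂P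
      + ∫ ω, Real.log (backward ν N Φ (N - k) (walk r R ξ w k ω)) ∂P
      - 1 / 2 * r ^ 2 * ∫ ω, ‖w k ω -
        S k ((backward ν N Φ (N - (k + 1)) (walk r R ξ w k ω))⁻¹ •
          backward ν N G (N - (k + 1)) (walk r R ξ w k ω))‖ ^ 2 ∂P|
      ≤ stepConst K B C * r ^ 3 := by
    intro k hk
    have hU := hΦ.backward hν (N - (k + 1)) (by omega)
    have hV := hΦ.backward hν (N - k) (by omega)
    refine h.abs_cost_step_le hRS hr0 hr1 hk hU (fun x => ?_) hV.continuous.measurable hB hw hwb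
      (hwi k hk)
    have e1 : N - k = (N - (k + 1)) + 1 := by omega
    have e2 : N - 1 - (N - (k + 1)) = k := by omega
    rw [e1, backward, e2]
  have h0 : Real.log (∫ ω, Φ (walk r R ξ (fun _ _ => (0 : H₀)) N ω) ∂P)
      = ∫ ω, Real.log (backward ν N Φ (N - 0) (walk r R ξ w 0 ω)) ∂P := by
    rw [h.integral_walk_zero hΦ]
    simp [walk, hνdef]
  have hN : ∫ ω, Real.log (Φ (walk r R ξ w N ω)) ∂P
      = ∫ ω, Real.log (backward ν N Φ (N - N) (walk r R ξ w N ω)) ∂P := by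
    rw [Nat.sub_self]; rfl
  have htel := Finset.sum_range_sub
    (fun k => ∫ ω, Real.log (backward ν N Φ (N - k) (walk r R ξ w k ω)) ∂P) N
  have hsum : 1 / 2 * r ^ 2 * ∑ k ∈ Finset.range N, ∫ ω, ‖w k ω‖ ^ 2 ∂P
      - ∫ ω, Real.log (Φ (walk r R ξ w N ω)) ∂P
      + Real.log (∫ ω, Φ (walk r R ξ (fun _ _ => (0 : H₀)) N ω) ∂P)
      - 1 / 2 * r ^ 2 * ∑ k ∈ Finset.range N, ∫ ω, ‖w k ω -
        S k ((backward ν N Φ (N - (k + 1)) (walk r R ξ w k ω))⁻¹ •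
          backward ν N G (N - (k + 1)) (walk r R ξ w k ω))‖ ^ 2 ∂P
      = ∑ k ∈ Finset.range N, (1 / 2 * r ^ 2 * ∫ ω, ‖w k ω‖ ^ 2 ∂P
      - ∫ ω, Real.log (backward ν N Φ (N - (k + 1)) (walk r R ξ w (k + 1) ω)) ∂P
      + ∫ ω, Real.log (backward ν N Φ (N - k) (walk r R ξ w k ω)) ∂P
      - 1 / 2 * r ^ 2 * ∫ ω, ‖w k ω -
        S k ((backward ν N Φ (N - (k + 1)) (walk r R ξ w k ω))⁻¹ •
          backward ν N G (N - (k + 1)) (walk r R ξ w k ω))‖ ^ 2 ∂P) := by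
    rw [hN, h0]
    simp only [Finset.sum_sub_distrib, Finset.sum_add_distrib, ← Finset.mul_sum] at htel ⊢
    linarith
  rw [hsum]
  refine (Finset.abs_sum_le_sum_abs _ _).trans ?_
  refine (Finset.sum_le_sum fun k hk => hstep k (Finset.mem_range.1 hk)).trans ?_
  simp

/-- Every control costs at least the free energy, up to the discretisation error. -/
theorem neg_log_le_cost (h : StepProcess P 𝓕 N r C ξ S)
    (hRS : ∀ k p a, ⟪p, R k a⟫ = ⟪S k p, a⟫) (hr0 : 0 ≤ r) (hr1 : r ≤ 1)
    (hΦ : RegularPotential K Φ G) (hB : 1 ≤ B)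
    (hw : ∀ k < N, StronglyMeasurable[𝓕 k] (w k)) (hwb : ∀ k < N, ∀ ω, ‖R k (w k ω)‖ ≤ B)
    (hwi : ∀ k < N, MemLp (w k) 2 P) :
    -Real.log (∫ ω, Φ (walk r R ξ (fun _ _ => (0 : H₀)) N ω) ∂P)
      ≤ 1 / 2 * r ^ 2 * ∑ k ∈ Finset.range N, ∫ ω, ‖w k ω‖ ^ 2 ∂P
        - ∫ ω, Real.log (Φ (walk r R ξ w N ω)) ∂P + N * (stepConst K B C * r ^ 3) := by
  have h1 := (abs_le.1 (h.abs_cost_le hRS hr0 hr1 hΦ hB hw hwb hwi)).1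
  have h2 : 0 ≤ 1 / 2 * r ^ 2 * ∑ k ∈ Finset.range N, ∫ ω, ‖w k ω -
        S k ((backward (fun k => P.map (ξ k)) N Φ (N - (k + 1)) (walk r R ξ w k ω))⁻¹ •
          backward (fun k => P.map (ξ k)) N G (N - (k + 1)) (walk r R ξ w k ω))‖ ^ 2 ∂P :=
    mul_nonneg (by positivity)
      (Finset.sum_nonneg fun k _ => integral_nonneg fun ω => by positivity)
  linarith

/-- The feedback control `w_k = S_k ∇ log U_{k+1}(X_k)` attains the free energy, up to the
discretisation error. -/
theorem exists_cost_le (h : StepProcess P 𝓕 N r C ξ S)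
    (hRS : ∀ k p a, ⟪p, R k a⟫ = ⟪S k p, a⟫) (hr0 : 0 ≤ r) (hr1 : r ≤ 1)
    (hΦ : RegularPotential K Φ G) {σ : ℝ} (hσ : 0 ≤ σ) (hS : ∀ k p, ‖S k p‖ ≤ σ * ‖p‖)
    (hB : 1 ≤ B) (hRB : ∀ k a, ‖a‖ ≤ σ * K ^ 2 → ‖R k a‖ ≤ B) :
    ∃ w : ℕ → Ω → H₀, (∀ k < N, StronglyMeasurable[𝓕 k] (w k)) ∧
      (∀ k < N, ∀ ω, ‖w k ω‖ ≤ σ * K ^ 2) ∧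
      1 / 2 * r ^ 2 * ∑ k ∈ Finset.range N, ∫ ω, ‖w k ω‖ ^ 2 ∂P
        - ∫ ω, Real.log (Φ (walk r R ξ w N ω)) ∂P
      ≤ -Real.log (∫ ω, Φ (walk r R ξ (fun _ _ => (0 : H₀)) N ω) ∂P)
        + N * (stepConst K B C * r ^ 3) := by
  have hν : ∀ k < N, IsProbabilityMeasure (P.map (ξ k)) := fun k hk => h.isProbabilityMeasure hk
  set ν := fun k => P.map (ξ k) with hνdef
  -- `a` is the feedback map and `X` the walk driven by it, defined together by recursion.
  let a : ℕ → F → H₀ := fun k x => S k ((backward ν N Φ (N - (k + 1)) x)⁻¹ •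
    backward ν N G (N - (k + 1)) x)
  let X : ℕ → Ω → F := fun k => Nat.rec (fun _ => 0)
    (fun k Y ω => Y ω + (r ^ 2 • R k (a k (Y ω)) + ξ k ω)) k
  let w : ℕ → Ω → H₀ := fun k ω => a k (X k ω)
  have hac : ∀ k < N, Continuous (a k) := fun k hk =>
    (S k).continuous.comp (hΦ.backward hν (N - (k + 1)) (by omega)).continuous_logGrad
  have hab : ∀ k < N, ∀ x, ‖a k x‖ ≤ σ * K ^ 2 := fun k hk x =>
    (hS k _).trans (mul_le_mul_of_nonneg_left
      ((hΦ.backward hν (N - (k + 1)) (by omega)).norm_logGrad_le x) hσ)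
  have hXw : ∀ k, walk r R ξ w k = X k := by
    intro k
    induction k with
    | zero => rfl
    | succ k ih => funext ω; simp only [walk, ih]; rfl
  have hXm : ∀ k ≤ N, Measurable[𝓕 k] (X k) := by
    intro k hk
    induction k with
    | zero => exact measurable_const
    | succ k ih =>
      have h1 : Measurable[𝓕 (k + 1)] (X k) :=
        (ih (by omega)).mono (h.mono (Nat.le_succ k)) le_rfl
      have h2 : Measurable[𝓕 (k + 1)] fun ω => R k (a k (X k ω)) :=
        ((R k).continuous.comp (hac k (by omega))).measurable.comp h1
      exact h1.add ((h2.const_smul (r ^ 2)).add (h.adapted k (by omega)))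
  have hw : ∀ k < N, StronglyMeasurable[𝓕 k] (w k) := fun k hk =>
    (hac k hk).comp_stronglyMeasurable (hXm k hk.le).stronglyMeasurable
  have hwb : ∀ k < N, ∀ ω, ‖w k ω‖ ≤ σ * K ^ 2 := fun k hk ω => hab k hk _
  have hwi : ∀ k < N, MemLp (w k) 2 P := fun k hk =>
    MemLp.of_bound ((hw k hk).mono (h.le k)).aestronglyMeasurable _
      (Eventually.of_forall (hwb k hk))
  refine ⟨w, hw, hwb, ?_⟩
  have h1 := (abs_le.1 (h.abs_cost_le hRS hr0 hr1 hΦ hB hw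
    (fun k hk ω => hRB k _ (hwb k hk ω)) hwi)).2
  have h2 : ∑ k ∈ Finset.range N, ∫ ω, ‖w k ω -
        S k ((backward ν N Φ (N - (k + 1)) (walk r R ξ w k ω))⁻¹ •
          backward ν N G (N - (k + 1)) (walk r R ξ w k ω))‖ ^ 2 ∂P = 0 := by
    refine Finset.sum_eq_zero fun k _ => ?_
    rw [hXw]
    have : ∀ ω, w k ω = S k ((backward ν N Φ (N - (k + 1)) (X k ω))⁻¹ •
          backward ν N G (N - (k + 1)) (X k ω)) := fun _ => rfl
    simp [this]
  rw [h2] at h1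
  linarith

end StepProcess

/-! ### Uniform time grids and step functions -/

section Grid

variable (T : ℝ) [hT : Fact (0 < T)]

/-- The grid point `kT/N` of `[0, T]` (equal to `T` for `k ≥ N`). -/
noncomputable def gridTime (N k : ℕ) : Time T := Set.projIcc 0 T hT.out.le (k * T / N)

theorem coe_gridTime {N k : ℕ} (hN : 0 < N) (hk : k ≤ N) :
    (gridTime T N k : ℝ) = k * T / N := by
  have hT0 := hT.out
  have hN' : (0 : ℝ) < N := by exact_mod_cast hN
  have hk' : (k : ℝ) ≤ N := by exact_mod_cast hk
  have hmem : k * T / N ∈ Set.Icc 0 T := by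
    refine ⟨by positivity, ?_⟩
    rw [div_le_iff₀ hN', mul_comm T]
    gcongr
  rw [gridTime, Set.projIcc_of_mem _ hmem]

theorem gridTime_mono (N : ℕ) : Monotone (gridTime T N) := by
  intro a b hab
  have hT0 := hT.out
  apply Set.monotone_projIcc
  gcongr

theorem gridTime_zero (N : ℕ) : gridTime T N 0 = ⊥ := by
  have hT0 := hT.out
  simp only [gridTime, Nat.cast_zero, zero_mul, zero_div]
  rw [Set.projIcc_left]; rfl

theorem gridTime_mul {q : ℕ} (hq : 0 < q) (N k : ℕ) :
    gridTime T (N * q) (k * q) = gridTime T N k := by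
  have hq' : (q : ℝ) ≠ 0 := by exact_mod_cast hq.ne'
  rw [gridTime, gridTime]
  congr 1
  push_cast
  rw [mul_right_comm, mul_div_mul_right _ _ hq']

theorem gridTime_div_le {q : ℕ} (hq : 0 < q) (N k : ℕ) :
    gridTime T N (k / q) ≤ gridTime T (N * q) k := by
  rw [← gridTime_mul T hq]
  exact gridTime_mono T _ (Nat.div_mul_le_self k q)

variable {T}

theorem leb_real_Ioc {a b : Time T} (hab : a ≤ b) : (leb T).real (Set.Ioc a b) = b - a := by
  have : Subtype.val '' Set.Ioc a b = Set.Ioc (a : ℝ) b := by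
    ext x
    simp only [Set.mem_image, Set.mem_Ioc]
    constructor
    · rintro ⟨y, hy, rfl⟩; exact hy
    · intro hx
      exact ⟨⟨x, a.2.1.trans hx.1.le, hx.2.trans b.2.2⟩, hx, rfl⟩
  rw [Measure.real, leb_apply, this, Real.volume_Ioc, ENNReal.toReal_ofReal]
  exact sub_nonneg.2 hab

theorem leb_real_univ : (leb T).real Set.univ = T := by
  rw [Measure.real, leb_apply, Set.image_univ, Subtype.range_coe, Real.volume_Icc, sub_zero,
    ENNReal.toReal_ofReal hT.out.le]

variable (T) in
/-- The time interval `(kT/N, (k+1)T/N]`. -/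
def slot (N k : ℕ) : Set (Time T) := Set.Ioc (gridTime T N k) (gridTime T N (k + 1))

theorem measurableSet_slot (N k : ℕ) : MeasurableSet (slot T N k) := measurableSet_Ioc

theorem leb_real_slot {N k : ℕ} (hN : 0 < N) (hk : k < N) : (leb T).real (slot T N k) = T / N := by
  rw [slot, leb_real_Ioc (gridTime_mono T N (Nat.le_succ k)), coe_gridTime T hN hk,
    coe_gridTime T hN hk.le]
  push_cast
  ring

theorem disjoint_slot {N i k : ℕ} (h : i ≠ k) : Disjoint (slot T N i) (slot T N k) := by
  rw [Set.disjoint_left]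
  intro t h1 h2
  rcases lt_or_gt_of_ne h with h' | h'
  · exact absurd (h1.2.trans (gridTime_mono T N h')) (not_le.2 h2.1)
  · exact absurd (h2.2.trans (gridTime_mono T N h')) (not_le.2 h1.1)

variable {H₀ H : Type*} [NormedAddCommGroup H₀] [InnerProductSpace ℝ H₀]
  [NormedAddCommGroup H] [InnerProductSpace ℝ H]

variable (T) in
/-- The step function in `L²(0, T; H₀)` with value `a k` on `(kT/N, (k+1)T/N]`. -/
noncomputable def gridL2 (N : ℕ) (a : ℕ → H₀) : L2 T H₀ :=
  ∑ k ∈ Finset.range N, indicatorConstLp 2 (measurableSet_slot (T := T) N k)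
    (measure_ne_top (leb T) _) (a k)

theorem coeFn_gridL2 (N : ℕ) (a : ℕ → H₀) :
    gridL2 T N a =ᵐ[leb T] fun t =>
      ∑ k ∈ Finset.range N, (slot T N k).indicator (fun _ => a k) t := by
  have : ∀ s : Finset ℕ, ⇑(∑ k ∈ s, indicatorConstLp 2 (measurableSet_slot (T := T) N k)
      (measure_ne_top (leb T) _) (a k)) =ᵐ[leb T] fun t =>
      ∑ k ∈ s, (slot T N k).indicator (fun _ => a k) t := by
    intro s
    induction s using Finset.induction_on with
    | empty =>
      simp only [Finset.sum_empty]
      exact Lp.coeFn_zero H₀ 2 (leb T)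
    | insert i s hi ih =>
      rw [Finset.sum_insert hi]
      filter_upwards [Lp.coeFn_add (indicatorConstLp 2 (measurableSet_slot (T := T) N i)
        (measure_ne_top (leb T) _) (a i)) (∑ k ∈ s, indicatorConstLp 2
          (measurableSet_slot (T := T) N k) (measure_ne_top (leb T) _) (a k)), ih,
        indicatorConstLp_coeFn (p := 2) (hs := measurableSet_slot (T := T) N i)
          (hμs := measure_ne_top (leb T) _) (c := a i)] with t h1 h2 h3
      rw [h1, Pi.add_apply, h2, h3, Finset.sum_insert hi]
  exact this _

theorem gridL2_congr {N : ℕ} {a b : ℕ → H₀} (h : ∀ k < N, a k = b k) :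
    gridL2 T N a = gridL2 T N b := by
  refine Finset.sum_congr rfl fun k hk => ?_
  rw [h k (Finset.mem_range.1 hk)]

theorem gridL2_smul (N : ℕ) (c : ℝ) (a : ℕ → H₀) :
    gridL2 T N (fun k => c • a k) = c • gridL2 T N a := by
  rw [gridL2, gridL2, Finset.smul_sum]
  refine Finset.sum_congr rfl fun k _ => ?_
  rw [indicatorConstLp, indicatorConstLp, ← MemLp.toLp_const_smul]
  congr 1
  ext t
  by_cases ht : t ∈ slot T N k <;> simp [ht]

/-- A step function is a step function on every finer grid. -/
theorem gridL2_refine {q : ℕ} (hq : 0 < q) (N : ℕ) (a : ℕ → H₀) :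
    gridL2 T (N * q) (fun k => a (k / q)) = gridL2 T N a := by
  set E : ℕ → H₀ → L2 T H₀ := fun k c =>
    indicatorConstLp 2 (measurableSet_Iic (a := gridTime T (N * q) k))
      (measure_ne_top (leb T) _) c with hE
  have hIoc : ∀ (i j : ℕ) (_ : i ≤ j) (s : Set (Time T)) (hs : MeasurableSet s) (c : H₀),
      s = Set.Ioc (gridTime T (N * q) i) (gridTime T (N * q) j) →
      indicatorConstLp 2 hs (measure_ne_top (leb T) _) c = E j c - E i c := by
    rintro i j hij s hs c rfl
    rw [eq_sub_iff_add_eq, add_comm, hE]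
    simp only
    rw [← indicatorConstLp_disjoint_union measurableSet_Iic hs (measure_ne_top (leb T) _)
      (measure_ne_top (leb T) _) (Set.Iic_disjoint_Ioc le_rfl)]
    congr 1
    exact Set.Iic_union_Ioc_eq_Iic (gridTime_mono T _ hij)
  have h1 : gridL2 T N a = ∑ k ∈ Finset.range N, (E ((k + 1) * q) (a k) - E (k * q) (a k)) := by
    refine Finset.sum_congr rfl fun k _ => ?_
    refine hIoc _ _ (by gcongr; exact Nat.le_succ k) _ _ _ ?_
    rw [gridTime_mul T hq, gridTime_mul T hq, slot]
  have h2 : gridL2 T (N * q) (fun k => a (k / q))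
      = ∑ k ∈ Finset.range (N * q), (E (k + 1) (a (k / q)) - E k (a (k / q))) :=
    Finset.sum_congr rfl fun k _ => hIoc _ _ (Nat.le_succ k) _ _ _ rfl
  rw [h1, h2]
  clear h1 h2 hIoc
  clear_value E
  clear hE
  induction N with
  | zero => simp
  | succ n ih =>
    rw [Nat.succ_mul, Finset.sum_range_add, ih, Finset.sum_range_succ]
    congr 1
    have hblock : ∀ i ∈ Finset.range q, E (n * q + i + 1) (a ((n * q + i) / q))
        - E (n * q + i) (a ((n * q + i) / q))
        = E (n * q + (i + 1)) (a n) - E (n * q + i) (a n) := by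
      intro i hi
      have : (n * q + i) / q = n := by
        rw [mul_comm, Nat.mul_add_div hq, Nat.div_eq_of_lt (Finset.mem_range.1 hi), add_zero]
      rw [this, add_assoc]
    rw [Finset.sum_congr rfl hblock, Finset.sum_range_sub (fun i => E (n * q + i) (a n)),
      Nat.succ_mul, add_zero]

theorem real_inner_indicator_slot [CompleteSpace H₀] {N i k : ℕ} (h : i ≠ k) (a b : H₀) :
    ⟪indicatorConstLp 2 (measurableSet_slot (T := T) N i) (measure_ne_top (leb T) _) a,
      indicatorConstLp 2 (measurableSet_slot (T := T) N k) (measure_ne_top (leb T) _) b⟫ = 0 := by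
  rw [L2.inner_indicatorConstLp_indicatorConstLp, (disjoint_slot h).inter_eq]
  simp

theorem energy_gridL2 [CompleteSpace H₀] {N : ℕ} (hN : 0 < N) (a : ℕ → H₀) :
    energy (gridL2 T N a) = T / N * ∑ k ∈ Finset.range N, ‖a k‖ ^ 2 := by
  rw [energy_eq_norm_sq, gridL2, ← real_inner_self_eq_norm_sq, sum_inner, Finset.mul_sum]
  refine Finset.sum_congr rfl fun k hk => ?_
  rw [inner_sum, Finset.sum_eq_single_of_mem k hk]
  · rw [L2.inner_indicatorConstLp_indicatorConstLp, Set.inter_self,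
      leb_real_slot hN (Finset.mem_range.1 hk), real_inner_self_eq_norm_sq]
    simp
  · intro j _ hj
    exact real_inner_indicator_slot hj.symm _ _

theorem continuous_indicatorConstLp {s : Set (Time T)} (hs : MeasurableSet s) :
    Continuous fun c : H₀ => (indicatorConstLp 2 hs (measure_ne_top (leb T) _) c : L2 T H₀) := by
  refine (LipschitzWith.of_dist_le_mul (K := ⟨(leb T).real s ^ (1 / (2 : ℝ≥0∞).toReal),
    by positivity⟩) fun x y => ?_).continuous
  rw [dist_eq_norm, dist_eq_norm, indicatorConstLp_sub,
    norm_indicatorConstLp (by norm_num) (by norm_num), mul_comm]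
  rfl

theorem stronglyMeasurable_gridL2 {Ω : Type*} {m : MeasurableSpace Ω} {N : ℕ} {w : ℕ → Ω → H₀}
    (hw : ∀ k < N, StronglyMeasurable (w k)) :
    StronglyMeasurable fun ω => gridL2 T N fun k => w k ω := by
  simp only [gridL2]
  refine Finset.stronglyMeasurable_fun_sum _ fun k hk => ?_
  exact (continuous_indicatorConstLp _).comp_stronglyMeasurable (hw k (Finset.mem_range.1 hk))

/-! ### The primitive of a step function -/

variable [CompleteSpace H₀]

theorem norm_setIntegral_L2_le (w : L2 T H₀) (t : Time T) :
    ‖∫ s in Set.Iic t, w s ∂(leb T)‖ ≤ √T * ‖w‖ := by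
  set c := ∫ s in Set.Iic t, w s ∂(leb T) with hc
  have h1 := L2.inner_indicatorConstLp_eq_inner_setIntegral (𝕜 := ℝ) (measurableSet_Iic (a := t))
    (measure_ne_top (leb T) _) c w
  rw [← hc, real_inner_self_eq_norm_sq] at h1
  have h2 : ‖c‖ ^ 2 ≤ ‖c‖ * √T * ‖w‖ := by
    rw [← h1]
    refine (real_inner_le_norm _ _).trans ?_
    rw [norm_indicatorConstLp (by norm_num) (by norm_num)]
    gcongr
    rw [Real.sqrt_eq_rpow]
    simp only [ENNReal.toReal_ofNat]
    gcongr
    calc (leb T).real (Set.Iic t) ≤ (leb T).real Set.univ := measureReal_mono (Set.subset_univ _)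
      _ = T := leb_real_univ
  rcases (norm_nonneg c).eq_or_lt with h0 | h0
  · rw [← h0]; positivity
  · rw [pow_two, mul_assoc] at h2
    exact le_of_mul_le_mul_left h2 h0

/-- The primitive as a continuous linear map from `L²(0, T; H₀)` to `C([0, T]; H)`. -/
noncomputable def primitiveCLM (J : H₀ →L[ℝ] H) : L2 T H₀ →L[ℝ] PathSpace T H :=
  LinearMap.mkContinuous
    { toFun := primitive J
      map_add' := fun u v => by
        ext t
        change J _ = J _ + J _
        rw [← map_add, ← integral_add (L2_integrable u).integrableOn (L2_integrable v).integrableOn]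
        congr 1
        exact integral_congr_ae (ae_restrict_of_ae (Lp.coeFn_add u v))
      map_smul' := fun c u => by
        ext t
        change J _ = c • J _
        rw [← map_smul, ← integral_smul]
        congr 1
        exact integral_congr_ae (ae_restrict_of_ae (Lp.coeFn_smul c u)) }
    (‖J‖ * √T) fun w => by
      refine (ContinuousMap.norm_le _ (by positivity)).2 fun t => ?_
      rw [mul_assoc]
      exact J.le_opNorm_of_le (norm_setIntegral_L2_le w t)

theorem primitive_smul (J : H₀ →L[ℝ] H) (c : ℝ) (w : L2 T H₀) :
    primitive J (c • w) = c • primitive J w := (primitiveCLM J).map_smul c w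

theorem setIntegral_gridL2 {N m : ℕ} (hN : 0 < N) (hm : m ≤ N) (a : ℕ → H₀) :
    ∫ s in Set.Iic (gridTime T N m), gridL2 T N a s ∂(leb T)
      = ∑ k ∈ Finset.range m, (T / N) • a k := by
  have h1 : ∫ s in Set.Iic (gridTime T N m), gridL2 T N a s ∂(leb T)
      = ∑ k ∈ Finset.range N, ∫ s in Set.Iic (gridTime T N m),
        (slot T N k).indicator (fun _ => a k) s ∂(leb T) := by
    rw [← integral_finsetSum]
    · exact integral_congr_ae (ae_restrict_of_ae (coeFn_gridL2 N a))
    · intro k _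
      exact ((integrable_const (a k)).indicator (measurableSet_slot N k)).integrableOn
  rw [h1, ← Finset.sum_subset (Finset.range_mono hm)]
  · refine Finset.sum_congr rfl fun k hk => ?_
    have hkm := Finset.mem_range.1 hk
    rw [integral_indicator (measurableSet_slot N k), Measure.restrict_restrict
      (measurableSet_slot N k), Set.inter_eq_left.2, setIntegral_const,
      leb_real_slot hN (by omega)]
    intro t ht
    exact ht.2.trans (gridTime_mono T N hkm)
  · intro k _ hk
    have hmk : m ≤ k := by simpa using hk
    rw [integral_indicator (measurableSet_slot N k), Measure.restrict_restrict
      (measurableSet_slot N k), Set.disjoint_iff_inter_eq_empty.1]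
    · simp
    · rw [Set.disjoint_left]
      intro t ht ht'
      exact absurd (ht'.trans (gridTime_mono T N hmk)) (not_le.2 ht.1)

theorem primitive_gridL2_sub (J : H₀ →L[ℝ] H) {N k : ℕ} (hk : k < N) (a : ℕ → H₀) :
    primitive J (gridL2 T N a) (gridTime T N (k + 1)) - primitive J (gridL2 T N a) (gridTime T N k)
      = (T / N) • J (a k) := by
  have hN : 0 < N := by omega
  change J _ - J _ = _
  rw [setIntegral_gridL2 hN hk, setIntegral_gridL2 hN hk.le, ← map_sub, Finset.sum_range_succ,
    add_sub_cancel_left, map_smul]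

theorem primitive_bot (J : H₀ →L[ℝ] H) (w : L2 T H₀) : primitive J w ⊥ = 0 := by
  change J _ = 0
  have h0 : leb T {(⊥ : Time T)} = 0 := by rw [leb_apply]; simp
  rw [Set.Iic_bot, Measure.restrict_eq_zero.2 h0]
  simp

end Grid

/-! ### Step controls -/

section Control

variable {Ω : Type*} [mΩ : MeasurableSpace Ω] {T : ℝ} [hT : Fact (0 < T)]
  {H₀ : Type*} [NormedAddCommGroup H₀] [InnerProductSpace ℝ H₀]

variable (T) in
/-- The process with value `w k` on `(kT/N, (k+1)T/N]`. -/
noncomputable def gridControl (N : ℕ) (w : ℕ → Ω → H₀) (t : Time T) (ω : Ω) : H₀ :=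
  ∑ k ∈ Finset.range N, (slot T N k).indicator (fun _ => w k ω) t

theorem isStronglyPredictable_gridControl {ℱ : Filtration (Time T) mΩ} {N : ℕ} {w : ℕ → Ω → H₀}
    (hw : ∀ k < N, StronglyMeasurable[ℱ (gridTime T N k)] (w k)) :
    IsStronglyPredictable ℱ (gridControl T N w) := by
  change StronglyMeasurable[ℱ.predictable] _
  have hsum : Function.uncurry (gridControl T N w) = fun p : Time T × Ω =>
      ∑ k ∈ Finset.range N, (slot T N k).indicator (fun _ => w k p.2) p.1 := rfl
  rw [hsum]
  refine Finset.stronglyMeasurable_fun_sum _ fun k hk => ?_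
  have hk' := Finset.mem_range.1 hk
  let _ : MeasurableSpace H₀ := borel H₀
  have : BorelSpace H₀ := ⟨rfl⟩
  have hslot : MeasurableSet[ℱ.predictable] (slot T N k ×ˢ (Set.univ : Set Ω)) :=
    measurableSet_predictable_Ioc_prod _ _ MeasurableSet.univ
  rw [stronglyMeasurable_iff_measurable_separable]
  constructor
  · intro B hB
    have hA : MeasurableSet[ℱ.predictable] (slot T N k ×ˢ (w k ⁻¹' B)) :=
      measurableSet_predictable_Ioc_prod _ _ ((hw k hk').measurable hB)
    have : (fun p : Time T × Ω => (slot T N k).indicator (fun _ => w k p.2) p.1) ⁻¹' B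
        = (slot T N k ×ˢ (w k ⁻¹' B)) ∪
          ((slot T N k ×ˢ (Set.univ : Set Ω))ᶜ ∩ {_p | (0 : H₀) ∈ B}) := by
      ext ⟨t, ω⟩
      by_cases ht : t ∈ slot T N k <;> simp [ht]
    rw [this]
    refine hA.union (hslot.compl.inter ?_)
    by_cases h0 : (0 : H₀) ∈ B <;> simp [h0]
  · refine ((hw k hk').isSeparable_range.union
      (Set.finite_singleton (0 : H₀)).isSeparable).mono ?_
    rintro _ ⟨⟨t, ω⟩, rfl⟩
    by_cases ht : t ∈ slot T N k
    · left; exact ⟨ω, by simp [ht]⟩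
    · right; simp [ht]

theorem memLp_gridControl (N : ℕ) (w : ℕ → Ω → H₀) (ω : Ω) :
    MemLp (fun s => gridControl T N w s ω) 2 (leb T) :=
  memLp_finsetSum _ fun k _ =>
    memLp_indicator_const 2 (measurableSet_slot N k) (w k ω) (Or.inr (measure_ne_top _ _))

theorem pathL2_gridControl (N : ℕ) (w : ℕ → Ω → H₀) (ω : Ω) :
    pathL2 (gridControl T N w) ω = gridL2 T N fun k => w k ω := by
  rw [pathL2, dif_pos (memLp_gridControl N w ω)]
  apply Lp.ext
  exact (MemLp.coeFn_toLp _).trans (coeFn_gridL2 N _).symm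

theorem isControlBdd_gridControl {P : Measure Ω} {ℱ : Filtration (Time T) mΩ} {N : ℕ}
    {w : ℕ → Ω → H₀} (hw : ∀ k < N, StronglyMeasurable[ℱ (gridTime T N k)] (w k)) {M : ℝ≥0}
    (hM : ∀ ω, energy (gridL2 T N fun k => w k ω) ≤ M) :
    IsControlBdd P ℱ M (gridControl T N w) :=
  ⟨⟨isStronglyPredictable_gridControl hw, Eventually.of_forall fun ω => memLp_gridControl N w ω⟩,
    Eventually.of_forall fun ω => by rw [pathL2_gridControl]; exact hM ω⟩

theorem val_toSBall_gridControl {N : ℕ} {w : ℕ → Ω → H₀} {M : ℝ≥0} {ω : Ω}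
    (hM : energy (gridL2 T N fun k => w k ω) ≤ M) :
    (toSBall M (gridControl T N w) ω).val = gridL2 T N fun k => w k ω := by
  have h : energy (pathL2 (gridControl T N w) ω) ≤ M := by rwa [pathL2_gridControl]
  have h' : toSBall M (gridControl T N w) ω = ⟨pathL2 (gridControl T N w) ω, h⟩ := dif_pos h
  rw [h']
  exact pathL2_gridControl N w ω

end Control

/-! ### Moments of Gaussian increments -/

/-- The absolute moments of the standard Gaussian law. -/
noncomputable def gaussMoment (q : ℕ) : ℝ := ∫ x, |x| ^ q ∂(gaussianReal 0 1)

theorem gaussMoment_nonneg (q : ℕ) : 0 ≤ gaussMoment q :=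
  integral_nonneg fun _ => by positivity

theorem integral_abs_pow_gaussianReal {σ : ℝ} (hσ : 0 ≤ σ) (q : ℕ) :
    ∫ x, |x| ^ q ∂(gaussianReal 0 (Real.toNNReal (σ ^ 2))) = σ ^ q * gaussMoment q := by
  have h := gaussianReal_map_const_mul (μ := 0) (v := 1) σ
  have hv : (NNReal.mk (σ ^ 2) (sq_nonneg _) * 1 : ℝ≥0) = Real.toNNReal (σ ^ 2) := by
    rw [mul_one]; ext; simp [sq_nonneg]
  rw [mul_zero, hv] at h
  rw [← h, integral_map (by fun_prop) (by fun_prop), gaussMoment, ← integral_const_mul]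
  simp_rw [abs_mul, mul_pow, abs_of_nonneg hσ]

section Moments

variable {d : ℕ}

/-- The moment constant of a Gaussian law on `ℝ^d` with standard deviations at most `c`. -/
noncomputable def momentConst (d : ℕ) (c : ℝ) : ℝ :=
  (d * c) ^ 2 * gaussMoment 2 + (d * c) ^ 3 * gaussMoment 3

theorem norm_euclidean_le_sum (x : EuclideanSpace ℝ (Fin d)) : ‖x‖ ≤ ∑ j, |x j| := by
  rw [EuclideanSpace.norm_eq, Real.sqrt_le_left (Finset.sum_nonneg fun _ _ => abs_nonneg _)]
  simp_rw [Real.norm_eq_abs]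
  exact Finset.sum_sq_le_sq_sum_of_nonneg fun _ _ => abs_nonneg _

theorem stepMoments_of_gaussian {ν : Measure (EuclideanSpace ℝ (Fin d))} [IsProbabilityMeasure ν]
    {r c : ℝ} (hr : 0 ≤ r) (hc : 0 ≤ c) {s : EuclideanSpace ℝ (Fin d) → ℝ} (hs0 : ∀ p, 0 ≤ s p)
    (hsc : ∀ p, s p ≤ c * ‖p‖)
    (h : ∀ p, ν.map (fun y => ⟪p, y⟫) = gaussianReal 0 (Real.toNNReal ((r * s p) ^ 2))) :
    StepMoments r (momentConst d c) ν := by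
  have hmeas : ∀ p : EuclideanSpace ℝ (Fin d), AEMeasurable (fun y => ⟪p, y⟫) ν := fun p => by
    fun_prop
  have hLp : ∀ p (q : ℝ≥0∞), q ≠ ∞ → MemLp (fun y => ⟪p, y⟫) q ν := fun p q hq => by
    have := memLp_id_gaussianReal' (μ := 0) (v := Real.toNNReal ((r * s p) ^ 2)) q hq
    rw [← h p, memLp_map_measure_iff (by fun_prop) (hmeas p)] at this
    exact this
  have hcoord : ∀ (j : Fin d) (y : EuclideanSpace ℝ (Fin d)),
      ⟪EuclideanSpace.single j (1 : ℝ), y⟫ = y j := fun j y => by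
    rw [EuclideanSpace.inner_single_left]; simp
  have hcLp : ∀ (j : Fin d) (q : ℝ≥0∞), q ≠ ∞ →
      MemLp (fun y : EuclideanSpace ℝ (Fin d) => |y j|) q ν := fun j q hq => by
    have := (hLp (EuclideanSpace.single j (1 : ℝ)) q hq).norm
    simpa only [hcoord, Real.norm_eq_abs] using this
  have hmom : ∀ (j : Fin d) (q : ℕ), ∫ y, |y j| ^ q ∂ν ≤ (r * c) ^ q * gaussMoment q := by
    intro j q
    set p := EuclideanSpace.single j (1 : ℝ) with hp
    have h1 : ∫ y, |y j| ^ q ∂ν = (r * s p) ^ q * gaussMoment q := by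
      rw [← integral_abs_pow_gaussianReal (mul_nonneg hr (hs0 p)), ← h p,
        integral_map (hmeas p) (by fun_prop)]
      simp_rw [hp, hcoord]
    have h2 : s p ≤ c := (hsc p).trans (by simp [hp])
    rw [h1]
    have := hs0 p
    have := gaussMoment_nonneg q
    gcongr
  have hq : ∀ q : ℕ, ∫ y, ‖y‖ ^ (q + 1) ∂ν ≤ (d * c) ^ (q + 1) * gaussMoment (q + 1) *
      r ^ (q + 1) := by
    intro q
    have hi : ∀ j : Fin d, Integrable (fun y : EuclideanSpace ℝ (Fin d) => |y j| ^ (q + 1)) ν := by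
      intro j
      have := (hcLp j ((q + 1 : ℕ) : ℝ≥0∞) (ENNReal.natCast_ne_top _)).integrable_norm_pow
        (Nat.succ_ne_zero q)
      simpa using this
    calc ∫ y, ‖y‖ ^ (q + 1) ∂ν ≤ ∫ y, (d : ℝ) ^ q * ∑ j, |y j| ^ (q + 1) ∂ν := by
          refine integral_mono_of_nonneg (Eventually.of_forall fun y => by positivity)
            ((integrable_finsetSum _ fun j _ => hi j).const_mul _)
            (Eventually.of_forall fun y => ?_)
          have h1 : ‖y‖ ^ (q + 1) ≤ (∑ j, |y j|) ^ (q + 1) := by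
            gcongr
            exact norm_euclidean_le_sum y
          refine h1.trans ?_
          simpa using pow_sum_le_card_mul_sum_pow (s := Finset.univ) (f := fun j => |y j|)
            (fun _ _ => abs_nonneg _) q
      _ = (d : ℝ) ^ q * ∑ j, ∫ y, |y j| ^ (q + 1) ∂ν := by
          rw [integral_const_mul, integral_finsetSum _ fun j _ => hi j]
      _ ≤ (d : ℝ) ^ q * ∑ _j : Fin d, (r * c) ^ (q + 1) * gaussMoment (q + 1) := by
          gcongr with j
          exact hmom j _
      _ = _ := by
          simp only [Finset.sum_const, Finset.card_univ, Fintype.card_fin, nsmul_eq_mul]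
          ring
  have g2 := gaussMoment_nonneg 2
  have g3 := gaussMoment_nonneg 3
  refine ⟨?_, fun p => ?_, ?_, ?_⟩
  · have hsum : MemLp (fun y : EuclideanSpace ℝ (Fin d) => ∑ j, |y j|) 3 ν :=
      memLp_finsetSum _ fun j _ => hcLp j 3 (by norm_num)
    refine hsum.mono (by fun_prop) (Eventually.of_forall fun y => ?_)
    rw [Real.norm_of_nonneg (Finset.sum_nonneg fun _ _ => abs_nonneg _)]
    exact norm_euclidean_le_sum y
  · have := integral_id_gaussianReal (μ := 0) (v := Real.toNNReal ((r * s p) ^ 2))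
    rw [← h p, integral_map (hmeas p) (by fun_prop)] at this
    exact this
  · refine (hq 1).trans ?_
    rw [momentConst]
    gcongr
    exact le_add_of_nonneg_right (by positivity)
  · refine (hq 2).trans ?_
    rw [momentConst]
    gcongr
    exact le_add_of_nonneg_left (by positivity)

theorem integral_sq_gaussianReal (v : ℝ≥0) : ∫ x, x ^ 2 ∂(gaussianReal 0 v) = v := by
  have h := variance_eq_integral (μ := gaussianReal 0 v) (X := id) aemeasurable_id
  rw [variance_id_gaussianReal] at h
  simp only [id, integral_id_gaussianReal, sub_zero] at h
  exact h.symm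

end Moments

/-! ### Finitely many observations of a path -/

section Observation

variable {T : ℝ} [hT : Fact (0 < T)] {H₀ H : Type*} [NormedAddCommGroup H₀]
  [InnerProductSpace ℝ H₀] [CompleteSpace H₀] [NormedAddCommGroup H] [InnerProductSpace ℝ H]
  [CompleteSpace H] {d : ℕ}

/-- The observations `⟪e j, x(m j T/N)⟫` of a path `x`. -/
noncomputable def obs (N : ℕ) (e : Fin d → H) (m : Fin d → ℕ) (x : PathSpace T H) :
    EuclideanSpace ℝ (Fin d) :=
  WithLp.toLp 2 fun j => ⟪e j, x (gridTime T N (m j))⟫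

/-- The contribution to the observations of the increment of the path over the `k`-th slot. -/
noncomputable def obsIncr (e : Fin d → H) (m : Fin d → ℕ) (k : ℕ) :
    H →L[ℝ] EuclideanSpace ℝ (Fin d) :=
  ((EuclideanSpace.equiv (Fin d) ℝ).symm : (Fin d → ℝ) →L[ℝ] EuclideanSpace ℝ (Fin d)) ∘L
    ContinuousLinearMap.pi fun j => if k < m j then innerSL ℝ (e j) else 0

theorem obsIncr_apply (e : Fin d → H) (m : Fin d → ℕ) (k : ℕ) (x : H) (j : Fin d) :
    obsIncr e m k x j = if k < m j then ⟪e j, x⟫ else 0 := by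
  have : obsIncr e m k x j = (if k < m j then innerSL ℝ (e j) else 0) x := rfl
  rw [this]
  split_ifs <;> simp

theorem norm_obsIncr_le (e : Fin d → H) (m : Fin d → ℕ) (k : ℕ) (x : H) :
    ‖obsIncr e m k x‖ ≤ (∑ j, ‖e j‖) * ‖x‖ := by
  refine (norm_euclidean_le_sum _).trans ?_
  rw [Finset.sum_mul]
  refine Finset.sum_le_sum fun j _ => ?_
  rw [obsIncr_apply]
  split_ifs
  · exact abs_real_inner_le_norm _ _
  · simp only [abs_zero]; positivity

theorem obs_eq_sum {N : ℕ} (e : Fin d → H) {m : Fin d → ℕ} (hm : ∀ j, m j ≤ N)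
    {x : PathSpace T H} (hx : x ⊥ = 0) :
    obs N e m x = ∑ k ∈ Finset.range N,
      obsIncr e m k (x (gridTime T N (k + 1)) - x (gridTime T N k)) := by
  ext j
  rw [WithLp.ofLp_sum, Finset.sum_apply]
  simp_rw [obsIncr_apply]
  rw [← Finset.sum_filter]
  have : (Finset.range N).filter (fun k => k < m j) = Finset.range (m j) := by
    ext k
    have := hm j
    simp only [Finset.mem_filter, Finset.mem_range]
    omega
  rw [this, ← inner_sum, Finset.sum_range_sub (fun k => x (gridTime T N k)), gridTime_zero, hx,
    sub_zero]
  rfl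

theorem continuous_obs (N : ℕ) (e : Fin d → H) (m : Fin d → ℕ) :
    Continuous (obs (T := T) N e m) := by
  refine (PiLp.continuous_toLp 2 _).comp (continuous_pi fun j => ?_)
  exact continuous_const.inner (continuous_eval_const _)

theorem obs_mul {q : ℕ} (hq : 0 < q) (N : ℕ) (e : Fin d → H) (m : Fin d → ℕ) :
    obs (T := T) (N * q) e (fun j => m j * q) = obs N e m := by
  funext x
  simp only [obs, gridTime_mul T hq]

/-- The effect on the observations of a control in the `k`-th slot. -/
noncomputable def ctrlMap (J : H₀ →L[ℝ] H) (e : Fin d → H) (m : Fin d → ℕ) (k : ℕ) :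
    H₀ →L[ℝ] EuclideanSpace ℝ (Fin d) := obsIncr e m k ∘L J

theorem norm_ctrlMap_le (J : H₀ →L[ℝ] H) (e : Fin d → H) (m : Fin d → ℕ) (k : ℕ) :
    ‖ctrlMap J e m k‖ ≤ (∑ j, ‖e j‖) * ‖J‖ := by
  have h : 0 ≤ ∑ j, ‖e j‖ := Finset.sum_nonneg fun _ _ => norm_nonneg _
  refine ContinuousLinearMap.opNorm_le_bound _ (by positivity) fun a => ?_
  rw [mul_assoc]
  exact (norm_obsIncr_le e m k (J a)).trans
    (mul_le_mul_of_nonneg_left (J.le_opNorm a) h)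

variable {Ω : Type*} [mΩ : MeasurableSpace Ω] {P : Measure Ω} [IsProbabilityMeasure P]
  {ℱ : Filtration (Time T) mΩ} [TopologicalSpace.SeparableSpace H] [MeasurableSpace H]
  [BorelSpace H] {J : H₀ →L[ℝ] H} {V : Ω → PathSpace T H}

/-- The increments of the observations of a Wiener process. As the covariance is `J J*`, the
covariance of an increment is `T/N` times `R_k R_k*`, where `R_k = ctrlMap J e m k` is also the
effect of a control. -/
theorem IsWienerProcess.stepProcess
    (hV : IsWienerProcess P ℱ (J ∘L ContinuousLinearMap.adjoint J) V) {N : ℕ}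
    (e : Fin d → H) (m : Fin d → ℕ) :
    StepProcess P (fun k => ℱ (gridTime T N k)) N (√(T / N))
      (momentConst d ((∑ j, ‖e j‖) * ‖J‖))
      (fun k ω => obsIncr e m k (V ω (gridTime T N (k + 1)) - V ω (gridTime T N k)))
      (fun k => ContinuousLinearMap.adjoint (ctrlMap J e m k)) := by
  have hT0 := hT.out
  have : SecondCountableTopology H := UniformSpace.secondCountable_of_separable H
  have hsum : 0 ≤ ∑ j, ‖e j‖ := Finset.sum_nonneg fun _ _ => norm_nonneg _
  have hadV : ∀ k, Measurable[ℱ (gridTime T N (k + 1))] fun ω =>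
      V ω (gridTime T N (k + 1)) - V ω (gridTime T N k) := fun k =>
    (hV.adapted _).sub
      ((hV.adapted _).mono (ℱ.mono (gridTime_mono T N (Nat.le_succ k))) le_rfl)
  have hmV : ∀ k, Measurable fun ω => V ω (gridTime T N (k + 1)) - V ω (gridTime T N k) :=
    fun k => (hadV k).mono (ℱ.le _) le_rfl
  have hmξ : ∀ k, Measurable fun ω =>
      obsIncr e m k (V ω (gridTime T N (k + 1)) - V ω (gridTime T N k)) :=
    fun k => (obsIncr e m k).continuous.measurable.comp (hmV k)
  have hlaw : ∀ k < N, ∀ p, (P.map (fun ω => obsIncr e m k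
      (V ω (gridTime T N (k + 1)) - V ω (gridTime T N k)))).map (fun y => ⟪p, y⟫)
      = gaussianReal 0 (Real.toNNReal
        ((√(T / N) * ‖ContinuousLinearMap.adjoint (ctrlMap J e m k) p‖) ^ 2)) := by
    intro k hk p
    have hN : 0 < N := by omega
    rw [Measure.map_map (by fun_prop) (hmξ k)]
    have h1 := hV.gaussian_increments (gridTime T N k) (gridTime T N (k + 1))
      (gridTime_mono T N (Nat.le_succ k)) (ContinuousLinearMap.adjoint (obsIncr e m k) p)
    have h2 : (fun ω => ⟪ContinuousLinearMap.adjoint (obsIncr e m k) p,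
        V ω (gridTime T N (k + 1)) - V ω (gridTime T N k)⟫)
        = (fun y => ⟪p, y⟫) ∘ fun ω => obsIncr e m k
          (V ω (gridTime T N (k + 1)) - V ω (gridTime T N k)) := by
      funext ω
      exact ContinuousLinearMap.adjoint_inner_left _ _ _
    rw [h2] at h1
    rw [h1]
    congr 2
    rw [coe_gridTime T hN hk, coe_gridTime T hN hk.le, mul_pow,
      Real.sq_sqrt (by positivity), ctrlMap, ContinuousLinearMap.adjoint_comp]
    simp only [ContinuousLinearMap.comp_apply]
    rw [← ContinuousLinearMap.adjoint_inner_left, real_inner_self_eq_norm_sq]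
    push_cast
    ring
  refine ⟨fun k => ℱ.le _, fun i j hij => ℱ.mono (gridTime_mono T N hij), fun k _ => ?_,
    fun k _ => ?_, fun k hk => ?_, fun k hk p => ?_⟩
  · exact (obsIncr e m k).continuous.measurable.comp (hadV k)
  · refine indep_of_indep_of_le_left (hV.indep_increments (gridTime T N k) (gridTime T N (k + 1))
      (gridTime_mono T N (Nat.le_succ k))) ?_
    have := (obsIncr e m k).continuous.measurable.comap_le
    calc MeasurableSpace.comap (fun ω => obsIncr e m k
          (V ω (gridTime T N (k + 1)) - V ω (gridTime T N k))) inferInstance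
        = MeasurableSpace.comap (fun ω => V ω (gridTime T N (k + 1)) - V ω (gridTime T N k))
          (MeasurableSpace.comap (obsIncr e m k) inferInstance) := by
            rw [MeasurableSpace.comap_comp]; rfl
      _ ≤ _ := MeasurableSpace.comap_mono this
  · have : IsProbabilityMeasure (P.map (fun ω => obsIncr e m k
      (V ω (gridTime T N (k + 1)) - V ω (gridTime T N k)))) :=
      Measure.isProbabilityMeasure_map (hmξ k).aemeasurable
    refine stepMoments_of_gaussian (Real.sqrt_nonneg _) (by positivity)
      (s := fun p => ‖ContinuousLinearMap.adjoint (ctrlMap J e m k) p‖)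
      (fun p => norm_nonneg _) (fun p => ?_) (hlaw k hk)
    refine ContinuousLinearMap.le_of_opNorm_le _ ?_ p
    rw [LinearIsometryEquiv.norm_map]
    exact norm_ctrlMap_le J e m k
  · have h1 := integral_sq_gaussianReal (Real.toNNReal
      ((√(T / N) * ‖ContinuousLinearMap.adjoint (ctrlMap J e m k) p‖) ^ 2))
    rw [← hlaw k hk p, integral_map (by fun_prop) (by fun_prop),
      Real.coe_toNNReal _ (sq_nonneg _), mul_pow] at h1
    exact h1

/-- The observations of the shifted Wiener process form the endpoint of a controlled walk. -/
theorem obs_add_primitive_eq_walk {N : ℕ} (hN : 0 < N) (e : Fin d → H) {m : Fin d → ℕ}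
    (hm : ∀ j, m j ≤ N) (w : ℕ → Ω → H₀) {ω : Ω} (hω : V ω ⊥ = 0) :
    obs N e m (V ω + primitive J (gridL2 T N fun k => w k ω))
      = walk (√(T / N)) (ctrlMap J e m)
        (fun k ω => obsIncr e m k (V ω (gridTime T N (k + 1)) - V ω (gridTime T N k))) w N ω := by
  have hT0 := hT.out
  have hwalk : ∀ n, walk (√(T / N)) (ctrlMap J e m)
        (fun k ω => obsIncr e m k (V ω (gridTime T N (k + 1)) - V ω (gridTime T N k))) w n ω
      = ∑ k ∈ Finset.range n, ((√(T / N)) ^ 2 • ctrlMap J e m k (w k ω)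
        + obsIncr e m k (V ω (gridTime T N (k + 1)) - V ω (gridTime T N k))) := by
    intro n
    induction n with
    | zero => rfl
    | succ n ih =>
      rw [Finset.sum_range_succ, ← ih]
      rfl
  have h0 : (V ω + primitive J (gridL2 T N fun k => w k ω)) ⊥ = 0 := by
    rw [ContinuousMap.add_apply, hω, primitive_bot, add_zero]
  rw [hwalk, obs_eq_sum e hm h0]
  refine Finset.sum_congr rfl fun k hk => ?_
  rw [ContinuousMap.add_apply, ContinuousMap.add_apply, add_sub_add_comm,
    primitive_gridL2_sub J (Finset.mem_range.1 hk), map_add, map_smul, add_comm,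
    Real.sq_sqrt (by positivity)]
  rfl

end Observation

/-! ### The variational formula for smooth functions of finitely many observations -/

section StepControl

variable {T : ℝ} [hT : Fact (0 < T)] {H₀ H : Type*} [NormedAddCommGroup H₀]
  [InnerProductSpace ℝ H₀] [CompleteSpace H₀] [NormedAddCommGroup H] [InnerProductSpace ℝ H]
  {Ω : Type*} [mΩ : MeasurableSpace Ω]

/-- Bounded adapted controls that are constant on the slots of a uniform grid. -/
structure IsStepControl (ℱ : Filtration (Time T) mΩ) (N : ℕ) (w : ℕ → Ω → H₀) : Prop where
  pos : 0 < N
  adapted : ∀ k < N, StronglyMeasurable[ℱ (gridTime T N k)] (w k)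
  bounded : ∃ B, ∀ k < N, ∀ ω, ‖w k ω‖ ≤ B

/-- The shifted path `V + ∫₀^· w(s) ds`, for a step control `w`. -/
noncomputable def shift (J : H₀ →L[ℝ] H) (V : Ω → PathSpace T H) (N : ℕ) (w : ℕ → Ω → H₀)
    (ω : Ω) : PathSpace T H :=
  V ω + primitive J (gridL2 T N fun k => w k ω)

/-- The cost `½ ∫₀ᵀ |w(s)|² ds` of a step control. -/
noncomputable def stepCost (T : ℝ) [Fact (0 < T)] (N : ℕ) (w : ℕ → Ω → H₀) (ω : Ω) : ℝ :=
  1 / 2 * energy (gridL2 T N fun k => w k ω)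

theorem stepCost_nonneg (N : ℕ) (w : ℕ → Ω → H₀) (ω : Ω) : 0 ≤ stepCost T N w ω := by
  rw [stepCost, energy_eq_norm_sq]; positivity

theorem gridL2_zero (N : ℕ) : gridL2 T N (fun _ => (0 : H₀)) = 0 := by
  have := gridL2_smul (T := T) N 0 (fun _ => (0 : H₀))
  simpa using this

variable {ℱ : Filtration (Time T) mΩ} {N : ℕ} {w : ℕ → Ω → H₀} {J : H₀ →L[ℝ] H}
  {V : Ω → PathSpace T H}

namespace IsStepControl

theorem stronglyMeasurable (hw : IsStepControl ℱ N w) {k : ℕ} (hk : k < N) :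
    StronglyMeasurable (w k) := (hw.adapted k hk).mono (ℱ.le _)

theorem refine (hw : IsStepControl ℱ N w) {q : ℕ} (hq : 0 < q) :
    IsStepControl ℱ (N * q) fun k => w (k / q) := by
  have hdiv : ∀ k < N * q, k / q < N := fun k hk => (Nat.div_lt_iff_lt_mul hq).2 hk
  obtain ⟨B, hB⟩ := hw.bounded
  exact ⟨Nat.mul_pos hw.pos hq, fun k hk => (hw.adapted _ (hdiv k hk)).mono
    (ℱ.mono (gridTime_div_le T hq N k)), B, fun k hk => hB _ (hdiv k hk)⟩

theorem memLp {P : Measure Ω} [IsFiniteMeasure P] (hw : IsStepControl ℱ N w) {k : ℕ} (hk : k < N) :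
    MemLp (w k) 2 P := by
  obtain ⟨B, hB⟩ := hw.bounded
  exact MemLp.of_bound (hw.stronglyMeasurable hk).aestronglyMeasurable B
    (Eventually.of_forall (hB k hk))

theorem stronglyMeasurable_gridL2 (hw : IsStepControl ℱ N w) :
    StronglyMeasurable fun ω => gridL2 T N fun k => w k ω :=
  LaplacePrincipleWiener.stronglyMeasurable_gridL2 fun _ hk => hw.stronglyMeasurable hk

theorem stepCost_eq (hw : IsStepControl ℱ N w) (ω : Ω) :
    stepCost T N w ω = 1 / 2 * (T / N * ∑ k ∈ Finset.range N, ‖w k ω‖ ^ 2) := by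
  rw [stepCost, energy_gridL2 hw.pos]

theorem integrable_stepCost {P : Measure Ω} [IsFiniteMeasure P] (hw : IsStepControl ℱ N w) :
    Integrable (stepCost T N w) P := by
  have : stepCost T N w = fun ω => 1 / 2 * (T / N * ∑ k ∈ Finset.range N, ‖w k ω‖ ^ 2) :=
    funext hw.stepCost_eq
  rw [this]
  refine ((integrable_finsetSum _ fun k hk => ?_).const_mul _).const_mul _
  exact (hw.memLp (Finset.mem_range.1 hk)).integrable_norm_pow (by norm_num)

theorem integral_stepCost {P : Measure Ω} [IsFiniteMeasure P] (hw : IsStepControl ℱ N w) :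
    ∫ ω, stepCost T N w ω ∂P
      = 1 / 2 * (T / N) * ∑ k ∈ Finset.range N, ∫ ω, ‖w k ω‖ ^ 2 ∂P := by
  simp_rw [hw.stepCost_eq]
  rw [integral_const_mul, integral_const_mul, integral_finsetSum, mul_assoc]
  intro k hk
  exact (hw.memLp (Finset.mem_range.1 hk)).integrable_norm_pow (by norm_num)

theorem measurable_shift [TopologicalSpace.SeparableSpace H] (hw : IsStepControl ℱ N w)
    (hV : Measurable V) : Measurable (shift J V N w) := by
  have : SecondCountableTopology H := UniformSpace.secondCountable_of_separable H
  exact hV.add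
    ((primitiveCLM J).continuous.comp_stronglyMeasurable hw.stronglyMeasurable_gridL2).measurable

end IsStepControl

variable [CompleteSpace H] [TopologicalSpace.SeparableSpace H] [MeasurableSpace H] [BorelSpace H]
  {P : Measure Ω} [IsProbabilityMeasure P] {d : ℕ} {K : ℝ} {Φ : EuclideanSpace ℝ (Fin d) → ℝ}
  {G : EuclideanSpace ℝ (Fin d) → EuclideanSpace ℝ (Fin d)}

theorem IsWienerProcess.integral_walk_zero_eq_obs
    (hV : IsWienerProcess P ℱ (J ∘L ContinuousLinearMap.adjoint J) V) (hN : 0 < N)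
    (e : Fin d → H) {m : Fin d → ℕ} (hm : ∀ j, m j ≤ N) :
    ∫ ω, Φ (walk (√(T / N)) (ctrlMap J e m)
        (fun k ω => obsIncr e m k (V ω (gridTime T N (k + 1)) - V ω (gridTime T N k)))
        (fun _ _ => (0 : H₀)) N ω) ∂P = ∫ ω, Φ (obs N e m (V ω)) ∂P := by
  refine integral_congr_ae ?_
  filter_upwards [hV.start] with ω hω
  rw [← obs_add_primitive_eq_walk (J := J) hN e hm (fun _ _ => (0 : H₀)) hω, gridL2_zero]
  have : primitive J (0 : L2 T H₀) = 0 := (primitiveCLM J).map_zero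
  rw [this, add_zero]

theorem sq_sqrt_div (N : ℕ) : √(T / N) ^ 2 = T / N := by
  have := hT.out
  exact Real.sq_sqrt (by positivity)

theorem mul_sqrt_div_cube {N : ℕ} (hN : 0 < N) (c : ℝ) :
    N * (c * √(T / N) ^ 3) = T * c * √(T / N) := by
  have hN' : (N : ℝ) ≠ 0 := by exact_mod_cast hN.ne'
  rw [pow_succ, sq_sqrt_div]
  field_simp

theorem sqrt_div_le_one {N : ℕ} (hN : 0 < N) (hTN : T ≤ N) : √(T / N) ≤ 1 := by
  rw [Real.sqrt_le_one, div_le_one (by exact_mod_cast hN)]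
  exact hTN

theorem tendsto_sqrt_div : Tendsto (fun N : ℕ => √(T / N)) atTop (𝓝 0) := by
  have h : Tendsto (fun N : ℕ => T / N) atTop (𝓝 0) := tendsto_const_div_atTop_nhds_zero_nat T
  have := (Real.continuous_sqrt.tendsto 0).comp h
  rw [Real.sqrt_zero] at this
  exact this

/-- On a grid that contains the observation times and the jumps of the control, the lower bound of
the variational formula holds up to the discretisation error. -/
theorem IsWienerProcess.neg_log_le_of_aligned
    (hV : IsWienerProcess P ℱ (J ∘L ContinuousLinearMap.adjoint J) V)
    (hw : IsStepControl ℱ N w) {B : ℝ} (hB : ∀ k < N, ∀ ω, ‖w k ω‖ ≤ B) (hTN : T ≤ N)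
    (e : Fin d → H) {m : Fin d → ℕ} (hm : ∀ j, m j ≤ N) (hΦ : RegularPotential K Φ G) :
    -Real.log (∫ ω, Φ (obs N e m (V ω)) ∂P) ≤ ∫ ω, stepCost T N w ω ∂P
      - ∫ ω, Real.log (Φ (obs N e m (shift J V N w ω))) ∂P
      + T * stepConst K (max 1 ((∑ j, ‖e j‖) * ‖J‖ * B)) (momentConst d ((∑ j, ‖e j‖) * ‖J‖))
        * √(T / N) := by
  have hsum : 0 ≤ ∑ j, ‖e j‖ := Finset.sum_nonneg fun _ _ => norm_nonneg _
  have h := (hV.stepProcess (N := N) e m).neg_log_le_cost (R := ctrlMap J e m) (w := w)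
    (B := max 1 ((∑ j, ‖e j‖) * ‖J‖ * B))
    (fun k p a => (ContinuousLinearMap.adjoint_inner_left _ _ _).symm) (Real.sqrt_nonneg _)
    (sqrt_div_le_one hw.pos hTN) hΦ (le_max_left _ _) hw.adapted
    (fun k hk ω => le_max_of_le_right
      (((ctrlMap J e m k).le_of_opNorm_le (norm_ctrlMap_le J e m k) _).trans
        (mul_le_mul_of_nonneg_left (hB k hk ω) (by positivity)))) (fun k hk => hw.memLp hk)
  rw [hV.integral_walk_zero_eq_obs hw.pos e hm, sq_sqrt_div, ← hw.integral_stepCost,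
    mul_sqrt_div_cube hw.pos] at h
  refine h.trans (le_of_eq ?_)
  congr 2
  refine integral_congr_ae ?_
  filter_upwards [hV.start] with ω hω
  rw [shift, obs_add_primitive_eq_walk hw.pos e hm w hω]

/-- The lower bound of the variational formula, for regular functions of finitely many
observations. -/
theorem IsWienerProcess.neg_log_regular_le
    (hV : IsWienerProcess P ℱ (J ∘L ContinuousLinearMap.adjoint J) V)
    (hw : IsStepControl ℱ N w) {N₀ : ℕ} (hN₀ : 0 < N₀)
    (e : Fin d → H) {m : Fin d → ℕ} (hm : ∀ j, m j ≤ N₀) (hΦ : RegularPotential K Φ G) :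
    -Real.log (∫ ω, Φ (obs N₀ e m (V ω)) ∂P) ≤ ∫ ω, stepCost T N w ω ∂P
      - ∫ ω, Real.log (Φ (obs N₀ e m (shift J V N w ω))) ∂P := by
  have hT0 := hT.out
  obtain ⟨B, hB⟩ := hw.bounded
  set c := T * stepConst K (max 1 ((∑ j, ‖e j‖) * ‖J‖ * B))
    (momentConst d ((∑ j, ‖e j‖) * ‖J‖)) with hc
  have hN := hw.pos
  have hbig : Tendsto (fun n : ℕ => N * (N₀ * n)) atTop atTop :=
    tendsto_id.const_mul_atTop' (Nat.mul_pos hN hN₀) |>.congr fun n => by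
      simp [mul_assoc]
  -- Along common refinements of the two grids the control and the observations stay the same, while
  -- the error vanishes.
  have hlim : Tendsto (fun n : ℕ => ∫ ω, stepCost T N w ω ∂P
      - ∫ ω, Real.log (Φ (obs N₀ e m (shift J V N w ω))) ∂P
      + c * √(T / (N * (N₀ * n) : ℕ))) atTop (𝓝 (∫ ω, stepCost T N w ω ∂P
      - ∫ ω, Real.log (Φ (obs N₀ e m (shift J V N w ω))) ∂P + c * 0)) :=
    tendsto_const_nhds.add ((tendsto_sqrt_div.comp hbig).const_mul c)
  rw [mul_zero, add_zero] at hlim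
  refine ge_of_tendsto hlim ?_
  filter_upwards [hbig.eventually_ge_atTop ⌈T⌉₊, eventually_gt_atTop 0] with n hn hn0
  have hTN : T ≤ (N * (N₀ * n) : ℕ) := (Nat.le_ceil T).trans (by exact_mod_cast hn)
  have hq : 0 < N₀ * n := Nat.mul_pos hN₀ hn0
  have hq' : 0 < N * n := Nat.mul_pos hN hn0
  have hcomm : N * (N₀ * n) = N₀ * (N * n) := by ring
  have hmm : ∀ j, m j * (N * n) ≤ N * (N₀ * n) := fun j => by
    rw [hcomm]; exact Nat.mul_le_mul_right _ (hm j)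
  have h := hV.neg_log_le_of_aligned (hw.refine hq)
    (fun k hk => hB _ ((Nat.div_lt_iff_lt_mul hq).2 hk)) hTN e hmm hΦ
  have hobs : obs (T := T) (N * (N₀ * n)) e (fun j => m j * (N * n)) = obs N₀ e m := by
    rw [hcomm, obs_mul hq']
  have hgrid : ∀ ω, gridL2 T (N * (N₀ * n)) (fun k => w (k / (N₀ * n)) ω)
      = gridL2 T N fun k => w k ω := fun ω => gridL2_refine hq N fun k => w k ω
  have hcost : stepCost T (N * (N₀ * n)) (fun k => w (k / (N₀ * n))) = stepCost T N w := by
    funext ω; rw [stepCost, stepCost, hgrid]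
  have hshift : shift J V (N * (N₀ * n)) (fun k => w (k / (N₀ * n))) = shift J V N w := by
    funext ω; rw [shift, shift, hgrid]
  rw [hobs, hcost, hshift] at h
  exact h

/-- The upper bound of the variational formula, for regular functions of finitely many
observations. -/
theorem IsWienerProcess.exists_le_neg_log_regular
    (hV : IsWienerProcess P ℱ (J ∘L ContinuousLinearMap.adjoint J) V) {N₀ : ℕ} (hN₀ : 0 < N₀)
    (e : Fin d → H) {m : Fin d → ℕ} (hm : ∀ j, m j ≤ N₀) (hΦ : RegularPotential K Φ G)
    {δ : ℝ} (hδ : 0 < δ) :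
    ∃ (N : ℕ) (w : ℕ → Ω → H₀), IsStepControl ℱ N w ∧
      ∫ ω, stepCost T N w ω ∂P - ∫ ω, Real.log (Φ (obs N₀ e m (shift J V N w ω))) ∂P
        ≤ -Real.log (∫ ω, Φ (obs N₀ e m (V ω)) ∂P) + δ := by
  have hT0 := hT.out
  have hsum : 0 ≤ ∑ j, ‖e j‖ := Finset.sum_nonneg fun _ _ => norm_nonneg _
  set σ := (∑ j, ‖e j‖) * ‖J‖ with hσ
  have hσ0 : 0 ≤ σ := by positivity
  set c := T * stepConst K (max 1 (σ * (σ * K ^ 2))) (momentConst d σ) with hc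
  have hbig : Tendsto (fun n : ℕ => N₀ * n) atTop atTop :=
    tendsto_id.const_mul_atTop' hN₀
  have hlim : Tendsto (fun n : ℕ => c * √(T / (N₀ * n : ℕ))) atTop (𝓝 (c * 0)) :=
    (tendsto_sqrt_div.comp hbig).const_mul c
  rw [mul_zero] at hlim
  obtain ⟨n, hn, hn0, hcn⟩ := ((hbig.eventually_ge_atTop ⌈T⌉₊).and
    ((eventually_gt_atTop 0).and (hlim.eventually (gt_mem_nhds hδ)))).exists
  have hTN : T ≤ (N₀ * n : ℕ) := (Nat.le_ceil T).trans (by exact_mod_cast hn)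
  have hN : 0 < N₀ * n := Nat.mul_pos hN₀ hn0
  have hmm : ∀ j, m j * n ≤ N₀ * n := fun j => Nat.mul_le_mul_right _ (hm j)
  obtain ⟨w, hw, hwb, hle⟩ := (hV.stepProcess (N := N₀ * n) e fun j => m j * n).exists_cost_le
    (R := ctrlMap J e fun j => m j * n) (B := max 1 (σ * (σ * K ^ 2))) (σ := σ)
    (fun k p a => (ContinuousLinearMap.adjoint_inner_left _ _ _).symm) (Real.sqrt_nonneg _)
    (sqrt_div_le_one hN hTN) hΦ hσ0
    (fun k p => ContinuousLinearMap.le_of_opNorm_le _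
      (by rw [LinearIsometryEquiv.norm_map]; exact norm_ctrlMap_le J e _ k) p)
    (le_max_left _ _)
    (fun k a ha => le_max_of_le_right
      (((ctrlMap J e _ k).le_of_opNorm_le (norm_ctrlMap_le J e _ k) _).trans
        (mul_le_mul_of_nonneg_left ha hσ0)))
  have hW : IsStepControl ℱ (N₀ * n) w := ⟨hN, hw, _, hwb⟩
  refine ⟨N₀ * n, w, hW, ?_⟩
  rw [hV.integral_walk_zero_eq_obs hN e hmm, sq_sqrt_div, ← hW.integral_stepCost,
    mul_sqrt_div_cube hN, obs_mul hn0] at hle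
  have hend : ∫ ω, Real.log (Φ (obs N₀ e m (shift J V (N₀ * n) w ω))) ∂P
      = ∫ ω, Real.log (Φ (walk (√(T / (N₀ * n : ℕ))) (ctrlMap J e fun j => m j * n)
        (fun k ω => obsIncr e (fun j => m j * n) k
          (V ω (gridTime T (N₀ * n) (k + 1)) - V ω (gridTime T (N₀ * n) k))) w (N₀ * n) ω)) ∂P := by
    refine integral_congr_ae ?_
    filter_upwards [hV.start] with ω hω
    rw [← obs_add_primitive_eq_walk hN e hmm w hω, obs_mul hn0, shift]
  rw [hend]
  linarith

end StepControl

/-! ### Approximation by smooth functions of finitely many observations -/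

open scoped ContDiff in
/-- Smooth compactly supported `φ` give regular potentials `exp (-κ sin φ)`. -/
theorem exists_regularPotential {F : Type*} [NormedAddCommGroup F] [InnerProductSpace ℝ F]
    [FiniteDimensional ℝ F] {φ : F → ℝ} (hφ : ContDiff ℝ ∞ φ) (hφc : HasCompactSupport φ) {κ : ℝ}
    (hκ : 0 ≤ κ) :
    ∃ K G, RegularPotential K (fun x => Real.exp (-(κ * Real.sin (φ x)))) G := by
  set Φ : F → ℝ := fun x => Real.exp (-(κ * Real.sin (φ x))) with hΦ
  have hΦs : ContDiff ℝ ∞ Φ := (contDiff_const.mul hφ.sin).neg.exp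
  have hdiff : Differentiable ℝ Φ := hΦs.differentiable (by simp)
  have hDs : ContDiff ℝ 1 (fderiv ℝ Φ) := hΦs.fderiv_right (by norm_cast)
  -- `Φ - 1` has compact support and the same derivative as `Φ`, so all derivatives are bounded.
  have hc : HasCompactSupport fun x => Φ x - 1 := by
    refine hφc.comp_left (g := fun t => Real.exp (-(κ * Real.sin t)) - 1) ?_
    simp
  have hDeq : fderiv ℝ (fun x => Φ x - 1) = fderiv ℝ Φ := by
    funext x
    exact fderiv_sub_const 1
  have hDc : HasCompactSupport (fderiv ℝ Φ) := by
    rw [← hDeq]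
    exact hc.fderiv ℝ
  obtain ⟨C, hC⟩ := hDs.continuous.bounded_above_of_compact_support hDc
  obtain ⟨L, hL⟩ := ContDiff.lipschitzWith_of_hasCompactSupport hDc hDs (by simp)
  have hLd : ∀ x y, ‖fderiv ℝ Φ x - fderiv ℝ Φ y‖ ≤ L * ‖x - y‖ := fun x y => by
    simpa [dist_eq_norm] using hL.dist_le_mul x y
  set K : ℝ := max (Real.exp κ) (max C L) with hK
  have hKL : (L : ℝ) ≤ K := (le_max_right _ _).trans (le_max_right _ _)
  refine ⟨K, fun x => (InnerProductSpace.toDual ℝ F).symm (fderiv ℝ Φ x), ?_, ?_, ?_, ?_, ?_, ?_⟩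
  · exact (Real.one_le_exp hκ).trans (le_max_left _ _)
  · intro x
    refine (inv_anti₀ (Real.exp_pos κ) (le_max_left _ _)).trans ?_
    rw [← Real.exp_neg]
    refine Real.exp_le_exp.2 (neg_le_neg ?_)
    exact mul_le_of_le_one_right hκ (Real.sin_le_one _)
  · intro x
    refine le_trans (Real.exp_le_exp.2 ?_) (le_max_left _ _)
    nlinarith [Real.neg_one_le_sin (φ x)]
  · intro x
    rw [LinearIsometryEquiv.norm_map]
    exact (hC x).trans ((le_max_left _ _).trans (le_max_right _ _))
  · intro x y
    rw [← map_sub, LinearIsometryEquiv.norm_map]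
    exact (hLd x y).trans (by gcongr)
  · intro x y
    rw [InnerProductSpace.toDual_symm_apply]
    have := (convex_closedBall x ‖y‖).norm_image_sub_le_of_norm_fderiv_le' (𝕜 := ℝ) (f := Φ)
      (φ := fderiv ℝ Φ x) (C := K * ‖y‖) (x := x) (y := x + y) (fun z _ => hdiff z)
      (fun z hz => (hLd z x).trans (by
        have : ‖z - x‖ ≤ ‖y‖ := mem_closedBall_iff_norm.1 hz
        gcongr))
      (Metric.mem_closedBall_self (norm_nonneg _)) (by simp)
    rw [add_sub_cancel_left] at this
    rw [← Real.norm_eq_abs]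
    linarith

/-- The first `n` coordinates of a sequence. -/
def firstCoords (n : ℕ) (x : ℕ → ℝ) : EuclideanSpace ℝ (Fin n) := WithLp.toLp 2 fun j => x j

theorem continuous_firstCoords (n : ℕ) : Continuous (firstCoords n) :=
  (PiLp.continuous_toLp 2 _).comp (continuous_pi fun _ => continuous_apply _)

/-- The extension of a finite sequence by zeros. -/
def extendZero (n : ℕ) (y : EuclideanSpace ℝ (Fin n)) (i : ℕ) : ℝ :=
  if h : i < n then y ⟨i, h⟩ else 0

theorem continuous_extendZero (n : ℕ) : Continuous (extendZero n) := by
  refine continuous_pi fun i => ?_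
  by_cases h : i < n
  · simp only [extendZero, h, dite_true]
    fun_prop
  · simp only [extendZero, h, dite_false]
    exact continuous_const

theorem tendsto_extendZero_firstCoords (x : ℕ → ℝ) :
    Tendsto (fun n => extendZero n (firstCoords n x)) atTop (𝓝 x) := by
  refine tendsto_pi_nhds.2 fun i => ?_
  refine tendsto_const_nhds.congr' ?_
  filter_upwards [eventually_gt_atTop i] with n hn
  simp [extendZero, firstCoords, hn]

open scoped ContDiff in
/-- Bounded measurable functions of a sequence are approximated in `L¹` by smooth functions of
finitely many coordinates. Writing the approximation as `K sin φ` keeps the bound `K`. -/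
theorem exists_smooth_firstCoords {ν : Measure (ℕ → ℝ)} [IsFiniteMeasure ν] {f : (ℕ → ℝ) → ℝ}
    (hf : Measurable f) {K : ℝ} (hK : 0 < K) (hfK : ∀ x, |f x| ≤ K) {δ : ℝ} (hδ : 0 < δ) :
    ∃ (n : ℕ) (φ : EuclideanSpace ℝ (Fin n) → ℝ), ContDiff ℝ ∞ φ ∧ HasCompactSupport φ ∧
      ∫ x, |f x - K * Real.sin (φ (firstCoords n x))| ∂ν ≤ δ := by
  set η := δ / (3 * K) with hη
  have hη0 : 0 < η := by positivity
  set a : (ℕ → ℝ) → ℝ := fun x => Real.arcsin (f x / K) with ha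
  have ham : Measurable a := Real.measurable_arcsin.comp (hf.div_const K)
  have hai : Integrable a ν := by
    refine Integrable.of_bound ham.aestronglyMeasurable (Real.pi / 2)
      (Eventually.of_forall fun x => ?_)
    rw [Real.norm_eq_abs, abs_le]
    exact ⟨Real.neg_pi_div_two_le_arcsin _, Real.arcsin_le_pi_div_two _⟩
  have hfa : ∀ x, f x = K * Real.sin (a x) := by
    intro x
    have h := abs_le.1 (hfK x)
    rw [ha, Real.sin_arcsin]
    · field_simp
    · rw [le_div_iff₀ hK]; linarith
    · rw [div_le_one hK]; exact h.2
  -- `arcsin (f / K)` is approximated by a bounded continuous function of the sequence, …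
  obtain ⟨g, hg, hgi⟩ := hai.exists_boundedContinuous_integral_sub_le hη0
  -- … which is replaced by one that depends on finitely many coordinates only, …
  have hlim : Tendsto (fun n => ∫ x, |g x - g (extendZero n (firstCoords n x))| ∂ν) atTop
      (𝓝 (∫ _, (0 : ℝ) ∂ν)) := by
    refine tendsto_integral_of_dominated_convergence (fun _ => 2 * ‖g‖) (fun n => ?_)
      (integrable_const _) (fun n => Eventually.of_forall fun x => ?_)
      (Eventually.of_forall fun x => ?_)
    · exact (g.continuous.sub (g.continuous.comp ((continuous_extendZero n).comp
        (continuous_firstCoords n)))).abs.aestronglyMeasurable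
    · rw [Real.norm_eq_abs, abs_abs]
      have := g.norm_coe_le_norm x
      have h2 := g.norm_coe_le_norm (extendZero n (firstCoords n x))
      have h3 := norm_sub_le (g x) (g (extendZero n (firstCoords n x)))
      rw [Real.norm_eq_abs] at h3
      linarith
    · have h1 := (g.continuous.tendsto x).comp (tendsto_extendZero_firstCoords x)
      have h2 := ((tendsto_const_nhds (x := g x)).sub h1).abs
      simpa using h2
  rw [integral_zero] at hlim
  obtain ⟨n, hn⟩ := (hlim.eventually (gt_mem_nhds hη0)).exists
  -- … and that one by a smooth function of these coordinates.
  have hpm : Measurable (firstCoords n) := (continuous_firstCoords n).measurable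
  have hgn : MemLp (fun y => g (extendZero n y)) 1 (ν.map (firstCoords n)) :=
    MemLp.of_bound (g.continuous.comp (continuous_extendZero n)).aestronglyMeasurable ‖g‖
      (Eventually.of_forall fun y => g.norm_coe_le_norm _)
  obtain ⟨φ, hφc, hφs, hφ⟩ := hgn.exist_eLpNorm_sub_le (by simp) le_rfl hη0
  have hφi : Integrable φ (ν.map (firstCoords n)) := hφs.continuous.integrable_of_hasCompactSupport hφc
  have hφ' : ∫ x, |g (extendZero n (firstCoords n x)) - φ (firstCoords n x)| ∂ν ≤ η := by
    have h1 : ∫ x, |g (extendZero n (firstCoords n x)) - φ (firstCoords n x)| ∂ν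
        = ∫ y, ‖((fun y => g (extendZero n y)) - φ) y‖ ∂(ν.map (firstCoords n)) := by
      rw [integral_map hpm.aemeasurable]
      · rfl
      · exact ((g.continuous.comp (continuous_extendZero n)).sub
          hφs.continuous).norm.aestronglyMeasurable
    rw [h1, integral_norm_eq_lintegral_enorm (hgn.1.sub hφi.1), ← eLpNorm_one_eq_lintegral_enorm]
    exact ENNReal.toReal_le_of_le_ofReal hη0.le hφ
  refine ⟨n, φ, hφs, hφc, ?_⟩
  have i1 : Integrable (fun x => |a x - g x|) ν := (hai.sub hgi).abs
  have i2 : Integrable (fun x => |g x - g (extendZero n (firstCoords n x))|) ν :=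
    (hgi.sub ((hgn.integrable le_rfl).comp_measurable hpm)).abs
  have i3 : Integrable (fun x => |g (extendZero n (firstCoords n x)) - φ (firstCoords n x)|) ν :=
    (((hgn.integrable le_rfl).sub hφi).comp_measurable hpm).abs
  have i12 : Integrable (fun x => |a x - g x| + |g x - g (extendZero n (firstCoords n x))|) ν :=
    i1.add i2
  have i123 : Integrable (fun x => |a x - g x| + |g x - g (extendZero n (firstCoords n x))|
    + |g (extendZero n (firstCoords n x)) - φ (firstCoords n x)|) ν := i12.add i3
  calc ∫ x, |f x - K * Real.sin (φ (firstCoords n x))| ∂ν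
      ≤ ∫ x, K * (|a x - g x| + |g x - g (extendZero n (firstCoords n x))|
        + |g (extendZero n (firstCoords n x)) - φ (firstCoords n x)|) ∂ν := by
        refine integral_mono_of_nonneg (Eventually.of_forall fun x => abs_nonneg _)
          (i123.const_mul K) (Eventually.of_forall fun x => ?_)
        simp only
        rw [hfa x, ← mul_sub, abs_mul, abs_of_pos hK]
        gcongr
        have hsin : |Real.sin (a x) - Real.sin (φ (firstCoords n x))|
            ≤ |a x - φ (firstCoords n x)| := by
          simpa [Real.dist_eq] using Real.lipschitzWith_sin.dist_le_mul (a x) (φ (firstCoords n x))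
        refine hsin.trans ?_
        refine (abs_sub_le _ (g x) _).trans ?_
        rw [add_assoc]
        gcongr
        exact abs_sub_le _ _ _
    _ = K * (∫ x, |a x - g x| ∂ν + ∫ x, |g x - g (extendZero n (firstCoords n x))| ∂ν
        + ∫ x, |g (extendZero n (firstCoords n x)) - φ (firstCoords n x)| ∂ν) := by
        rw [integral_const_mul, integral_add i12 i3, integral_add i1 i2]
    _ ≤ K * (η + η + η) := by
        gcongr
        exact hg
    _ = δ := by rw [hη]; field_simp; ring

section Paths

variable {T : ℝ} [hT : Fact (0 < T)] {H : Type*} [NormedAddCommGroup H] [InnerProductSpace ℝ H]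

theorem exists_gridTime_le_lt {N : ℕ} (hN : 0 < N) (t : Time T) :
    ∃ k ≤ N, (gridTime T N k : ℝ) ≤ t ∧ (t : ℝ) - gridTime T N k ≤ T / N := by
  have hT0 := hT.out
  have hN' : (0 : ℝ) < N := by exact_mod_cast hN
  have ht0 := t.2.1
  have hle : ⌊(t : ℝ) * N / T⌋₊ ≤ N := by
    refine Nat.floor_le_of_le ?_
    rw [div_le_iff₀ hT0, mul_comm]
    gcongr
    exact t.2.2
  refine ⟨⌊(t : ℝ) * N / T⌋₊, hle, ?_, ?_⟩
  · rw [coe_gridTime T hN hle, div_le_iff₀ hN', ← le_div_iff₀ hT0]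
    exact Nat.floor_le (by positivity)
  · rw [coe_gridTime T hN hle]
    have h1 := (Nat.lt_floor_add_one ((t : ℝ) * N / T)).le
    rw [div_le_iff₀ hT0] at h1
    rw [sub_le_iff_le_add, ← add_div, le_div_iff₀ hN']
    linarith

theorem exists_tendsto_gridTime (t : Time T) : ∃ k : ℕ → ℕ, (∀ n, k n ≤ n + 1) ∧
    Tendsto (fun n => gridTime T (n + 1) (k n)) atTop (𝓝 t) := by
  choose k hk h1 h2 using fun n : ℕ => exists_gridTime_le_lt (Nat.succ_pos n) t
  refine ⟨k, hk, ?_⟩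
  rw [tendsto_subtype_rng]
  have hlim : Tendsto (fun n : ℕ => (t : ℝ) - T / (n + 1 : ℕ)) atTop (𝓝 ((t : ℝ) - 0)) :=
    tendsto_const_nhds.sub ((tendsto_const_div_atTop_nhds_zero_nat T).comp (tendsto_add_atTop_nat 1))
  rw [sub_zero] at hlim
  refine tendsto_of_tendsto_of_tendsto_of_le_of_le hlim tendsto_const_nhds (fun n => ?_) h1
  have := h2 n
  simp only [Nat.succ_eq_add_one] at this ⊢
  linarith

variable [TopologicalSpace.SeparableSpace H]

/-- A sequence of observations that determines the path. -/
noncomputable def observation (i : ℕ) (x : PathSpace T H) : ℝ :=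
  ⟪TopologicalSpace.denseSeq H i.unpair.1,
    x (gridTime T (i.unpair.2.unpair.1 + 1)
      (min i.unpair.2.unpair.2 (i.unpair.2.unpair.1 + 1)))⟫

theorem continuous_observation :
    Continuous fun (x : PathSpace T H) (i : ℕ) => observation i x :=
  continuous_pi fun _ => continuous_const.inner (continuous_eval_const _)

theorem injective_observation :
    Function.Injective fun (x : PathSpace T H) (i : ℕ) => observation i x := by
  intro x y hxy
  have h1 : ∀ n k, k ≤ n + 1 → x (gridTime T (n + 1) k) = y (gridTime T (n + 1) k) := by
    intro n k hk
    refine ext_inner_left ℝ fun h => ?_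
    have hcl : IsClosed {h : H | ⟪h, x (gridTime T (n + 1) k)⟫ = ⟪h, y (gridTime T (n + 1) k)⟫} :=
      isClosed_eq (continuous_id.inner continuous_const) (continuous_id.inner continuous_const)
    refine (TopologicalSpace.denseRange_denseSeq H).induction_on h hcl fun a => ?_
    have := congrFun hxy (Nat.pair a (Nat.pair n k))
    simpa [observation, hk] using this
  ext t
  obtain ⟨k, hk, hkt⟩ := exists_tendsto_gridTime t
  refine tendsto_nhds_unique ((x.continuous.tendsto t).comp hkt) ?_
  refine ((y.continuous.tendsto t).comp hkt).congr fun n => ?_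
  exact (h1 n _ (hk n)).symm

/-- Any finite number of observations lives on one uniform grid. -/
theorem exists_obs_eq_observation (d : ℕ) : ∃ (N : ℕ) (_ : 0 < N) (e : Fin d → H) (m : Fin d → ℕ),
    (∀ j, m j ≤ N) ∧ ∀ x : PathSpace T H,
      obs N e m x = firstCoords d fun i => observation i x := by
  set q : Fin d → ℕ := fun j => (j : ℕ).unpair.2.unpair.1 + 1 with hq
  set p : Fin d → ℕ := fun j => min (j : ℕ).unpair.2.unpair.2 (q j) with hp
  have hq0 : ∀ j, 0 < q j := fun j => Nat.succ_pos _
  have hN : 0 < ∏ j, q j := Finset.prod_pos fun j _ => hq0 j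
  choose c hc using fun j => Finset.dvd_prod_of_mem q (Finset.mem_univ j)
  have hc0 : ∀ j, 0 < c j := fun j => Nat.pos_of_ne_zero fun h => by
    have := hc j
    rw [h, mul_zero] at this
    omega
  refine ⟨∏ j, q j, hN, fun j => TopologicalSpace.denseSeq H (j : ℕ).unpair.1,
    fun j => p j * c j, fun j => ?_, fun x => ?_⟩
  · rw [hc j]
    exact Nat.mul_le_mul_right _ (min_le_right _ _)
  · ext j
    simp only [obs, firstCoords, observation]
    rw [hc j, gridTime_mul T (hc0 j)]

variable [CompleteSpace H]

open scoped ContDiff in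
/-- Bounded measurable functions of the path are approximated in `L¹` by smooth functions of
finitely many observations. -/
theorem exists_smooth_obs {μ : Measure (PathSpace T H)} [IsFiniteMeasure μ]
    {f : PathSpace T H → ℝ} (hf : Measurable f) {K : ℝ} (hK : 0 < K) (hfK : ∀ x, |f x| ≤ K)
    {δ : ℝ} (hδ : 0 < δ) :
    ∃ (d N : ℕ) (_ : 0 < N) (e : Fin d → H) (m : Fin d → ℕ) (φ : EuclideanSpace ℝ (Fin d) → ℝ),
      (∀ j, m j ≤ N) ∧ ContDiff ℝ ∞ φ ∧ HasCompactSupport φ ∧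
      ∫ x, |f x - K * Real.sin (φ (obs N e m x))| ∂μ ≤ δ := by
  have : SecondCountableTopology H := UniformSpace.secondCountable_of_separable H
  have : PolishSpace (PathSpace T H) := inferInstance
  set Θ : PathSpace T H → ℕ → ℝ := fun x i => observation i x with hΘ
  have hΘc : Continuous Θ := continuous_observation
  have hemb : MeasurableEmbedding Θ := hΘc.measurableEmbedding injective_observation
  obtain ⟨f', hf'm, hf'⟩ := hemb.exists_measurable_extend hf fun _ => inferInstance
  set f'' : (ℕ → ℝ) → ℝ := fun y => max (-K) (min (f' y) K) with hf''
  have hf''m : Measurable f'' := measurable_const.max (hf'm.min measurable_const)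
  have hb : ∀ y, |f'' y| ≤ K := fun y => by
    rw [abs_le]
    exact ⟨le_max_left _ _, max_le (by linarith) (min_le_right _ _)⟩
  have hval : ∀ x, f'' (Θ x) = f x := fun x => by
    have h1 : f' (Θ x) = f x := congrFun hf' x
    have h2 := abs_le.1 (hfK x)
    rw [hf'']
    simp only
    rw [h1, min_eq_left h2.2, max_eq_right h2.1]
  obtain ⟨d, φ, hφs, hφc, hφ⟩ := exists_smooth_firstCoords (ν := μ.map Θ) hf''m hK hb hδ
  obtain ⟨N, hN, e, m, hm, hobs⟩ := exists_obs_eq_observation (T := T) (H := H) d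
  refine ⟨d, N, hN, e, m, φ, hm, hφs, hφc, ?_⟩
  rw [integral_map hΘc.measurable.aemeasurable] at hφ
  · simp_rw [hval] at hφ
    simp_rw [hobs]
    exact hφ
  · exact (hf''m.sub ((Real.continuous_sin.comp (hφs.continuous.comp
      (continuous_firstCoords d))).measurable.const_mul K)).abs.aestronglyMeasurable

end Paths

/-! ### The variational formula for bounded measurable functions -/

section FreeEnergy

variable {Ω : Type*} [MeasurableSpace Ω] {P : Measure Ω} [IsProbabilityMeasure P] {K : ℝ}

theorem integrable_of_abs_le {f : Ω → ℝ} (hf : Measurable f) (hfK : ∀ ω, |f ω| ≤ K) :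
    Integrable f P :=
  Integrable.of_bound hf.aestronglyMeasurable K (Eventually.of_forall hfK)

theorem integrable_exp_neg {f : Ω → ℝ} (hf : Measurable f) (hfK : ∀ ω, |f ω| ≤ K) :
    Integrable (fun ω => Real.exp (-f ω)) P := by
  refine Integrable.of_bound hf.neg.exp.aestronglyMeasurable (Real.exp K)
    (Eventually.of_forall fun ω => ?_)
  rw [Real.norm_of_nonneg (Real.exp_pos _).le, Real.exp_le_exp]
  linarith [(abs_le.1 (hfK ω)).1]

theorem exp_neg_le_integral {f : Ω → ℝ} (hf : Measurable f) (hfK : ∀ ω, |f ω| ≤ K) :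
    Real.exp (-K) ≤ ∫ ω, Real.exp (-f ω) ∂P := by
  have := integral_mono (integrable_const (μ := P) (Real.exp (-K))) (integrable_exp_neg hf hfK)
    (fun ω => Real.exp_le_exp.2 (by linarith [(abs_le.1 (hfK ω)).2]))
  simpa using this

theorem neg_log_integral_exp_le {f : Ω → ℝ} (hf : Measurable f) (hfK : ∀ ω, |f ω| ≤ K) :
    -Real.log (∫ ω, Real.exp (-f ω) ∂P) ≤ K := by
  have := Real.log_le_log (Real.exp_pos _) (exp_neg_le_integral (P := P) hf hfK)
  rw [Real.log_exp] at this
  linarith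

/-- The free energy of bounded functions is Lipschitz for the `L¹` distance. -/
theorem neg_log_integral_exp_le_add {f g : Ω → ℝ} (hf : Measurable f) (hg : Measurable g)
    (hfK : ∀ ω, |f ω| ≤ K) (hgK : ∀ ω, |g ω| ≤ K) {δ : ℝ} (hδ : ∫ ω, |f ω - g ω| ∂P ≤ δ) :
    -Real.log (∫ ω, Real.exp (-f ω) ∂P)
      ≤ -Real.log (∫ ω, Real.exp (-g ω) ∂P) + Real.exp (2 * K) * δ := by
  set a := ∫ ω, Real.exp (-f ω) ∂P with ha
  set b := ∫ ω, Real.exp (-g ω) ∂P with hb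
  have ha0 : Real.exp (-K) ≤ a := exp_neg_le_integral hf hfK
  have hap : 0 < a := (Real.exp_pos _).trans_le ha0
  have hbp : 0 < b := (Real.exp_pos _).trans_le (exp_neg_le_integral hg hgK)
  have hab : b - a ≤ Real.exp K * δ := by
    rw [ha, hb, ← integral_sub (integrable_exp_neg hg hgK) (integrable_exp_neg hf hfK)]
    have hi : Integrable (fun ω => |f ω - g ω|) P :=
      ((integrable_of_abs_le hf hfK).sub (integrable_of_abs_le hg hgK)).abs
    calc _ ≤ ∫ ω, Real.exp K * |f ω - g ω| ∂P := by
          refine integral_mono ((integrable_exp_neg hg hgK).sub (integrable_exp_neg hf hfK))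
            (hi.const_mul _) fun ω => ?_
          simp only
          have h1 : Real.exp (-g ω) - Real.exp (-f ω) ≤ Real.exp (-g ω) * (f ω - g ω) := by
            have h2 := Real.add_one_le_exp (g ω - f ω)
            have h3 : Real.exp (-f ω) = Real.exp (-g ω) * Real.exp (g ω - f ω) := by
              rw [← Real.exp_add]; ring_nf
            rw [h3]
            nlinarith [Real.exp_pos (-g ω)]
          have h4 : Real.exp (-g ω) ≤ Real.exp K :=
            Real.exp_le_exp.2 (by linarith [(abs_le.1 (hgK ω)).1])
          calc _ ≤ Real.exp (-g ω) * (f ω - g ω) := h1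
            _ ≤ Real.exp (-g ω) * |f ω - g ω| := by
                gcongr
                exact le_abs_self _
            _ ≤ Real.exp K * |f ω - g ω| := by gcongr
      _ = Real.exp K * ∫ ω, |f ω - g ω| ∂P := integral_const_mul _ _
      _ ≤ Real.exp K * δ := by gcongr
  have hlog : Real.log b - Real.log a ≤ (b - a) / a := by
    rw [← Real.log_div hbp.ne' hap.ne']
    refine (Real.log_le_sub_one_of_pos (div_pos hbp hap)).trans (le_of_eq ?_)
    field_simp
  have hδ0 : 0 ≤ δ := (integral_nonneg fun _ => abs_nonneg _).trans hδ
  have hdiv : (b - a) / a ≤ Real.exp (2 * K) * δ := by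
    rw [div_le_iff₀ hap]
    refine hab.trans ?_
    calc Real.exp K * δ = Real.exp (2 * K) * δ * Real.exp (-K) := by
          have : Real.exp K = Real.exp (2 * K) * Real.exp (-K) := by
            rw [← Real.exp_add]; ring_nf
          rw [this]; ring
      _ ≤ Real.exp (2 * K) * δ * a := by gcongr
  linarith

/-- Exponential moments of small nonnegative bounded functions. -/
theorem log_integral_exp_le {g : Ω → ℝ} (hg : Measurable g) (hg0 : ∀ ω, 0 ≤ g ω)
    (hgK : ∀ ω, g ω ≤ K) :
    Real.log (∫ ω, Real.exp (g ω) ∂P) ≤ Real.exp K * ∫ ω, g ω ∂P := by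
  have hgi : Integrable g P := integrable_of_abs_le hg fun ω => by
    rw [abs_of_nonneg (hg0 ω)]; exact hgK ω
  have hei : Integrable (fun ω => Real.exp (g ω)) P := by
    have := integrable_exp_neg (P := P) (f := fun ω => -g ω) (K := K) hg.neg fun ω => by
      rw [abs_neg, abs_of_nonneg (hg0 ω)]; exact hgK ω
    simpa using this
  have hle : ∫ ω, Real.exp (g ω) ∂P ≤ 1 + Real.exp K * ∫ ω, g ω ∂P := by
    calc _ ≤ ∫ ω, (1 + Real.exp K * g ω) ∂P := by
          refine integral_mono hei ((integrable_const _).add (hgi.const_mul _)) fun ω => ?_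
          simp only
          have h1 := Real.add_one_le_exp (-g ω)
          have h2 : Real.exp (g ω) * Real.exp (-g ω) = 1 := by
            rw [← Real.exp_add]; simp
          have h3 : Real.exp (g ω) ≤ Real.exp K := Real.exp_le_exp.2 (hgK ω)
          have h4 := mul_le_mul_of_nonneg_right h3 (hg0 ω)
          nlinarith [Real.exp_pos (g ω)]
      _ = 1 + Real.exp K * ∫ ω, g ω ∂P := by
          rw [integral_add (integrable_const _) (hgi.const_mul _), integral_const_mul]
          simp
  have hpos : 0 < ∫ ω, Real.exp (g ω) ∂P := by
    have := integral_mono (integrable_const (μ := P) (1 : ℝ)) hei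
      (fun ω => Real.one_le_exp (hg0 ω))
    simp only [integral_const, probReal_univ, one_smul] at this
    linarith
  have := Real.log_le_sub_one_of_pos hpos
  linarith

end FreeEnergy

section Variational

variable {T : ℝ} [hT : Fact (0 < T)] {H₀ H : Type*} [NormedAddCommGroup H₀]
  [InnerProductSpace ℝ H₀] [CompleteSpace H₀] [NormedAddCommGroup H] [InnerProductSpace ℝ H]
  [CompleteSpace H] [TopologicalSpace.SeparableSpace H] [MeasurableSpace H] [BorelSpace H]
  {Ω : Type*} [mΩ : MeasurableSpace Ω] {P : Measure Ω} [IsProbabilityMeasure P]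
  {ℱ : Filtration (Time T) mΩ} {J : H₀ →L[ℝ] H} {V : Ω → PathSpace T H}
  {N : ℕ} {w : ℕ → Ω → H₀} {K : ℝ} {Ψ : PathSpace T H → ℝ}

open scoped ContDiff in
theorem measurable_smooth_obs {d N₀ : ℕ} {e : Fin d → H} {m : Fin d → ℕ}
    {φ : EuclideanSpace ℝ (Fin d) → ℝ} (hφ : ContDiff ℝ ∞ φ) (K : ℝ) :
    Measurable fun x : PathSpace T H => K * Real.sin (φ (obs N₀ e m x)) :=
  (Real.continuous_sin.comp (hφ.continuous.comp (continuous_obs N₀ e m))).measurable.const_mul K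

theorem abs_mul_sin_le (hK : 0 < K) (t : ℝ) : |K * Real.sin t| ≤ K := by
  rw [abs_mul, abs_of_pos hK]
  exact mul_le_of_le_one_right hK.le (Real.abs_sin_le_one t)

/-- The lower bound of the variational formula: no step control has a smaller cost than the free
energy. -/
theorem IsWienerProcess.neg_log_le
    (hV : IsWienerProcess P ℱ (J ∘L ContinuousLinearMap.adjoint J) V)
    (hw : IsStepControl ℱ N w) (hΨ : Measurable Ψ) (hK : 0 < K) (hΨK : ∀ x, |Ψ x| ≤ K) :
    -Real.log (∫ ω, Real.exp (-Ψ (V ω)) ∂P)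
      ≤ ∫ ω, stepCost T N w ω ∂P + ∫ ω, Ψ (shift J V N w ω) ∂P := by
  have hVm := hV.measurable
  have hsm : Measurable (shift J V N w) := hw.measurable_shift hVm
  refine le_of_forall_pos_le_add fun δ hδ => ?_
  set η := δ / (Real.exp (2 * K) + 1) with hη
  have hE := Real.exp_pos (2 * K)
  have hη0 : 0 < η := by positivity
  -- The approximation has to be good under the laws of `V` and of the shifted path at once.
  obtain ⟨d, N₀, hN₀, e, m, φ, hm, hφs, hφc, hφ⟩ :=
    exists_smooth_obs (μ := P.map V + P.map (shift J V N w)) hΨ hK hΨK hη0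
  set Ψ' : PathSpace T H → ℝ := fun x => K * Real.sin (φ (obs N₀ e m x)) with hΨ'
  have hΨ'm : Measurable Ψ' := measurable_smooth_obs hφs K
  have hΨ'K : ∀ x, |Ψ' x| ≤ K := fun x => abs_mul_sin_le hK _
  have hi : ∀ {X : Ω → PathSpace T H}, Measurable X → Integrable (fun x => |Ψ x - Ψ' x|) (P.map X) :=
    fun hX => by
      have := Measure.isProbabilityMeasure_map (μ := P) hX.aemeasurable
      exact ((integrable_of_abs_le hΨ hΨK).sub (integrable_of_abs_le hΨ'm hΨ'K)).abs
  have hm' : ∀ {X : Ω → PathSpace T H}, Measurable X →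
      ∫ x, |Ψ x - Ψ' x| ∂(P.map X) = ∫ ω, |Ψ (X ω) - Ψ' (X ω)| ∂P := fun hX =>
    integral_map hX.aemeasurable (hΨ.sub hΨ'm).abs.aestronglyMeasurable
  rw [integral_add_measure (hi hVm) (hi hsm), hm' hVm, hm' hsm] at hφ
  have n1 : 0 ≤ ∫ ω, |Ψ (V ω) - Ψ' (V ω)| ∂P := integral_nonneg fun _ => abs_nonneg _
  have n2 : 0 ≤ ∫ ω, |Ψ (shift J V N w ω) - Ψ' (shift J V N w ω)| ∂P :=
    integral_nonneg fun _ => abs_nonneg _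
  obtain ⟨K', G, hreg⟩ := exists_regularPotential hφs hφc hK.le
  have h1 := hV.neg_log_regular_le hw hN₀ e hm hreg
  simp only [Real.log_exp, integral_neg, sub_neg_eq_add] at h1
  have h2 := neg_log_integral_exp_le_add (P := P) (hΨ.comp hVm) (hΨ'm.comp hVm)
    (fun ω => hΨK (V ω)) (fun ω => hΨ'K (V ω)) (δ := η) (by simp only [Function.comp]; linarith)
  have h3 : ∫ ω, Ψ' (shift J V N w ω) ∂P ≤ ∫ ω, Ψ (shift J V N w ω) ∂P + η := by
    have i1 : Integrable (fun ω => Ψ' (shift J V N w ω)) P :=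
      integrable_of_abs_le (hΨ'm.comp hsm) fun ω => hΨ'K _
    have i2 : Integrable (fun ω => Ψ (shift J V N w ω)) P :=
      integrable_of_abs_le (hΨ.comp hsm) fun ω => hΨK _
    have : ∫ ω, Ψ' (shift J V N w ω) ∂P - ∫ ω, Ψ (shift J V N w ω) ∂P
        ≤ ∫ ω, |Ψ (shift J V N w ω) - Ψ' (shift J V N w ω)| ∂P := by
      rw [← integral_sub i1 i2]
      refine integral_mono (i1.sub i2) (i2.sub i1).abs fun ω => ?_
      simp only
      rw [abs_sub_comm]
      exact le_abs_self _
    linarith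
  have h4 : Real.exp (2 * K) * η + η = δ := by rw [hη]; field_simp
  simp only [Function.comp] at h2
  simp only [hΨ'] at h2 h3
  linarith

/-- The upper bound of the variational formula: step controls attain the free energy up to
arbitrarily small errors. The law of the shifted path has bounded relative entropy with respect to
the law of `V`, which is expressed by the lower bound for `-c |Ψ - Ψ'|`, with `c` large. -/
theorem IsWienerProcess.exists_le_neg_log
    (hV : IsWienerProcess P ℱ (J ∘L ContinuousLinearMap.adjoint J) V)
    (hΨ : Measurable Ψ) (hK : 0 < K) (hΨK : ∀ x, |Ψ x| ≤ K) {δ : ℝ} (hδ : 0 < δ) :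
    ∃ (N : ℕ) (w : ℕ → Ω → H₀), IsStepControl ℱ N w ∧
      ∫ ω, stepCost T N w ω ∂P + ∫ ω, Ψ (shift J V N w ω) ∂P
        ≤ -Real.log (∫ ω, Real.exp (-Ψ (V ω)) ∂P) + δ := by
  have hVm := hV.measurable
  set c := 4 * (2 * K + 1) / δ with hc
  have hc0 : 0 < c := by positivity
  set D := Real.exp (2 * K) + Real.exp (c * (2 * K)) with hD
  have hD0 : 0 < D := by positivity
  set η := δ / (4 * D) with hη
  have hη0 : 0 < η := by positivity
  have hDη : D * η = δ / 4 := by rw [hη]; field_simp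
  have := Measure.isProbabilityMeasure_map (μ := P) hVm.aemeasurable
  obtain ⟨d, N₀, hN₀, e, m, φ, hm, hφs, hφc, hφ⟩ :=
    exists_smooth_obs (μ := P.map V) hΨ hK hΨK hη0
  set Ψ' : PathSpace T H → ℝ := fun x => K * Real.sin (φ (obs N₀ e m x)) with hΨ'
  have hΨ'm : Measurable Ψ' := measurable_smooth_obs hφs K
  have hΨ'K : ∀ x, |Ψ' x| ≤ K := fun x => abs_mul_sin_le hK _
  set g : PathSpace T H → ℝ := fun x => |Ψ x - Ψ' x| with hg
  have hgm : Measurable g := (hΨ.sub hΨ'm).abs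
  have hg0 : ∀ x, 0 ≤ g x := fun x => abs_nonneg _
  have hgK : ∀ x, g x ≤ 2 * K := fun x => by
    have h1 := abs_le.1 (hΨK x)
    have h2 := abs_le.1 (hΨ'K x)
    rw [hg, abs_le]
    constructor <;> linarith
  rw [integral_map hVm.aemeasurable hgm.aestronglyMeasurable] at hφ
  obtain ⟨K', G, hreg⟩ := exists_regularPotential hφs hφc hK.le
  obtain ⟨N, w, hw, hle⟩ := hV.exists_le_neg_log_regular hN₀ e hm hreg
    (δ := min (δ / 4) 1) (by positivity)
  simp only [Real.log_exp, integral_neg, sub_neg_eq_add] at hle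
  have hsm : Measurable (shift J V N w) := hw.measurable_shift hVm
  refine ⟨N, w, hw, ?_⟩
  have hmin1 := min_le_left (δ / 4) 1
  have hmin2 := min_le_right (δ / 4) 1
  have h2 := neg_log_integral_exp_le_add (P := P) (hΨ'm.comp hVm) (hΨ.comp hVm)
    (fun ω => hΨ'K (V ω)) (fun ω => hΨK (V ω)) (δ := η) (by
      simp only [Function.comp]
      simp_rw [abs_sub_comm (Ψ' _)]
      exact hφ)
  simp only [Function.comp] at h2
  have i1 : Integrable (fun ω => Ψ' (shift J V N w ω)) P :=
    integrable_of_abs_le (hΨ'm.comp hsm) fun ω => hΨ'K _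
  have i2 : Integrable (fun ω => Ψ (shift J V N w ω)) P :=
    integrable_of_abs_le (hΨ.comp hsm) fun ω => hΨK _
  have ig : Integrable (fun ω => g (shift J V N w ω)) P := (i2.sub i1).abs
  -- The energy of the control is bounded, independently of `c` and `η`, …
  have hcost : ∫ ω, stepCost T N w ω ∂P ≤ 2 * K + 1 := by
    have h3 : -Real.log (∫ ω, Real.exp (-Ψ' (V ω)) ∂P) ≤ K :=
      neg_log_integral_exp_le (hΨ'm.comp hVm) fun ω => hΨ'K _
    have h4 : -K ≤ ∫ ω, Ψ' (shift J V N w ω) ∂P := by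
      have := integral_mono (integrable_const (μ := P) (-K)) i1 fun ω => (abs_le.1 (hΨ'K _)).1
      simpa using this
    simp only [hΨ'] at h3 h4
    linarith
  -- … so that the approximation is good for the shifted path too.
  have hgs : ∫ ω, g (shift J V N w ω) ∂P ≤ δ / 4 + Real.exp (c * (2 * K)) * η := by
    have h5 := hV.neg_log_le hw (Ψ := fun x => -(c * g x)) (K := c * (2 * K))
      (hgm.const_mul c).neg (by positivity) (fun x => by
        rw [abs_neg, abs_of_nonneg (mul_nonneg hc0.le (hg0 x))]
        exact mul_le_mul_of_nonneg_left (hgK x) hc0.le)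
    simp only [neg_neg, integral_neg, integral_const_mul] at h5
    have h6 := log_integral_exp_le (P := P) (g := fun ω => c * g (V ω)) (K := c * (2 * K))
      ((hgm.comp hVm).const_mul c) (fun ω => mul_nonneg hc0.le (hg0 _))
      (fun ω => mul_le_mul_of_nonneg_left (hgK _) hc0.le)
    rw [integral_const_mul] at h6
    have h7 : Real.exp (c * (2 * K)) * (c * ∫ ω, g (V ω) ∂P)
        ≤ c * (Real.exp (c * (2 * K)) * η) := by
      rw [mul_left_comm]
      gcongr
    have h8 : c * (δ / 4) = 2 * K + 1 := by rw [hc]; field_simp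
    refine le_of_mul_le_mul_left ?_ hc0
    rw [mul_add, h8]
    linarith
  have h9 : ∫ ω, Ψ (shift J V N w ω) ∂P
      ≤ ∫ ω, Ψ' (shift J V N w ω) ∂P + ∫ ω, g (shift J V N w ω) ∂P := by
    rw [← integral_add i1 ig]
    refine integral_mono i2 (i1.add ig) fun ω => ?_
    have := le_abs_self (Ψ (shift J V N w ω) - Ψ' (shift J V N w ω))
    simp only [hg]
    linarith
  have h10 : Real.exp (2 * K) * η + Real.exp (c * (2 * K)) * η = δ / 4 := by
    rw [← add_mul]; exact hDη
  simp only [hΨ'] at h2 h9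
  linarith

/-! ### Truncation and scaling of controls -/

/-- The step control `w`, switched off as soon as its energy exceeds `M`. -/
noncomputable def truncate (T : ℝ) (M : ℝ) (N : ℕ) (w : ℕ → Ω → H₀) (k : ℕ) (ω : Ω) : H₀ :=
  open Classical in
  if T / N * ∑ j ∈ Finset.range (k + 1), ‖w j ω‖ ^ 2 ≤ M then w k ω else 0

theorem norm_truncate_le (M : ℝ) (N : ℕ) (w : ℕ → Ω → H₀) (k : ℕ) (ω : Ω) :
    ‖truncate T M N w k ω‖ ≤ ‖w k ω‖ := by
  rw [truncate]
  split_ifs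
  · exact le_rfl
  · simp

theorem sum_truncate_le {M : ℝ} (hM : 0 ≤ M) (N : ℕ) (w : ℕ → Ω → H₀) (n : ℕ) (ω : Ω) :
    T / N * ∑ k ∈ Finset.range n, ‖truncate T M N w k ω‖ ^ 2 ≤ M := by
  have hT0 := hT.out
  induction n with
  | zero => simpa using hM
  | succ n ih =>
    by_cases h : T / N * ∑ j ∈ Finset.range (n + 1), ‖w j ω‖ ^ 2 ≤ M
    · refine le_trans ?_ h
      gcongr with k
      exact norm_truncate_le M N w k ω
    · have : truncate T M N w n ω = 0 := by rw [truncate, if_neg h]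
      rw [Finset.sum_range_succ, this]
      simpa using ih

theorem truncate_eq {M : ℝ} {N : ℕ} {w : ℕ → Ω → H₀} {ω : Ω}
    (h : T / N * ∑ j ∈ Finset.range N, ‖w j ω‖ ^ 2 ≤ M) {k : ℕ} (hk : k < N) :
    truncate T M N w k ω = w k ω := by
  have hT0 := hT.out
  rw [truncate, if_pos]
  refine le_trans ?_ h
  gcongr
  exact hk

theorem IsStepControl.truncate (hw : IsStepControl ℱ N w) (M : ℝ) :
    IsStepControl ℱ N (truncate T M N w) := by
  obtain ⟨B, hB⟩ := hw.bounded
  refine ⟨hw.pos, fun k hk => ?_, B, fun k hk ω => (norm_truncate_le M N w k ω).trans (hB k hk ω)⟩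
  refine StronglyMeasurable.ite ?_ (hw.adapted k hk) stronglyMeasurable_const
  refine measurableSet_le (Measurable.const_mul ?_ _) measurable_const
  refine Finset.measurable_fun_sum _ fun j hj => ?_
  have hjk : j ≤ k := Nat.lt_succ_iff.1 (Finset.mem_range.1 hj)
  exact (((hw.adapted j (by omega)).mono (ℱ.mono (gridTime_mono T N hjk))).norm.pow 2).measurable

theorem IsStepControl.const_smul (hw : IsStepControl ℱ N w) (c : ℝ) :
    IsStepControl ℱ N fun k ω => c • w k ω := by
  obtain ⟨B, hB⟩ := hw.bounded
  refine ⟨hw.pos, fun k hk => (hw.adapted k hk).const_smul c, ‖c‖ * B, fun k hk ω => ?_⟩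
  rw [norm_smul]
  exact mul_le_mul_of_nonneg_left (hB k hk ω) (norm_nonneg _)

/-- The upper bound of the variational formula in the scaling of the Laplace principle, with
controls of energy at most `M`. -/
theorem IsWienerProcess.exists_scaled_le
    (hV : IsWienerProcess P ℱ (J ∘L ContinuousLinearMap.adjoint J) V) {f : PathSpace T H → ℝ}
    (hf : Measurable f) (hK : 0 < K) (hfK : ∀ x, |f x| ≤ K) {a M δ : ℝ} (ha : 0 < a) (hM : 0 < M)
    (hδ : 0 < δ) :
    ∃ (N : ℕ) (w : ℕ → Ω → H₀), IsStepControl ℱ N w ∧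
      (∀ ω, energy (gridL2 T N fun k => w k ω) ≤ M) ∧
      ∫ ω, stepCost T N w ω ∂P
        + ∫ ω, f (V ω + √a • primitive J (gridL2 T N fun k => w k ω)) ∂P
        ≤ -(1 / a * Real.log (∫ ω, Real.exp (-a * f (V ω)) ∂P)) + δ + 4 * K * (2 * K + δ) / M := by
  have hVm := hV.measurable
  obtain ⟨N, w, hw, hle⟩ := hV.exists_le_neg_log (Ψ := fun x => a * f x) (K := a * K)
    (hf.const_mul a) (by positivity) (fun x => by
      rw [abs_mul, abs_of_pos ha]; exact mul_le_mul_of_nonneg_left (hfK x) ha.le)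
    (δ := a * δ) (by positivity)
  set v := LaplacePrincipleWiener.truncate T (a * M) N w with hv
  have hvs : IsStepControl ℱ N v := hw.truncate (a * M)
  have hsa : 0 < √a := Real.sqrt_pos.2 ha
  set u : ℕ → Ω → H₀ := fun k ω => (√a)⁻¹ • v k ω with hu
  have hus : IsStepControl ℱ N u := hvs.const_smul _
  have hgu : ∀ ω, gridL2 T N (fun k => u k ω) = (√a)⁻¹ • gridL2 T N fun k => v k ω := fun ω =>
    gridL2_smul N _ _
  have heu : ∀ ω, energy (gridL2 T N fun k => u k ω) = a⁻¹ * energy (gridL2 T N fun k => v k ω) := by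
    intro ω
    rw [hgu, energy_eq_norm_sq, energy_eq_norm_sq, norm_smul, mul_pow, norm_inv, inv_pow,
      Real.norm_of_nonneg hsa.le, Real.sq_sqrt ha.le]
  have hev : ∀ ω, energy (gridL2 T N fun k => v k ω) ≤ a * M := fun ω => by
    rw [energy_gridL2 hw.pos]
    exact sum_truncate_le (by positivity) N w N ω
  have hpu : ∀ ω, V ω + √a • primitive J (gridL2 T N fun k => u k ω) = shift J V N v ω := by
    intro ω
    rw [shift, hgu, primitive_smul, smul_smul, mul_inv_cancel₀ hsa.ne', one_smul]
  have hcv : ∀ ω, stepCost T N v ω ≤ stepCost T N w ω := by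
    intro ω
    have hT0 := hT.out
    rw [hvs.stepCost_eq, hw.stepCost_eq]
    gcongr with k
    exact norm_truncate_le _ _ _ _ _
  have hcu : ∀ ω, stepCost T N u ω = a⁻¹ * stepCost T N v ω := fun ω => by
    rw [stepCost, stepCost, heu]; ring
  -- Where the control is switched off, its cost is at least `a M / 2`, which pays for the change of
  -- `f` by at most `2 K`.
  have hfv : ∀ ω, f (shift J V N v ω) ≤ f (shift J V N w ω)
      + 4 * K / (a * M) * stepCost T N w ω := by
    intro ω
    have hc0 := stepCost_nonneg (T := T) N w ω
    by_cases h : T / N * ∑ j ∈ Finset.range N, ‖w j ω‖ ^ 2 ≤ a * M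
    · have : shift J V N v ω = shift J V N w ω := by
        rw [shift, shift, gridL2_congr fun k hk => truncate_eq h hk]
      rw [this]
      exact le_add_of_nonneg_right (by positivity)
    · push Not at h
      have h1 : 2 * K ≤ 4 * K / (a * M) * stepCost T N w ω := by
        rw [hw.stepCost_eq, div_mul_eq_mul_div, le_div_iff₀ (by positivity)]
        nlinarith [mul_lt_mul_of_pos_left h hK]
      have h2 := (abs_le.1 (hfK (shift J V N v ω))).2
      have h3 := (abs_le.1 (hfK (shift J V N w ω))).1
      linarith
  have ic : Integrable (stepCost T N w) P := hw.integrable_stepCost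
  have iw : Integrable (fun ω => f (shift J V N w ω)) P :=
    integrable_of_abs_le (hf.comp (hw.measurable_shift hVm)) fun ω => hfK _
  have iv : Integrable (fun ω => f (shift J V N v ω)) P :=
    integrable_of_abs_le (hf.comp (hvs.measurable_shift hVm)) fun ω => hfK _
  have h1 : ∫ ω, f (shift J V N v ω) ∂P ≤ ∫ ω, f (shift J V N w ω) ∂P
      + 4 * K / (a * M) * ∫ ω, stepCost T N w ω ∂P := by
    rw [← integral_const_mul, ← integral_add iw (ic.const_mul _)]
    exact integral_mono iv (iw.add (ic.const_mul _)) hfv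
  have h2 : ∫ ω, stepCost T N v ω ∂P ≤ ∫ ω, stepCost T N w ω ∂P :=
    integral_mono hvs.integrable_stepCost ic hcv
  have h3 : ∫ ω, stepCost T N u ω ∂P = a⁻¹ * ∫ ω, stepCost T N v ω ∂P := by
    simp_rw [hcu]; exact integral_const_mul _ _
  have h4 : ∫ ω, stepCost T N w ω ∂P ≤ a * (2 * K + δ) := by
    have h5 : -Real.log (∫ ω, Real.exp (-(a * f (V ω))) ∂P) ≤ a * K :=
      neg_log_integral_exp_le ((hf.comp hVm).const_mul a) fun ω => by
        rw [abs_mul, abs_of_pos ha]; exact mul_le_mul_of_nonneg_left (hfK _) ha.le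
    have h6 : -K ≤ ∫ ω, f (shift J V N w ω) ∂P := by
      have := integral_mono (integrable_const (μ := P) (-K)) iw fun ω => (abs_le.1 (hfK _)).1
      simpa using this
    rw [integral_const_mul] at hle
    nlinarith
  refine ⟨N, u, hus, fun ω => ?_, ?_⟩
  · rw [heu, inv_mul_le_iff₀ ha]
    exact hev ω
  · simp_rw [hpu, neg_mul]
    rw [h3]
    rw [integral_const_mul] at hle
    have h7 : 4 * K / (a * M) * ∫ ω, stepCost T N w ω ∂P ≤ 4 * K * (2 * K + δ) / M := by
      calc _ ≤ 4 * K / (a * M) * (a * (2 * K + δ)) := by gcongr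
        _ = 4 * K * (2 * K + δ) / M := by field_simp
    have h8 : a⁻¹ * ∫ ω, stepCost T N v ω ∂P + ∫ ω, f (shift J V N w ω) ∂P
        ≤ -(1 / a * Real.log (∫ ω, Real.exp (-(a * f (V ω))) ∂P)) + δ := by
      refine le_of_mul_le_mul_left ?_ ha
      have e1 : a * (a⁻¹ * ∫ ω, stepCost T N v ω ∂P + ∫ ω, f (shift J V N w ω) ∂P)
          = ∫ ω, stepCost T N v ω ∂P + a * ∫ ω, f (shift J V N w ω) ∂P := by
        field_simp
      have e2 : a * (-(1 / a * Real.log (∫ ω, Real.exp (-(a * f (V ω))) ∂P)) + δ)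
          = -Real.log (∫ ω, Real.exp (-(a * f (V ω))) ∂P) + a * δ := by
        field_simp
      rw [e1, e2]
      linarith
    linarith

end Variational

/-! ### The ball `S_M` with the weak topology -/

/-- An injective Hilbert–Schmidt operator has a separable domain: all but countably many members of
an orthonormal basis are mapped to `0`. -/
theorem IsHilbertSchmidt.separableSpace {H₀ H : Type*} [NormedAddCommGroup H₀]
    [InnerProductSpace ℝ H₀] [NormedAddCommGroup H] [InnerProductSpace ℝ H] {J : H₀ →L[ℝ] H}
    (hJ : Function.Injective J) (h : IsHilbertSchmidt J) : TopologicalSpace.SeparableSpace H₀ := by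
  obtain ⟨ι, e, he⟩ := h
  have hsupp : (Function.support fun i => ‖J (e i)‖ ^ 2) = Set.univ := by
    ext i
    simp only [Function.mem_support, ne_eq, Set.mem_univ, iff_true]
    intro h0
    have h1 : J (e i) = 0 := by simpa using h0
    have h2 : e i = 0 := hJ (by rw [h1, map_zero])
    have h3 := e.orthonormal.1 i
    rw [h2, norm_zero] at h3
    exact zero_ne_one h3
  have hc : Countable ι := by
    have := he.countable_support
    rw [hsupp] at this
    exact Set.countable_univ_iff.1 this
  have h1 : TopologicalSpace.IsSeparable (Set.range e) := (Set.countable_range e).isSeparable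
  have h2 := (h1.span (R := ℝ)).closure
  have h3 : closure (Submodule.span ℝ (Set.range e) : Set H₀) = Set.univ := by
    rw [← Submodule.topologicalClosure_coe, e.dense_span]
    rfl
  rw [h3] at h2
  exact TopologicalSpace.isSeparable_univ_iff.1 h2

section WeakBall

variable {T : ℝ} {H₀ : Type*} [NormedAddCommGroup H₀] [InnerProductSpace ℝ H₀] [CompleteSpace H₀]
  {M : ℝ≥0}

theorem SBall.continuous_iff {X : Type*} [TopologicalSpace X] {f : X → SBall T H₀ M} :
    Continuous f ↔ ∀ v : L2 T H₀, Continuous fun x => ⟪v, (f x).val⟫ := by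
  rw [continuous_induced_rng]
  constructor
  · intro h v
    exact (WeakBilin.eval_continuous (topDualPairing ℝ (L2 T H₀)).flip
      (InnerProductSpace.toDual ℝ (L2 T H₀) v)).comp h
  · intro h
    refine WeakBilin.continuous_of_continuous_eval _ fun l => ?_
    refine (h ((InnerProductSpace.toDual ℝ (L2 T H₀)).symm l)).congr fun x => ?_
    exact InnerProductSpace.toDual_symm_apply

theorem SBall.continuous_inner (v : L2 T H₀) :
    Continuous fun u : SBall T H₀ M => ⟪v, u.val⟫ :=
  SBall.continuous_iff.1 continuous_id v

theorem SBall.continuous_of_continuous_val {X : Type*} [TopologicalSpace X] {f : X → SBall T H₀ M}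
    (hf : Continuous fun x => (f x).val) : Continuous f :=
  SBall.continuous_iff.2 fun _ => continuous_const.inner hf

theorem SBall.measurable_of_stronglyMeasurable_val {Ω : Type*} [MeasurableSpace Ω]
    {f : Ω → SBall T H₀ M} (hf : StronglyMeasurable fun ω => (f ω).val) : Measurable f := by
  borelize (L2 T H₀)
  have h1 : Measurable fun ω => (⟨(f ω).val, (f ω).2⟩ : {w : L2 T H₀ // energy w ≤ M}) :=
    hf.measurable.subtype_mk
  let j : {w : L2 T H₀ // energy w ≤ M} → SBall T H₀ M := fun w => w
  have h2 : Continuous j := SBall.continuous_of_continuous_val continuous_subtype_val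
  exact h2.measurable.comp h1

theorem SBall.norm_val_le (u : SBall T H₀ M) : ‖u.val‖ ≤ √M := by
  have := u.2
  rw [energy_eq_norm_sq] at this
  exact Real.le_sqrt_of_sq_le this

/-- Banach–Alaoglu for `S_M`, transported through the Riesz isomorphism. -/
instance instCompactSpaceSBall : CompactSpace (SBall T H₀ M) := by
  set K : Set (WeakDual ℝ (L2 T H₀)) := WeakDual.toStrongDual ⁻¹' Metric.closedBall 0 √M
  have hK : IsCompact K := WeakDual.isCompact_closedBall 0 √M
  have : CompactSpace K := isCompact_iff_compactSpace.1 hK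
  have hmem : ∀ φ : K, energy ((InnerProductSpace.toDual ℝ (L2 T H₀)).symm
      (WeakDual.toStrongDual φ.1)) ≤ M := by
    intro φ
    have h1 : ‖WeakDual.toStrongDual φ.1‖ ≤ √M :=
      (dist_zero_right (WeakDual.toStrongDual φ.1)).symm.trans_le φ.2
    rw [energy_eq_norm_sq, LinearIsometryEquiv.norm_map]
    exact (Real.le_sqrt (norm_nonneg _) M.2).1 h1
  let G : K → SBall T H₀ M := fun φ => ⟨_, hmem φ⟩
  have hG : Continuous G := by
    refine SBall.continuous_iff.2 fun v => ?_
    refine ((WeakDual.eval_continuous v).comp continuous_subtype_val).congr fun φ => ?_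
    change _ = ⟪v, (InnerProductSpace.toDual ℝ (L2 T H₀)).symm (WeakDual.toStrongDual φ.1)⟫
    rw [real_inner_comm, InnerProductSpace.toDual_symm_apply]
    rfl
  have hsurj : Function.Surjective G := by
    intro u
    refine ⟨⟨StrongDual.toWeakDual (InnerProductSpace.toDual ℝ (L2 T H₀) u.val), ?_⟩, ?_⟩
    · change dist (InnerProductSpace.toDual ℝ (L2 T H₀) u.val) 0 ≤ √M
      rw [dist_zero_right, LinearIsometryEquiv.norm_map]
      exact u.norm_val_le
    · apply Subtype.ext
      exact LinearIsometryEquiv.symm_apply_apply _ _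
  exact hsurj.compactSpace hG

variable [TopologicalSpace.SeparableSpace H₀]

theorem separableSpace_L2 : TopologicalSpace.SeparableSpace (L2 T H₀) := by
  have : Fact ((1 : ℝ≥0∞) ≤ 2) := ⟨one_le_two⟩
  have : Fact ((2 : ℝ≥0∞) ≠ ∞) := ⟨by simp⟩
  infer_instance

instance instMetrizableSpaceSBall : TopologicalSpace.MetrizableSpace (SBall T H₀ M) := by
  have := separableSpace_L2 (T := T) (H₀ := H₀)
  refine Metric.PiNatEmbed.TopologicalSpace.MetrizableSpace.of_countable_separating
    (fun n u => ⟪TopologicalSpace.denseSeq (L2 T H₀) n, u.val⟫) (fun n => SBall.continuous_inner _)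
    fun u v huv => ?_
  by_contra! h
  refine huv (Subtype.ext ?_)
  have h1 : (fun x : L2 T H₀ => ⟪x, u.val⟫) = fun x => ⟪x, v.val⟫ :=
    (TopologicalSpace.denseRange_denseSeq (L2 T H₀)).equalizer
      (continuous_id.inner continuous_const) (continuous_id.inner continuous_const) (funext h)
  exact ext_inner_left ℝ fun x => congrFun h1 x

instance instSeparableSpaceSBall : TopologicalSpace.SeparableSpace (SBall T H₀ M) := by
  let _ := TopologicalSpace.metrizableSpaceMetric (SBall T H₀ M)
  infer_instance

/-- Weak lower semicontinuity of the energy, in the form used below: `½ ‖u‖²` is an increasing limit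
of weakly continuous functions, namely of finite maxima of `⟪x, u⟫ - ½ ‖x‖² = ½ ‖u‖² - ½ ‖u - x‖²`
over `x` in a dense sequence. -/
theorem exists_continuous_tendsto_energy (M : ℝ≥0) : ∃ f : ℕ → C(SBall T H₀ M, ℝ),
    (∀ n u, 0 ≤ f n u) ∧ (∀ n u, f n u ≤ 1 / 2 * energy u.val) ∧
    ∀ u, Tendsto (fun n => f n u) atTop (𝓝 (1 / 2 * energy u.val)) := by
  have := separableSpace_L2 (T := T) (H₀ := H₀)
  set x := TopologicalSpace.denseSeq (L2 T H₀) with hx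
  have hgap : ∀ (u : SBall T H₀ M) i,
      1 / 2 * energy u.val - (⟪x i, u.val⟫ - 1 / 2 * ‖x i‖ ^ 2) = 1 / 2 * ‖u.val - x i‖ ^ 2 := by
    intro u i
    rw [energy_eq_norm_sq, norm_sub_sq_real, real_inner_comm]
    ring
  let G : ℕ → C(SBall T H₀ M, ℝ) := fun i =>
    ⟨fun u => ⟪x i, u.val⟫ - 1 / 2 * ‖x i‖ ^ 2, (SBall.continuous_inner _).sub continuous_const⟩
  let f : ℕ → C(SBall T H₀ M, ℝ) := fun n => Nat.rec 0 (fun i g => g ⊔ G i) n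
  have hmono : Monotone f := monotone_nat_of_le_succ fun n => le_sup_left
  have hle : ∀ n u, f n u ≤ 1 / 2 * energy u.val := by
    intro n u
    induction n with
    | zero =>
      change (0 : ℝ) ≤ _
      rw [energy_eq_norm_sq]; positivity
    | succ n ih =>
      change f n u ⊔ G n u ≤ _
      refine sup_le ih ?_
      have h1 := hgap u n
      have h2 : 0 ≤ 1 / 2 * ‖u.val - x n‖ ^ 2 := by positivity
      change ⟪x n, u.val⟫ - 1 / 2 * ‖x n‖ ^ 2 ≤ _
      linarith
  refine ⟨f, fun n u => hmono (Nat.zero_le n) u, hle, fun u => ?_⟩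
  refine Metric.tendsto_atTop.2 fun δ hδ => ?_
  obtain ⟨i, hi⟩ := (TopologicalSpace.denseRange_denseSeq (L2 T H₀)).exists_dist_lt u.val
    (Real.sqrt_pos.2 hδ)
  refine ⟨i + 1, fun n hn => ?_⟩
  have h1 : G i u ≤ f n u :=
    le_trans (le_sup_right : G i ≤ f i ⊔ G i) (hmono hn) u
  have h2 := hgap u i
  rw [dist_eq_norm] at hi
  have h3 : ‖u.val - x i‖ ^ 2 < δ := by
    have := pow_lt_pow_left₀ hi (norm_nonneg _) two_ne_zero
    rwa [Real.sq_sqrt hδ.le] at this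
  change ⟪x i, u.val⟫ - 1 / 2 * ‖x i‖ ^ 2 ≤ _ at h1
  rw [dist_comm, Real.dist_eq, abs_of_nonneg (by linarith [hle n u])]
  linarith

end WeakBall

/-! ### Density of step functions -/

section Density

variable {T : ℝ} [hT : Fact (0 < T)] {H₀ : Type*} [NormedAddCommGroup H₀] [InnerProductSpace ℝ H₀]

theorem exists_mem_slot {N : ℕ} (hN : 0 < N) {t : Time T} (ht : t ≠ ⊥) :
    ∃ k < N, t ∈ slot T N k := by
  classical
  have hex : ∃ k, t ≤ gridTime T N k := by
    refine ⟨N, ?_⟩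
    rw [← Subtype.coe_le_coe, coe_gridTime T hN le_rfl, mul_div_cancel_left₀ _ (by positivity)]
    exact t.2.2
  have hfN : Nat.find hex ≤ N := by
    refine Nat.find_le ?_
    rw [← Subtype.coe_le_coe, coe_gridTime T hN le_rfl, mul_div_cancel_left₀ _ (by positivity)]
    exact t.2.2
  have h0 : Nat.find hex ≠ 0 := by
    intro h0
    have := Nat.find_spec hex
    rw [h0, gridTime_zero] at this
    exact ht (le_bot_iff.1 this)
  obtain ⟨k, hk⟩ := Nat.exists_eq_succ_of_ne_zero h0
  refine ⟨k, by omega, ?_, ?_⟩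
  · exact not_le.1 (Nat.find_min hex (by omega))
  · have := Nat.find_spec hex
    rwa [hk] at this

theorem gridL2_ae_eq_of_mem_slot (N : ℕ) (a : ℕ → H₀) :
    ∀ᵐ t ∂(leb T), ∀ k < N, t ∈ slot T N k → gridL2 T N a t = a k := by
  filter_upwards [coeFn_gridL2 (T := T) N a] with t ht k hk htk
  rw [ht, Finset.sum_eq_single_of_mem k (Finset.mem_range.2 hk), Set.indicator_of_mem htk]
  intro i _ hik
  exact Set.indicator_of_notMem (fun h => Set.disjoint_left.1 (disjoint_slot hik) h htk) _

theorem exists_norm_gridL2_sub_lt (u : L2 T H₀) {δ : ℝ} (hδ : 0 < δ) :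
    ∃ (N : ℕ) (a : ℕ → H₀), 0 < N ∧ ‖gridL2 T N a - u‖ < δ := by
  have hT0 := hT.out
  obtain ⟨f, hf⟩ := (ContinuousMap.toLp_denseRange H₀ (leb T) ℝ (p := 2) (by simp)).exists_dist_lt u
    (half_pos hδ)
  set c : ℝ := T ^ ((2 : ℝ≥0∞).toReal)⁻¹ with hc
  have hc0 : 0 ≤ c := by positivity
  set η : ℝ := δ / (2 * (c + 1)) with hη
  have hη0 : 0 < η := by positivity
  obtain ⟨ρ, hρ, hfρ⟩ := Metric.uniformContinuous_iff.1
    (CompactSpace.uniformContinuous_of_continuous f.continuous) η hη0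
  obtain ⟨n, hn⟩ := exists_nat_gt (T / ρ)
  have hN : 0 < n := by
    have : (0 : ℝ) < n := lt_trans (by positivity) hn
    exact_mod_cast this
  have hN' : (0 : ℝ) < n := by exact_mod_cast hN
  have hTn : T / n < ρ := by
    rw [div_lt_iff₀ hρ] at hn
    rw [div_lt_iff₀ hN']
    linarith
  refine ⟨n, fun k => f (gridTime T n k), hN, ?_⟩
  have hbot : ∀ᵐ t ∂(leb T), t ≠ ⊥ := by
    have : leb T {(⊥ : Time T)} = 0 := by rw [leb_apply]; simp
    exact compl_mem_ae_iff.2 this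
  have hae : ∀ᵐ t ∂(leb T), ‖(gridL2 T n (fun k => f (gridTime T n k)) -
      ContinuousMap.toLp 2 (leb T) ℝ f : L2 T H₀) t‖ ≤ η := by
    filter_upwards [hbot, gridL2_ae_eq_of_mem_slot n (fun k => f (gridTime T n k)),
      Lp.coeFn_sub (gridL2 T n (fun k => f (gridTime T n k))) (ContinuousMap.toLp 2 (leb T) ℝ f),
      ContinuousMap.coeFn_toLp (p := 2) (𝕜 := ℝ) (leb T) f] with t ht0 ht1 ht2 ht3
    obtain ⟨k, hk, htk⟩ := exists_mem_slot hN ht0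
    rw [ht2, Pi.sub_apply, ht1 k hk htk, ht3, ← dist_eq_norm]
    refine (hfρ ?_).le
    rw [dist_comm, Subtype.dist_eq, Real.dist_eq]
    have h1 : (gridTime T n k : ℝ) < t := htk.1
    have h2 : (t : ℝ) ≤ gridTime T n (k + 1) := htk.2
    rw [coe_gridTime T hN hk] at h2
    rw [coe_gridTime T hN hk.le] at h1 ⊢
    rw [abs_of_pos (sub_pos.2 h1)]
    have h3 : ((k + 1 : ℕ) : ℝ) * T / n = k * T / n + T / n := by push_cast; ring
    linarith
  have h1 := Lp.norm_le_of_ae_bound hη0.le hae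
  have h2 : ‖(gridL2 T n (fun k => f (gridTime T n k)) -
      ContinuousMap.toLp 2 (leb T) ℝ f : L2 T H₀)‖ ≤ c * η := by
    refine h1.trans_eq ?_
    rw [← leb_real_univ (T := T)] at hc
    rw [hc]
    rfl
  have h3 : c * η < δ / 2 := by
    rw [hη, mul_div_assoc', div_lt_div_iff₀ (by positivity) (by positivity)]
    nlinarith
  rw [dist_comm, dist_eq_norm] at hf
  calc _ ≤ _ := norm_sub_le_norm_sub_add_norm_sub _ (ContinuousMap.toLp 2 (leb T) ℝ f) _
    _ < δ := by linarith

end Density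

/-! ### The limit `ε → 0` and convergence in distribution -/

theorem smallEps_eq_atBot : smallEps = atBot := by
  rw [← comap_coe_Ioi_nhdsGT (0 : ℝ), smallEps, nhdsWithin, comap_inf, comap_principal,
    Subtype.coe_preimage_self, principal_univ, inf_top_eq]

instance instIsCountablyGeneratedSmallEps : smallEps.IsCountablyGenerated :=
  Filter.comap.isCountablyGenerated _ _

/-- A strictly decreasing sequence `e m → 0` has a left inverse `n` with `n(ε) → ∞` as `ε → 0`: let
`n(ε)` be the least `n` with `e n ≤ ε`. It turns a sequence of controls, one for each `e m`, into a
family of controls indexed by all `ε`. -/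
theorem exists_index_of_strictAnti {e : ℕ → Eps} (he : StrictAnti e)
    (he0 : Tendsto e atTop smallEps) :
    ∃ n : Eps → ℕ, (∀ m, n (e m) = m) ∧ Tendsto n smallEps atTop := by
  classical
  rw [smallEps_eq_atBot] at he0 ⊢
  have hex : ∀ ε, ∃ n, e n ≤ ε := fun ε => (he0.eventually (eventually_le_atBot ε)).exists
  refine ⟨fun ε => Nat.find (hex ε), fun m => ?_, tendsto_atTop.2 fun k => ?_⟩
  · rw [Nat.find_eq_iff]
    exact ⟨le_rfl, fun i hi => not_le.2 (he hi)⟩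
  · filter_upwards [eventually_lt_atBot (e k)] with ε hε
    refine (Nat.le_find_iff _ _).2 fun i hi => not_le.2 (hε.trans (he hi))

theorem exists_strictAnti_subseq {e : ℕ → Eps} (he0 : Tendsto e atTop smallEps) :
    ∃ φ : ℕ → ℕ, StrictMono φ ∧ StrictAnti (e ∘ φ) := by
  rw [smallEps_eq_atBot] at he0
  exact strictMono_subseq_of_tendsto_atTop (β := Epsᵒᵈ) (u := e) he0

section Distribution

variable {ι Ω Ω' S : Type*} [MeasurableSpace Ω] [MeasurableSpace Ω'] [TopologicalSpace S]
  [MeasurableSpace S] [BorelSpace S] {P : Measure Ω} [IsProbabilityMeasure P] {Q : Measure Ω'}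
  [IsProbabilityMeasure Q] {l : Filter ι} {X : ι → Ω → S} {Z : Ω' → S}

theorem tendsto_integral_of_tendstoInDistribution
    (h : TendstoInDistribution X l Z (fun _ => P) Q) (f : S →ᵇ ℝ) :
    Tendsto (fun i => ∫ ω, f (X i ω) ∂P) l (𝓝 (∫ ω, f (Z ω) ∂Q)) := by
  have h1 := ProbabilityMeasure.tendsto_iff_forall_integral_tendsto.1 h.tendsto f
  simp only [ProbabilityMeasure.coe_mk] at h1
  rw [integral_map h.aemeasurable_limit f.continuous.aestronglyMeasurable] at h1
  refine h1.congr fun i => ?_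
  exact integral_map (h.forall_aemeasurable i) f.continuous.aestronglyMeasurable

theorem tendstoInDistribution_id_of_tendsto_law (hX : ∀ i, Measurable (X i))
    {μ : ProbabilityMeasure S}
    (h : Tendsto (β := ProbabilityMeasure S) (fun i => ⟨P.map (X i),
      Measure.isProbabilityMeasure_map (hX i).aemeasurable⟩) l (𝓝 μ)) :
    TendstoInDistribution X l (fun u : S => u) (fun _ => P) (μ : Measure S) where
  forall_aemeasurable i := (hX i).aemeasurable
  aemeasurable_limit := aemeasurable_id'
  tendsto := by
    convert h using 1
    exact congrArg 𝓝 (Subtype.ext Measure.map_id')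

end Distribution

/-! ### The two Laplace bounds -/

section Laplace

variable {Ω : Type*} [mΩ : MeasurableSpace Ω] {P : Measure Ω} [IsProbabilityMeasure P]
  {T : ℝ} [Fact (0 < T)] {ℱ : Filtration (Time T) mΩ}
  {H₀ H : Type*} [NormedAddCommGroup H₀] [InnerProductSpace ℝ H₀] [CompleteSpace H₀]
  [NormedAddCommGroup H] [InnerProductSpace ℝ H] [CompleteSpace H]
  [TopologicalSpace.SeparableSpace H] [MeasurableSpace H] [BorelSpace H]
  {E : Type*} [TopologicalSpace E] [MeasurableSpace E] [BorelSpace E]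
  {J : H₀ →L[ℝ] H} {V : Ω → PathSpace T H} {α : Eps → ℝ}
  {g : Eps → PathSpace T H → E} {g₀ : PathSpace T H → E}

theorem isControlBdd_of_isStepControl {N : ℕ} {w : ℕ → Ω → H₀} (hw : IsStepControl ℱ N w) {M : ℝ≥0}
    (hM : ∀ ω, energy (gridL2 T N fun k => w k ω) ≤ M) :
    IsControlBdd P ℱ M (gridControl T N w) :=
  isControlBdd_gridControl hw.adapted hM

theorem measurable_toSBall_gridControl {N : ℕ} {w : ℕ → Ω → H₀} (hw : IsStepControl ℱ N w) {M : ℝ≥0}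
    (hM : ∀ ω, energy (gridL2 T N fun k => w k ω) ≤ M) :
    Measurable (toSBall M (gridControl T N w)) := by
  refine SBall.measurable_of_stronglyMeasurable_val ?_
  simp_rw [val_toSBall_gridControl (hM _)]
  exact hw.stronglyMeasurable_gridL2

/-- Every `u` in `L²(0, T; H₀)` gives an asymptotic upper bound of the scaled free energy:
deterministic step controls that converge to `u` in norm are inserted in the variational formula, and
hypothesis (H) identifies the limit of their images as the constant `g⁰(∫₀^· u ds)`. -/
theorem eventually_neg_log_le [TopologicalSpace.SeparableSpace H₀]
    (hV : IsWienerProcess P ℱ (J ∘L ContinuousLinearMap.adjoint J) V)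
    (hα : Tendsto α smallEps atTop) (hg : ∀ ε, Measurable (g ε))
    (hH : HypothesisH P ℱ J V α g g₀) (h : E →ᵇ ℝ) (u : L2 T H₀) {c : ℝ}
    (hc : 1 / 2 * energy u + h (g₀ (primitive J u)) < c) :
    ∀ᶠ ε in smallEps,
      -(1 / α ε * Real.log (∫ ω, Real.exp (-(α ε) * h (g ε (V ω))) ∂P)) < c := by
  have hchoose : ∀ ε : Eps, ∃ (N : ℕ) (a : ℕ → H₀),
      0 < N ∧ ‖gridL2 T N a - u‖ < min (ε : ℝ) 1 := fun ε =>
    exists_norm_gridL2_sub_lt u (lt_min ε.2 one_pos)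
  choose N a hN ha using hchoose
  set M : ℝ≥0 := ⟨(‖u‖ + 1) ^ 2, by positivity⟩ with hM
  have hM0 : 0 < M := by
    rw [← NNReal.coe_pos]
    change 0 < (‖u‖ + 1) ^ 2
    positivity
  have hbd : ∀ ε, energy (gridL2 T (N ε) (a ε)) ≤ M := by
    intro ε
    rw [energy_eq_norm_sq]
    change _ ≤ (‖u‖ + 1) ^ 2
    gcongr
    have h1 := norm_sub_norm_le (gridL2 T (N ε) (a ε)) u
    have h2 := (ha ε).le.trans (min_le_right _ _)
    linarith
  have hubd : energy u ≤ M := by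
    rw [energy_eq_norm_sq]
    change _ ≤ (‖u‖ + 1) ^ 2
    gcongr
    linarith
  have hstep : ∀ ε, IsStepControl ℱ (N ε) fun k (_ : Ω) => a ε k := fun ε =>
    { pos := hN ε
      adapted := fun k _ => stronglyMeasurable_const
      bounded := ⟨∑ k ∈ Finset.range (N ε), ‖a ε k‖, fun k hk _ =>
        Finset.single_le_sum (f := fun k => ‖a ε k‖) (fun _ _ => norm_nonneg _)
          (Finset.mem_range.2 hk)⟩ }
  have hval : ∀ ε ω, (toSBall M (gridControl T (N ε) fun k (_ : Ω) => a ε k) ω).val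
      = gridL2 T (N ε) (a ε) := fun ε ω => val_toSBall_gridControl (hbd ε)
  have hlim : Tendsto (fun ε => gridL2 T (N ε) (a ε)) smallEps (𝓝 u) := by
    rw [tendsto_iff_norm_sub_tendsto_zero]
    refine squeeze_zero (fun _ => norm_nonneg _)
      (fun ε => (ha ε).le.trans (min_le_left _ _)) ?_
    exact tendsto_comap
  set u' : SBall T H₀ M := ⟨u, hubd⟩ with hu'
  have hweak : ∀ ω, Tendsto (fun ε => toSBall M (gridControl T (N ε) fun k (_ : Ω) => a ε k) ω)
      smallEps (𝓝 u') := by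
    intro ω
    refine (Topology.IsInducing.tendsto_nhds_iff ⟨rfl⟩).2 ?_
    have h1 := ((toWeakSpaceCLM ℝ (L2 T H₀)).continuous.tendsto u).comp hlim
    refine h1.congr fun ε => ?_
    exact congrArg (toWeakSpace ℝ (L2 T H₀)) (hval ε ω).symm
  have hmeas : ∀ ε, Measurable (toSBall M (gridControl T (N ε) fun k (_ : Ω) => a ε k)) := fun ε =>
    measurable_toSBall_gridControl (hstep ε) fun _ => hbd ε
  have hdist := hH.weak_convergence M hM0 (fun ε => gridControl T (N ε) fun k (_ : Ω) => a ε k)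
    (fun ε => isControlBdd_of_isStepControl (hstep ε) fun _ => hbd ε) (Measure.dirac u')
    (tendstoInDistribution_id_of_tendsto_law hmeas (μ := ⟨Measure.dirac u', inferInstance⟩) (by
      have h1 := (tendstoInDistribution_of_ae_tendsto (μ' := P) (l := smallEps)
        (fun ε => (hmeas ε).aemeasurable) (aemeasurable_const (b := u'))
        (Eventually.of_forall hweak)).tendsto
      convert h1 using 1
      refine congrArg 𝓝 (Subtype.ext ?_)
      change Measure.dirac u' = P.map fun _ => u'
      rw [Measure.map_const, measure_univ, one_smul]))
  have hint := tendsto_integral_of_tendstoInDistribution hdist h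
  rw [integral_dirac] at hint
  have henergy : Tendsto (fun ε => 1 / 2 * energy (gridL2 T (N ε) (a ε))) smallEps
      (𝓝 (1 / 2 * energy u)) := by
    simp_rw [energy_eq_norm_sq]
    exact (hlim.norm.pow 2).const_mul _
  have hev := (henergy.add hint).eventually (gt_mem_nhds hc)
  filter_upwards [hev, hα.eventually_gt_atTop 0] with ε hε hαε
  refine lt_of_le_of_lt ?_ hε
  have hs : IsStepControl ℱ (N ε) fun k (_ : Ω) => √(α ε) • a ε k := (hstep ε).const_smul _
  have hb := hV.neg_log_le hs (Ψ := fun x => α ε * h (g ε x)) (K := α ε * (‖h‖ + 1))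
    ((h.continuous.measurable.comp (hg ε)).const_mul _) (by positivity) (fun x => by
      rw [abs_mul, abs_of_pos hαε]
      gcongr
      have := h.norm_coe_le_norm (g ε x)
      rw [Real.norm_eq_abs] at this
      linarith)
  simp only [shift, stepCost, gridL2_smul, primitive_smul, integral_const_mul, integral_const,
    probReal_univ, one_smul] at hb
  simp only [hval]
  have hsq : energy (√(α ε) • gridL2 T (N ε) (a ε)) = α ε * energy (gridL2 T (N ε) (a ε)) := by
    rw [energy_eq_norm_sq, energy_eq_norm_sq, norm_smul, mul_pow, Real.norm_eq_abs, sq_abs,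
      Real.sq_sqrt hαε.le]
  rw [hsq] at hb
  simp only [neg_mul] at hb ⊢
  rw [← mul_neg, one_div, inv_mul_le_iff₀ hαε]
  refine hb.trans_eq ?_
  ring

/-- Hypothesis (H) for controls given only along a strictly decreasing sequence of parameters. -/
theorem HypothesisH.tendsto_integral_seq (hH : HypothesisH P ℱ J V α g g₀) {M : ℝ≥0} (hM : 0 < M)
    {e : ℕ → Eps} (he : StrictAnti e) (he0 : Tendsto e atTop smallEps)
    {w : ℕ → Time T → Ω → H₀} (hw : ∀ n, IsControlBdd P ℱ M (w n))
    (hwm : ∀ n, Measurable (toSBall M (w n))) {μ : ProbabilityMeasure (SBall T H₀ M)}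
    (hμ : Tendsto (β := ProbabilityMeasure (SBall T H₀ M)) (fun n => ⟨P.map (toSBall M (w n)),
      Measure.isProbabilityMeasure_map (hwm n).aemeasurable⟩) atTop (𝓝 μ))
    (h : E →ᵇ ℝ) :
    AEMeasurable (fun u : SBall T H₀ M => g₀ (primitive J u.val)) μ ∧ Tendsto (fun n => ∫ ω, h (g (e n) (V ω + √(α (e n)) • primitive J (toSBall M (w n) ω).val)) ∂P)
      atTop (𝓝 (∫ u, h (g₀ (primitive J u.val)) ∂(μ : Measure (SBall T H₀ M)))) := by
  obtain ⟨n, hn, hn0⟩ := exists_index_of_strictAnti he he0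
  have h1 := hH.weak_convergence M hM (fun ε => w (n ε)) (fun ε => hw _)
    (μ : Measure (SBall T H₀ M))
    (tendstoInDistribution_id_of_tendsto_law (fun ε => hwm (n ε)) (hμ.comp hn0))
  refine ⟨h1.aemeasurable_limit, ?_⟩
  refine ((tendsto_integral_of_tendstoInDistribution h1 h).comp he0).congr fun m => ?_
  simp only [Function.comp_apply, hn]

/-- Asymptotic lower bound of the scaled free energy: nearly optimal controls of bounded energy have laws in the compact space of
probability measures on `S_M`; along a sequence violating the bound, a limit point of these laws
would have mean cost below the infimum `ℓ`. -/
theorem eventually_le_neg_log [TopologicalSpace.SeparableSpace H₀]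
    (hV : IsWienerProcess P ℱ (J ∘L ContinuousLinearMap.adjoint J) V)
    (hα : Tendsto α smallEps atTop) (hg : ∀ ε, Measurable (g ε))
    (hH : HypothesisH P ℱ J V α g g₀) (h : E →ᵇ ℝ) {ℓ c : ℝ}
    (hℓ : ∀ u : L2 T H₀, ℓ ≤ 1 / 2 * energy u + h (g₀ (primitive J u))) (hc : c < ℓ) :
    ∀ᶠ ε in smallEps,
      c < -(1 / α ε * Real.log (∫ ω, Real.exp (-(α ε) * h (g ε (V ω))) ∂P)) := by
  by_contra hcon
  rw [not_eventually] at hcon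
  obtain ⟨e₀, he₀, hbad₀⟩ := exists_seq_forall_of_frequently
    (hcon.and_eventually (hα.eventually_gt_atTop 0))
  set δ := (ℓ - c) / 4 with hδ
  have hδ0 : 0 < δ := by rw [hδ]; linarith
  set K : ℝ := ‖h‖ + 1 with hK
  have hK0 : 0 < K := by positivity
  have hhK : ∀ y, |h y| ≤ K := fun y => by
    have := h.norm_coe_le_norm y
    rw [Real.norm_eq_abs] at this
    rw [hK]; linarith
  -- The truncation level for which the error term of `IsWienerProcess.exists_scaled_le` is `δ`.
  set M : ℝ≥0 := ⟨4 * K * (2 * K + δ) / δ, by positivity⟩ with hM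
  have hMc : (M : ℝ) = 4 * K * (2 * K + δ) / δ := rfl
  have hM0 : (0 : ℝ) < M := by rw [hMc]; positivity
  have hME : 4 * K * (2 * K + δ) / M = δ := by
    rw [hMc]
    field_simp
  have hchoose : ∀ n, ∃ (N : ℕ) (w : ℕ → Ω → H₀), IsStepControl ℱ N w ∧
      (∀ ω, energy (gridL2 T N fun k => w k ω) ≤ M) ∧
      ∫ ω, stepCost T N w ω ∂P + ∫ ω, h (g (e₀ n) (V ω + √(α (e₀ n)) •
        primitive J (gridL2 T N fun k => w k ω))) ∂P ≤ c + 2 * δ := by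
    intro n
    obtain ⟨N, w, hw, hwM, hle⟩ := hV.exists_scaled_le
      (f := fun x => h (g (e₀ n) x)) (h.continuous.measurable.comp (hg _)) hK0
      (fun x => hhK _) (hbad₀ n).2 hM0 hδ0
    refine ⟨N, w, hw, hwM, hle.trans ?_⟩
    rw [hME]
    linarith [not_lt.1 (hbad₀ n).1]
  choose N w hw hwM hle using hchoose
  have hmeas : ∀ n, Measurable (toSBall M (gridControl T (N n) (w n))) := fun n =>
    measurable_toSBall_gridControl (hw n) (hwM n)
  let law : ℕ → ProbabilityMeasure (SBall T H₀ M) := fun n =>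
    ⟨P.map (toSBall M (gridControl T (N n) (w n))),
      Measure.isProbabilityMeasure_map (hmeas n).aemeasurable⟩
  obtain ⟨φ, hφ, hanti⟩ := exists_strictAnti_subseq he₀
  obtain ⟨μ, ψ, hψ, hμ⟩ := CompactSpace.tendsto_subseq (law ∘ φ)
  have hθ : StrictMono (φ ∘ ψ) := hφ.comp hψ
  obtain ⟨hg₀m, hB⟩ := hH.tendsto_integral_seq (NNReal.coe_pos.1 hM0) (e := e₀ ∘ (φ ∘ ψ))
    (hanti.comp_strictMono hψ)
    (he₀.comp hθ.tendsto_atTop) (w := fun n => gridControl T (N (φ (ψ n))) (w (φ (ψ n))))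
    (fun n => isControlBdd_of_isStepControl (hw _) (hwM _)) (fun n => hmeas _) hμ h
  obtain ⟨f, hf0, hfle, hflim⟩ := exists_continuous_tendsto_energy (T := T) (H₀ := H₀) M
  set B := ∫ u, h (g₀ (primitive J u.val)) ∂(μ : Measure (SBall T H₀ M)) with hBdef
  have hj : ∀ j, ∫ u, f j u ∂(μ : Measure (SBall T H₀ M)) + B ≤ c + 2 * δ := by
    intro j
    have h1 := ProbabilityMeasure.tendsto_iff_forall_integral_tendsto.1 hμ
      (BoundedContinuousFunction.mkOfCompact (f j))
    refine le_of_tendsto (h1.add hB) (Eventually.of_forall fun n => ?_)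
    have h2 := hle (φ (ψ n))
    have h3 : ∫ u, f j u ∂(law (φ (ψ n)) : Measure (SBall T H₀ M))
        ≤ ∫ ω, stepCost T (N (φ (ψ n))) (w (φ (ψ n))) ω ∂P := by
      change ∫ u, f j u ∂(P.map (toSBall M (gridControl T (N (φ (ψ n))) (w (φ (ψ n)))))) ≤ _
      rw [integral_map (hmeas _).aemeasurable (f j).continuous.aestronglyMeasurable]
      refine integral_mono_of_nonneg (Eventually.of_forall fun ω => hf0 _ _)
        (hw _).integrable_stepCost (Eventually.of_forall fun ω => ?_)
      refine (hfle _ _).trans_eq ?_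
      rw [val_toSBall_gridControl (hwM _ _), stepCost]
    have h4 : ∀ ω, (toSBall M (gridControl T (N (φ (ψ n))) (w (φ (ψ n)))) ω).val
        = gridL2 T (N (φ (ψ n))) fun k => w (φ (ψ n)) k ω := fun ω =>
      val_toSBall_gridControl (hwM _ ω)
    simp only [h4, Function.comp_apply, BoundedContinuousFunction.mkOfCompact_apply]
    linarith
  have hbound : ∀ u : SBall T H₀ M, 1 / 2 * energy u.val ≤ 1 / 2 * M := fun u => by
    have := u.2
    change energy u.val ≤ _ at this
    linarith
  have hdom : Tendsto (fun j => ∫ u, f j u ∂(μ : Measure (SBall T H₀ M))) atTop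
      (𝓝 (∫ u, 1 / 2 * energy u.val ∂(μ : Measure (SBall T H₀ M)))) := by
    refine tendsto_integral_of_dominated_convergence (fun _ => 1 / 2 * (M : ℝ))
      (fun j => (f j).continuous.aestronglyMeasurable) (integrable_const _)
      (fun j => Eventually.of_forall fun u => ?_) (Eventually.of_forall hflim)
    rw [Real.norm_eq_abs, abs_of_nonneg (hf0 j u)]
    exact (hfle j u).trans (hbound u)
  have hle1 : ∫ u, 1 / 2 * energy u.val ∂(μ : Measure (SBall T H₀ M)) + B ≤ c + 2 * δ :=
    le_of_tendsto (hdom.add_const B) (Eventually.of_forall hj)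
  have hEm : Measurable fun u : SBall T H₀ M => 1 / 2 * energy u.val :=
    measurable_of_tendsto_metrizable (fun j => (f j).continuous.measurable)
      (tendsto_pi_nhds.2 hflim)
  have hEi : Integrable (fun u : SBall T H₀ M => 1 / 2 * energy u.val)
      (μ : Measure (SBall T H₀ M)) := by
    refine integrable_of_abs_le (K := 1 / 2 * (M : ℝ)) hEm fun u => ?_
    rw [abs_of_nonneg (by rw [energy_eq_norm_sq]; positivity)]
    exact hbound u
  have hgi : Integrable (fun u : SBall T H₀ M => h (g₀ (primitive J u.val)))
      (μ : Measure (SBall T H₀ M)) := Integrable.of_bound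
      (h.continuous.measurable.comp_aemeasurable hg₀m).aestronglyMeasurable K
      (Eventually.of_forall fun u => hhK _)
  rw [hBdef, ← integral_add hEi hgi] at hle1
  have hge : ℓ ≤ ∫ u, (1 / 2 * energy u.val + h (g₀ (primitive J u.val)))
      ∂(μ : Measure (SBall T H₀ M)) := by
    calc ℓ = ∫ _, ℓ ∂(μ : Measure (SBall T H₀ M)) := by simp
      _ ≤ _ := integral_mono (integrable_const _) (hEi.add hgi) fun u => hℓ u.val
  rw [hδ] at hle1
  linarith

/-! ### The rate function -/

theorem bddBelow_cost (J : H₀ →L[ℝ] H) (g₀ : PathSpace T H → E) (h : E →ᵇ ℝ) :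
    BddBelow (Set.range fun u : L2 T H₀ => 1 / 2 * energy u + h (g₀ (primitive J u))) := by
  refine ⟨-‖h‖, ?_⟩
  rintro _ ⟨u, rfl⟩
  have h1 := (abs_le.1 ((Real.norm_eq_abs _).symm.trans_le
    (h.norm_coe_le_norm (g₀ (primitive J u))))).1
  have h2 : 0 ≤ energy u := by rw [energy_eq_norm_sq]; positivity
  change -‖h‖ ≤ 1 / 2 * energy u + h (g₀ (primitive J u))
  linarith

theorem iInf_add_rate (J : H₀ →L[ℝ] H) (g₀ : PathSpace T H → E) (h : E →ᵇ ℝ) :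
    ⨅ y : E, (((h y : ℝ) : EReal) + ((rate J g₀ y : ℝ≥0∞) : EReal))
      = ((⨅ u : L2 T H₀, (1 / 2 * energy u + h (g₀ (primitive J u))) : ℝ) : EReal) := by
  have hpos : ∀ u : L2 T H₀, 0 ≤ 1 / 2 * energy u := fun u => by
    rw [energy_eq_norm_sq]; positivity
  apply le_antisymm
  · refine EReal.le_of_forall_lt_iff_le.1 fun z hz => ?_
    obtain ⟨u, hu⟩ := exists_lt_of_ciInf_lt (EReal.coe_lt_coe_iff.1 hz)
    refine (iInf_le _ (g₀ (primitive J u))).trans ?_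
    have h1 : rate J g₀ (g₀ (primitive J u)) ≤ ENNReal.ofReal (1 / 2 * energy u) := by
      unfold rate
      exact iInf₂_le (f := fun (w : L2 T H₀) (_ : g₀ (primitive J u) = g₀ (primitive J w)) =>
        ENNReal.ofReal (1 / 2 * energy w)) u rfl
    have h2 : ((rate J g₀ (g₀ (primitive J u)) : ℝ≥0∞) : EReal) ≤ ((1 / 2 * energy u : ℝ) : EReal) := by
      refine (EReal.coe_ennreal_le_coe_ennreal_iff.2 h1).trans_eq ?_
      rw [EReal.coe_ennreal_ofReal, max_eq_left (hpos u)]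
    calc _ ≤ ((h (g₀ (primitive J u)) : ℝ) : EReal) + ((1 / 2 * energy u : ℝ) : EReal) := by gcongr
      _ ≤ z := by
        rw [← EReal.coe_add, EReal.coe_le_coe_iff]
        linarith
  · refine le_iInf fun y => ?_
    set ℓ := ⨅ u : L2 T H₀, (1 / 2 * energy u + h (g₀ (primitive J u))) with hℓ
    have h1 : ENNReal.ofReal (ℓ - h y) ≤ rate J g₀ y := by
      refine le_iInf₂ fun u hu => ENNReal.ofReal_le_ofReal ?_
      have := ciInf_le (bddBelow_cost J g₀ h) u
      rw [← hℓ] at this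
      rw [hu]
      linarith
    have h2 : ((ℓ - h y : ℝ) : EReal) ≤ ((rate J g₀ y : ℝ≥0∞) : EReal) := by
      refine le_trans ?_ (EReal.coe_ennreal_le_coe_ennreal_iff.2 h1)
      rw [EReal.coe_ennreal_ofReal, EReal.coe_le_coe_iff]
      exact le_max_left _ _
    calc (ℓ : EReal) = ((h y : ℝ) : EReal) + ((ℓ - h y : ℝ) : EReal) := by
          rw [← EReal.coe_add]; congr 1; ring
      _ ≤ _ := by gcongr

/-- The sublevel sets of the rate function are intersections of the compact sets `K_M`. -/
theorem lowerSemicontinuous_rate [T2Space E] (hH : HypothesisH P ℱ J V α g g₀) :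
    LowerSemicontinuous (rate J g₀) := by
  rw [lowerSemicontinuous_iff_isClosed_preimage]
  intro b
  induction b with
  | top => simp
  | coe b =>
    have : rate J g₀ ⁻¹' Set.Iic (b : ℝ≥0∞)
        = ⋂ η : Set.Ioi (0 : ℝ≥0), {y : E | ∃ u : SBall T H₀ (2 * (b + η)),
            g₀ (primitive J u.val) = y} := by
      ext y
      simp only [Set.mem_preimage, Set.mem_Iic, Set.mem_iInter, Set.mem_ofPred_eq]
      constructor
      · intro hy η
        have h1 : rate J g₀ y < (b + η : ℝ≥0) := by
          refine hy.trans_lt (ENNReal.coe_lt_coe.2 ?_)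
          exact lt_add_of_pos_right _ η.2
        simp only [rate, iInf_lt_iff] at h1
        obtain ⟨u, hu, hlt⟩ := h1
        have h2 : 1 / 2 * energy u < ((b + η : ℝ≥0) : ℝ) := by
          rw [← ENNReal.ofReal_coe_nnreal] at hlt
          exact (ENNReal.ofReal_lt_ofReal_iff_of_nonneg
            (by rw [energy_eq_norm_sq]; positivity)).1 hlt
        refine ⟨⟨u, ?_⟩, hu.symm⟩
        push_cast at h2 ⊢
        linarith
      · intro hy
        refine ENNReal.le_of_forall_pos_le_add fun η hη _ => ?_
        obtain ⟨u, hu⟩ := hy ⟨η, hη⟩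
        refine (iInf₂_le u.val hu.symm).trans ?_
        rw [← ENNReal.coe_add, ← ENNReal.ofReal_coe_nnreal]
        refine ENNReal.ofReal_le_ofReal ?_
        have h2 : energy u.val ≤ ((2 * (b + η) : ℝ≥0) : ℝ) := u.2
        push_cast at h2 ⊢
        linarith
    rw [this]
    exact isClosed_iInter fun η => (hH.isCompact_levels _).isClosed

end Laplace

end LaplacePrincipleWiener

open LaplacePrincipleWiener in
theorem theorem7p1
    {Ω : Type*} [mΩ : MeasurableSpace Ω] (P : Measure Ω) [IsProbabilityMeasure P]
    (T : ℝ) [Fact (0 < T)] (ℱ : Filtration (Time T) mΩ)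
    {H₀ H : Type*} [NormedAddCommGroup H₀] [InnerProductSpace ℝ H₀] [CompleteSpace H₀]
    [NormedAddCommGroup H] [InnerProductSpace ℝ H] [CompleteSpace H]
    [TopologicalSpace.SeparableSpace H] [MeasurableSpace H] [BorelSpace H]
    {E : Type*} [TopologicalSpace E] [PolishSpace E] [MeasurableSpace E] [BorelSpace E]
    (J : H₀ →L[ℝ] H) (hJ : Function.Injective J) (hJHS : IsHilbertSchmidt J)
    (V : Ω → PathSpace T H)
    (hV : IsWienerProcess P ℱ (J ∘L ContinuousLinearMap.adjoint J) V)
    (α : Eps → ℝ) (hα : Tendsto α smallEps atTop)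
    (g : Eps → PathSpace T H → E) (hg : ∀ ε, Measurable (g ε))
    (g₀ : PathSpace T H → E) (hH : HypothesisH P ℱ J V α g g₀) :
    LaplacePrinciple P (fun ε ω => g ε (V ω)) (rate J g₀) α := by
  have hsep : TopologicalSpace.SeparableSpace H₀ := hJHS.separableSpace hJ
  refine ⟨fun ε => ((hg ε).comp hV.measurable).aemeasurable, lowerSemicontinuous_rate hH, hα,
    fun h => ?_⟩
  rw [iInf_add_rate, ← EReal.coe_neg]
  refine (continuous_coe_real_ereal.tendsto _).comp ?_
  set ℓ := ⨅ u : L2 T H₀, (1 / 2 * energy u + h (g₀ (primitive J u))) with hℓ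
  have hlim : Tendsto (fun ε =>
      -(1 / α ε * Real.log (∫ ω, Real.exp (-(α ε) * h (g ε (V ω))) ∂P))) smallEps (𝓝 ℓ) := by
    refine tendsto_order.2 ⟨fun c hc => ?_, fun c hc => ?_⟩
    · exact eventually_le_neg_log hV hα hg hH h
        (fun u => ciInf_le (bddBelow_cost J g₀ h) u) hc
    · obtain ⟨u, hu⟩ := exists_lt_of_ciInf_lt hc
      exact eventually_neg_log_le hV hα hg hH h u hu
  simpa only [neg_neg] using hlim.neg
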